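/- Let $L$ be a connected link diagram with $n\ge 1$ crossings (considered up to isotopy on the sphere), and let $\langle L\rangle\in\mathbb Z[A,A^{-1}]$ be its Kauffman bracket: each crossing is replaced by $A$ times its $A$-smoothing plus $A^{-1}$ times its other smoothing, each circle contributes a factor $-A^2-A^{-2}$, and the empty diagram has bracket $1$. A cutting of $L$ is a nested sequence of disks, meeting $L$ transversally, that cut out tangles $T_0\subset T_1\subset\dots\subset T_N$, where $T_0$ is empty, $T_N$ is $L$, and in each step all components of $T_i\setminus T_{i-1}$ are arcs running from the boundary of $T_{i-1}$ to the boundary of $T_i$, except one, which contains at most one crossing. (So in a step one adds either a single crossing, or an arc without crossings that has both its ends on the boundary of $T_i$ or both on the boundary of $T_{i-1}$.) The girth of a cutting is the maximal number of boundary points of the tangles $T_i$, and the girth $g$ of $L$ is the minimal girth of its cuttings. Proposition. $\langle L\rangle$ can be computed along a cutting of minimal girth with $O(n2^g)$ memory and in time $O(2^g)$ times a polynomial in $n$ and $g$. Precisely: there are a single program for a random access machine over the integers (with constants, addition, subtraction, indirect loads and stores, and conditional jumps, at unit cost), a constant $C$ and a polynomial $p$ such that for every such $L$, with $n$ crossings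 and girth $g$: (1) $L$ has a cutting of girth $g$ with at most $n(g+1)$ steps; (2) given $L$ and any cutting of $L$ of girth $g$ with at most $n(g+1)$ steps, the program halts after at most $2^g\,p(n,g)$ instructions with $\langle L\rangle$ (its list of coefficients) as output; it uses only $C\,n\,2^g$ memory cells, input and output included, each of which holds one integer; and all integers that occur during the computation have absolute value at most $2^{C(n+g)}$. -/

import Mathlib

noncomputable section

namespace KauffmanGirth

/-! ## Link diagrams -/

/-- `(c, j)` is the `j`-th of the four half-edges at the crossing `c`. The half-edges at a
crossing are numbered counterclockwise; `0, 2` form the under-strand, `1, 3` the over-strand. -/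
abbrev Dart (n : ℕ) := Fin n × Fin 4

/-- The next half-edge, counterclockwise, at the same crossing. -/
def rot {n : ℕ} (d : Dart n) : Dart n := (d.1, d.2 + 1)

/-- The graph on the crossings in which two crossings are adjacent if an edge joins them. -/
def crossingGraph {n : ℕ} (link : Dart n → Dart n) : SimpleGraph (Fin n) :=
  SimpleGraph.fromRel fun c c' => ∃ j k, link (c, j) = (c', k)

/-- The number of faces, counted separately in each connected component: the number of
cycles of the permutation `rot ∘ link` of the half-edges. -/
def faceCount {n : ℕ} (link : Dart n → Dart n) : ℕ :=
  Nat.card (Quot fun d e : Dart n => e = rot (link d))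

/-- A link diagram with `n` crossings in which every component of the projection has a crossing,
as a planar 4-valent combinatorial map: `link` sends each half-edge to the
other half of its edge. There are `n` vertices and `2 n` edges, so `planar` is Euler's formula
(genus zero in every connected component). -/
structure LinkDiagram (n : ℕ) where
  link : Dart n → Dart n
  link_link : ∀ d, link (link d) = d
  link_ne : ∀ d, link d ≠ d
  planar : faceCount link = n + 2 * Nat.card (crossingGraph link).ConnectedComponent

/-- The projection is connected (and has at least one crossing). -/
def LinkDiagram.Connected {n : ℕ} (L : LinkDiagram n) : Prop :=
  (crossingGraph L.link).Connected

/-! ## The Kauffman bracket -/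

/-- Smoothing of a crossing. The `A`-smoothing (`true`) merges the two regions swept out by
turning the over-strand counterclockwise, so it joins the half-edges `0, 1` and `2, 3`;
the other one (`false`) joins `1, 2` and `3, 0`. -/
def smoothing : Bool → Fin 4 → Fin 4
  | true => ![1, 0, 3, 2]
  | false => ![3, 2, 1, 0]

/-- The number of circles left after smoothing every crossing as `s` says. -/
def LinkDiagram.loopCount {n : ℕ} (L : LinkDiagram n) (s : Fin n → Bool) : ℕ :=
  Nat.card (Quot fun d e : Dart n => e = L.link d ∨ e = (d.1, smoothing (s d.1) d.2))

/-- The Kauffman bracket in `ℤ[A, A⁻¹]` (`A` is `T 1`), i.e. the coefficient of the empty diagram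
in the skein module of the disk without boundary points: each crossing is
`A • (A-smoothing) + A⁻¹ • (other smoothing)`, each circle is a factor `-A² - A⁻²`, and the
empty diagram has bracket `1`. -/
def LinkDiagram.bracket {n : ℕ} (L : LinkDiagram n) : LaurentPolynomial ℤ :=
  ∑ s : Fin n → Bool,
    (∏ c, LaurentPolynomial.T (if s c then 1 else -1)) *
      (-LaurentPolynomial.T 2 - LaurentPolynomial.T (-2)) ^ L.loopCount s

/-! ## Cuttings and girth

A nested sequence of disks is recorded through the pieces of the diagram in the successive annuli
between them. Up to isotopy such a piece consists of radial strands and one further component,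
which contains at most one crossing. It is therefore of one of three kinds: an arc with both ends
on the outer circle (`cup`), an arc with both ends on the inner circle (`cap`), or a crossing whose
half-edges run to the inner circle, to the outer circle, or to each other (`crossing`). -/

/-- What is found by entering the disk at a boundary point: the half-edge of a crossing or
one of the two ends of the `k`-th crossingless arc. -/
inductive StrandEnd (n : ℕ)
  | dart (d : Dart n)
  | cup (k : ℕ) (b : Bool)

/-- Is this a half-edge of the crossing `c`? -/
def StrandEnd.isAt {n : ℕ} (c : Fin n) : StrandEnd n → Bool
  | .dart d => decide (d.1 = c)
  | .cup _ _ => false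

/-- The part of a diagram inside a disk: the boundary points in counterclockwise order (a cyclic
list, cut open at an arbitrary place), the pairs of ends that have been joined,
and the number of crossingless arcs introduced so far. -/
structure Tangle (n : ℕ) where
  boundary : List (StrandEnd n)
  joins : List (StrandEnd n × StrandEnd n)
  cups : ℕ

/-- The empty tangle. -/
def Tangle.empty (n : ℕ) : Tangle n := ⟨[], [], 0⟩

/-- Join the boundary points number `q` and `q + 1` (cyclically) by an arc outside the disk,
provided the pair of them is admissible. -/
def Tangle.close {n : ℕ} (ok : StrandEnd n → StrandEnd n → Bool) (T : Tangle n) (q : ℕ) :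
    Option (Tangle n) :=
  if q < T.boundary.length then
    match T.boundary.rotate q with
    | x :: y :: rest => if ok x y then some ⟨rest, (x, y) :: T.joins, T.cups⟩ else none
    | _ => none
  else none

/-- One step of a cutting. `p` and `q` are positions on the boundary circle. In `crossing c j p qs`
the crossing `c` is put next to the disk at position `p`, with the corner between its half-edges
`j - 1` and `j` facing the disk; then the adjacent pairs at the positions `qs` are joined. -/
inductive Move (n : ℕ)
  | cup (p : ℕ)
  | cap (q : ℕ)
  | crossing (c : Fin n) (j : Fin 4) (p : ℕ) (qs : List ℕ)

/-- The effect of a step. In a crossing step each joined pair must contain a half-edge of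
the new crossing, so that all new arcs belong to the component of that crossing. -/
def Move.apply {n : ℕ} (T : Tangle n) : Move n → Option (Tangle n)
  | .cup p =>
      if p ≤ T.boundary.length then
        some ⟨.cup T.cups false :: .cup T.cups true :: T.boundary.rotate p, T.joins, T.cups + 1⟩
      else none
  | .cap q => T.close (fun _ _ => true) q
  | .crossing c j p qs =>
      if p ≤ T.boundary.length then
        qs.foldlM (Tangle.close fun x y => x.isAt c || y.isAt c)
          ⟨[.dart (c, j), .dart (c, j + 1), .dart (c, j + 2), .dart (c, j + 3)] ++
            T.boundary.rotate p, T.joins, T.cups⟩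
      else none

/-- The crossing added by a step, if there is one. -/
def Move.crossing? {n : ℕ} : Move n → Option (Fin n)
  | .crossing c _ _ _ => some c
  | _ => none

/-- The tangle built by a sequence of steps from the empty tangle. -/
def build {n : ℕ} (moves : List (Move n)) : Option (Tangle n) :=
  moves.foldlM Move.apply (Tangle.empty n)

/-- Two ends lie on a common edge of the tangle: the equivalence relation generated by the joins
and by the crossingless arcs. -/
def Tangle.SameEdge {n : ℕ} (T : Tangle n) : StrandEnd n → StrandEnd n → Prop :=
  Relation.EqvGen fun x y =>
    (x, y) ∈ T.joins ∨ ∃ k < T.cups, x = .cup k false ∧ y = .cup k true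

/-- The tangle has no boundary points, its edges are those of `L`, and it has no closed curve
without crossings. -/
def Tangle.Presents {n : ℕ} (T : Tangle n) (L : LinkDiagram n) : Prop :=
  T.boundary = [] ∧
  (∀ d e : Dart n, T.SameEdge (.dart d) (.dart e) ↔ e = d ∨ e = L.link d) ∧
  ∀ k < T.cups, ∃ d : Dart n, T.SameEdge (.cup k false) (.dart d)

/-- A cutting of `L`: a sequence of steps from the empty tangle to `L`, in which
every crossing of `L` is added exactly once. -/
structure LinkDiagram.Cutting {n : ℕ} (L : LinkDiagram n) where
  moves : List (Move n)
  crossings : (moves.filterMap Move.crossing?).Perm (List.finRange n)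
  presents : ∃ T, build moves = some T ∧ T.Presents L

/-- The girth of a cutting: the maximal number of boundary points of its tangles. -/
def LinkDiagram.Cutting.girth {n : ℕ} {L : LinkDiagram n} (c : L.Cutting) : ℕ :=
  (Finset.range (c.moves.length + 1)).sup fun i =>
    ((build (c.moves.take i)).map fun T => T.boundary.length).getD 0

/-- The girth of a diagram: the minimal girth of its cuttings. -/
def LinkDiagram.girth {n : ℕ} (L : LinkDiagram n) : ℕ :=
  sInf (Set.range fun c : L.Cutting => c.girth)

/-! ## Random access machines over the integers -/

/-- Instructions of a random access machine with finitely many named registers and an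
unbounded memory; each register and each memory cell holds one integer. -/
inductive Instr
  | const (dst : ℕ) (z : ℤ)
  | add (dst a b : ℕ)
  | sub (dst a b : ℕ)
  | load (dst addr : ℕ)
  | store (addr src : ℕ)
  | jumpPos (a target : ℕ)

/-- Configurations: program counter, registers, memory. -/
structure Config where
  pc : ℕ
  reg : ℕ → ℤ
  mem : ℕ → ℤ

/-- The effect of one instruction. `load` and `store` address the memory indirectly, through the
content of the register `addr`. -/
def Instr.exec (s : Config) : Instr → Config
  | .const dst z => ⟨s.pc + 1, Function.update s.reg dst z, s.mem⟩
  | .add dst a b => ⟨s.pc + 1, Function.update s.reg dst (s.reg a + s.reg b), s.mem⟩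
  | .sub dst a b => ⟨s.pc + 1, Function.update s.reg dst (s.reg a - s.reg b), s.mem⟩
  | .load dst addr => ⟨s.pc + 1, Function.update s.reg dst (s.mem (s.reg addr).toNat), s.mem⟩
  | .store addr src => ⟨s.pc + 1, s.reg, Function.update s.mem (s.reg addr).toNat (s.reg src)⟩
  | .jumpPos a target => ⟨if 0 < s.reg a then target else s.pc + 1, s.reg, s.mem⟩

/-- The instruction only touches memory cells with addresses below `S`. -/
def Instr.accessBelow (S : ℕ) (s : Config) : Instr → Prop
  | .load _ addr => 0 ≤ s.reg addr ∧ s.reg addr < S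
  | .store addr _ => 0 ≤ s.reg addr ∧ s.reg addr < S
  | _ => True

/-- One step; the machine halts when the program counter leaves the program. -/
def Config.next (code : List Instr) (s : Config) : Config :=
  match code[s.pc]? with
  | some i => i.exec s
  | none => s

/-- The initial configuration: the input is in the first memory cells, all else is zero. -/
def Config.init (input : List ℤ) : Config :=
  ⟨0, fun _ => 0, fun i => input.getD i 0⟩

/-- The configuration holds the Laurent polynomial `f` in memory cells below `S`: register 0 is the
exponent of the first coefficient, register 1 the number of coefficients (one for each
exponent, in increasing order), register 2 the address of the first one. -/
def Config.Holds (s : Config) (S : ℕ) (f : LaurentPolynomial ℤ) : Prop :=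
  0 ≤ s.reg 1 ∧ 0 ≤ s.reg 2 ∧ s.reg 2 + s.reg 1 ≤ S ∧
  f = ∑ i ∈ Finset.range (s.reg 1).toNat,
    LaurentPolynomial.C (s.mem ((s.reg 2).toNat + i)) * LaurentPolynomial.T (s.reg 0 + i)

/-- On this input the program halts within `time` instructions and outputs `f`; input, output
and all memory accesses are confined to the first `space` cells, and throughout the computation
all registers and memory cells hold integers of absolute value at most `2 ^ bits`. -/
def Computes (code : List Instr) (input : List ℤ) (f : LaurentPolynomial ℤ)
    (time space bits : ℕ) : Prop :=
  input.length ≤ space ∧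
  ∃ t ≤ time,
    (∀ u ≤ t,
      (∀ i, |((Config.next code)^[u] (Config.init input)).reg i| ≤ 2 ^ bits) ∧
      (∀ i, |((Config.next code)^[u] (Config.init input)).mem i| ≤ 2 ^ bits) ∧
      ∀ ins ∈ code[((Config.next code)^[u] (Config.init input)).pc]?,
        ins.accessBelow space ((Config.next code)^[u] (Config.init input))) ∧
    code.length ≤ ((Config.next code)^[t] (Config.init input)).pc ∧
    ((Config.next code)^[t] (Config.init input)).Holds space f

/-! ## Input format -/

/-- A diagram as a list of integers: `n`, then for each half-edge, in lexicographic order, the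
number `4 c + j` of the other half `(c, j)` of its edge. -/
def LinkDiagram.encode {n : ℕ} (L : LinkDiagram n) : List ℤ :=
  (n : ℤ) :: (List.finRange n).flatMap fun c => (List.finRange 4).map fun j =>
    (4 * ((L.link (c, j)).1 : ℕ) + ((L.link (c, j)).2 : ℕ) : ℤ)

/-- A step of a cutting as a list of integers. -/
def Move.encode {n : ℕ} : Move n → List ℤ
  | .cup p => [0, p]
  | .cap q => [1, q]
  | .crossing c j p qs =>
      [2, ((c : ℕ) : ℤ), ((j : ℕ) : ℤ), p, qs.length] ++ qs.map fun q : ℕ => (q : ℤ)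

/-- A cutting as a list of integers: the number of steps, then the steps. -/
def LinkDiagram.Cutting.encode {n : ℕ} {L : LinkDiagram n} (c : L.Cutting) : List ℤ :=
  (c.moves.length : ℤ) :: c.moves.flatMap Move.encode

end KauffmanGirth

end

/-! The bracket is computed by a transfer matrix in a spin model. Every boundary point carries a
spin in `Bool`, and the state of a tangle with m boundary points, read from a cut point of its
circle, is a function from spin lists of length m to Laurent polynomials. For a smoothed tangle the
boundary points are matched by planar arcs; its state is the product of the weights `cupW` of these
arcs, times a factor `loopVal` for every closed circle. Three identities make this consistent:
`rotW_mul_cupW` (the cut point moves past an end of an arc), `cap_cup_same` (an arc closes up to a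
circle of value -A² - A⁻²) and `cap_cup_cup` (two arcs are joined to one). Spin lists are binary
numbers, so a state is a table with 2^m entries, and each elementary step is a linear map consisting
of at most eight shifted additions of rows of the table. No enumeration of planar matchings is
needed.

Correctness is checked one smoothing at a time. `PInv` describes the state by a planar matching and
a number ℓ of circles, which is tied to the number of connected pieces; at the end ℓ is the number
of circles of the smoothed diagram (`PInv.loopCount`). By linearity (`runOp_braW`) the computed
state is the weighted sum over all smoothings, and for the full diagram this is the bracket
(`runOp_bracket`). The same expansion gives a priori bounds (`bdd_runOp`): every intermediate tangle
extends to L and circles never disappear, so there are at most 4 n of them; exponents are at most 9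
n plus the number of boundary points, and coefficients at most 2^(5 n). Hence rows of O(n) cells
suffice. Inside a crossing step up to four more points are exposed, which costs a constant factor
16.

Two facts about cuttings are needed. First, the girth is at most 2 n + 2 (`exists_cutting_le`),
which bounds the exponents by a multiple of n and shows that the minimal girth is attained. The
crossings are added along a spanning tree, so that no face is closed off; then Euler's formula and
the pigeonhole principle always yield two neighbouring boundary points that can be joined. Second,
every cutting can be shortened without raising its girth (`exists_short_cutting`): arcs added
without crossings are postponed; a later join either straightens such an arc, or commutes with it,
or lowers the number of boundary points. This leaves at most g + 1 steps for each crossing.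

The program is written with blocks, sequences and loops, and verified by triples `Tri` that record
time, memory and the size of integers together with the result. -/

noncomputable section

namespace KauffmanGirth

open LaurentPolynomial (T)

/-! ## Structured programs for the random access machine -/

/-- While-programs. Register 29 is reserved for the control flow. -/
inductive Cmd
  | block (l : List Instr)
  | seq (c d : Cmd)
  | loop (a : ℕ) (c : Cmd)

def Cmd.size : Cmd → ℕ
  | .block l => l.length
  | .seq c d => c.size + d.size
  | .loop _ c => c.size + 3

/-- The machine code of a while-program that is placed at address `k`. -/
def Cmd.compile : Cmd → ℕ → List Instr
  | .block l, _ => l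
  | .seq c d, k => c.compile k ++ d.compile (k + c.size)
  | .loop a c, k =>
      -- The test stands behind the body. The first two instructions form an unconditional jump to
      -- it, so the body is executed as long as register `a` is positive, possibly never.
      .const 29 1 :: .jumpPos 29 (k + 2 + c.size) :: (c.compile (k + 2) ++ [.jumpPos a (k + 2)])

theorem Cmd.length_compile (c : Cmd) : ∀ k, (c.compile k).length = c.size := by
  induction c with
  | block l => intro k; rfl
  | seq c d hc hd => intro k; simp [compile, size, hc, hd]
  | loop a c hc => intro k; simp [compile, size, hc]

/-- Registers and memory. -/
structure Store where
  reg : ℕ → ℤ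
  mem : ℕ → ℤ

def Store.at (s : Store) (k : ℕ) : Config := ⟨k, s.reg, s.mem⟩

def Store.Bd (B : ℤ) (s : Store) : Prop := (∀ i, |s.reg i| ≤ B) ∧ ∀ i, |s.mem i| ≤ B

def Store.set (s : Store) (i : ℕ) (z : ℤ) : Store := ⟨Function.update s.reg i z, s.mem⟩

/-- The effect of an instruction that is not a jump. -/
def Instr.act (s : Store) : Instr → Store
  | .const dst z => ⟨Function.update s.reg dst z, s.mem⟩
  | .add dst a b => ⟨Function.update s.reg dst (s.reg a + s.reg b), s.mem⟩
  | .sub dst a b => ⟨Function.update s.reg dst (s.reg a - s.reg b), s.mem⟩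
  | .load dst addr => ⟨Function.update s.reg dst (s.mem (s.reg addr).toNat), s.mem⟩
  | .store addr src => ⟨s.reg, Function.update s.mem (s.reg addr).toNat (s.reg src)⟩
  | .jumpPos _ _ => s

/-- The instruction is not a jump, it respects the bound `B` on integers and the bound `S` on
addresses. -/
def Instr.Ok (S : ℕ) (B : ℤ) (s : Store) : Instr → Prop
  | .const _ z => |z| ≤ B
  | .add _ a b => |s.reg a + s.reg b| ≤ B
  | .sub _ a b => |s.reg a - s.reg b| ≤ B
  | .load _ addr => 0 ≤ s.reg addr ∧ s.reg addr < S
  | .store addr _ => 0 ≤ s.reg addr ∧ s.reg addr < S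
  | .jumpPos _ _ => False

theorem abs_update_le {f : ℕ → ℤ} {B z : ℤ} (hf : ∀ i, |f i| ≤ B) (hz : |z| ≤ B) (j i : ℕ) :
    |Function.update f j z i| ≤ B := by
  rw [Function.update_apply]; split_ifs
  · exact hz
  · exact hf i

theorem Instr.bd_act {S : ℕ} {B : ℤ} {s : Store} {i : Instr} (hs : s.Bd B) (hi : i.Ok S B s) :
    (i.act s).Bd B := by
  cases i with
  | const dst z => exact ⟨abs_update_le hs.1 hi _, hs.2⟩
  | add dst a b => exact ⟨abs_update_le hs.1 hi _, hs.2⟩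
  | sub dst a b => exact ⟨abs_update_le hs.1 hi _, hs.2⟩
  | load dst addr => exact ⟨abs_update_le hs.1 (hs.2 _) _, hs.2⟩
  | store addr src => exact ⟨hs.1, abs_update_le hs.2 (hs.1 _) _⟩
  | jumpPos a t => exact hs

/-- These are the conditions that `Computes` imposes on each single configuration. -/
def SafeAt (code : List Instr) (S : ℕ) (B : ℤ) (x : Config) : Prop :=
  (∀ i, |x.reg i| ≤ B) ∧ (∀ i, |x.mem i| ≤ B) ∧ ∀ ins ∈ code[x.pc]?, ins.accessBelow S x

/-- The machine gets from `x` to `y` in `t` steps, and all configurations before `y` are safe. -/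
def Reach (code : List Instr) (S : ℕ) (B : ℤ) (x : Config) (t : ℕ) (y : Config) : Prop :=
  (Config.next code)^[t] x = y ∧ ∀ u < t, SafeAt code S B ((Config.next code)^[u] x)

theorem Reach.refl {code : List Instr} {S : ℕ} {B : ℤ} {x : Config} : Reach code S B x 0 x :=
  ⟨rfl, fun _ h => absurd h (by omega)⟩

theorem Reach.trans {code : List Instr} {S : ℕ} {B : ℤ} {x y z : Config} {t u : ℕ}
    (h : Reach code S B x t y) (h' : Reach code S B y u z) : Reach code S B x (t + u) z := by
  constructor
  · rw [add_comm, Function.iterate_add_apply, h.1, h'.1]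
  · intro v hv
    by_cases hvt : v < t
    · exact h.2 v hvt
    · obtain ⟨w, rfl⟩ := Nat.exists_eq_add_of_le (not_lt.1 hvt)
      rw [add_comm, Function.iterate_add_apply, h.1]
      exact h'.2 w (by omega)

theorem Reach.step {code : List Instr} {S : ℕ} {B : ℤ} {x : Config} (h : SafeAt code S B x) :
    Reach code S B x 1 (Config.next code x) :=
  ⟨rfl, fun u hu => by obtain rfl : u = 0 := by omega
                       exact h⟩

/-- The code contains `l` at address `k`. -/
def Sits (code : List Instr) (k : ℕ) (l : List Instr) : Prop :=
  ∃ pre post, code = pre ++ l ++ post ∧ pre.length = k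

theorem Sits.left {code l l' : List Instr} {k : ℕ} (h : Sits code k (l ++ l')) : Sits code k l := by
  obtain ⟨pre, post, rfl, hk⟩ := h
  exact ⟨pre, l' ++ post, by simp, hk⟩

theorem Sits.right {code l l' : List Instr} {k : ℕ} (h : Sits code k (l ++ l')) :
    Sits code (k + l.length) l' := by
  obtain ⟨pre, post, rfl, hk⟩ := h
  exact ⟨pre ++ l, post, by simp, by simp [hk]⟩

theorem Sits.head {code l : List Instr} {i : Instr} {k : ℕ} (h : Sits code k (i :: l)) :
    code[k]? = some i := by
  obtain ⟨pre, post, rfl, rfl⟩ := h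
  simp

theorem Sits.tail {code l : List Instr} {i : Instr} {k : ℕ} (h : Sits code k (i :: l)) :
    Sits code (k + 1) l :=
  Sits.right (l := [i]) h

/-- Started in `s`, the program ends within `t` steps and safely in a state that satisfies `Q`. -/
def Tri (S : ℕ) (B : ℤ) (c : Cmd) (s : Store) (t : ℕ) (Q : Store → Prop) : Prop :=
  -- Quantifying over all programs that contain the compiled code somewhere makes triples
  -- composable; the bound on integers is passed from start to end.
  s.Bd B → ∀ code k, Sits code k (c.compile k) →
    ∃ t' ≤ t, ∃ s', Reach code S B (s.at k) t' (s'.at (k + c.size)) ∧ s'.Bd B ∧ Q s'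

section rules

variable {S : ℕ} {B : ℤ} {s : Store} {Q Q' : Store → Prop} {t t' : ℕ} {c d : Cmd}

theorem Tri.mono (h : Tri S B c s t Q) (ht : t ≤ t') (hQ : ∀ s', s'.Bd B → Q s' → Q' s') :
    Tri S B c s t' Q' := by
  intro hs code k hc
  obtain ⟨u, hu, s', h1, h2, h3⟩ := h hs code k hc
  exact ⟨u, hu.trans ht, s', h1, h2, hQ s' h2 h3⟩

/-- The postcondition of the first command is the triple of the second one, so no intermediate
assertion has to be named. -/
theorem Tri.seq (h : Tri S B c s t fun s' => Tri S B d s' t' Q) :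
    Tri S B (c.seq d) s (t + t') Q := by
  intro hs code k hc
  obtain ⟨u, hu, s', h1, h2, h3⟩ := h hs code k hc.left
  have hr := hc.right
  rw [Cmd.length_compile] at hr
  obtain ⟨u', hu', s'', h1', h2', h3'⟩ := h3 h2 code _ hr
  refine ⟨u + u', by omega, s'', ?_, h2', h3'⟩
  simpa [Cmd.size, add_assoc] using h1.trans h1'

theorem Tri.nil (h : Q s) : Tri S B (.block []) s 0 Q :=
  fun hs _ _ _ => ⟨0, le_rfl, s, Reach.refl, hs, h⟩

theorem Tri.cons {i : Instr} {l : List Instr} (hi : i.Ok S B s)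
    (h : Tri S B (.block l) (i.act s) t Q) : Tri S B (.block (i :: l)) s (t + 1) Q := by
  intro hs code k hc
  have hb := Instr.bd_act hs hi
  obtain ⟨u, hu, s', h1, h2, h3⟩ := h hb code (k + 1) hc.tail
  have hk : code[k]? = some i := hc.head
  refine ⟨1 + u, by omega, s', ?_, h2, h3⟩
  have hsafe : SafeAt code S B (s.at k) := by
    refine ⟨hs.1, hs.2, ?_⟩
    intro ins hins
    have : ins = i := by simpa [Store.at, hk, eq_comm] using hins
    subst this
    cases ins <;> trivial
  have hn : Config.next code (s.at k) = (i.act s).at (k + 1) := by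
    simp only [Config.next, Store.at, hk]
    cases i <;> first | rfl | exact hi.elim
  have := (Reach.step hsafe).trans (hn ▸ h1)
  have e : k + 1 + (Cmd.block l).size = k + (Cmd.block (i :: l)).size := by
    simp [Cmd.size]; omega
  rwa [e] at this

/-- The invariant is indexed by the number of rounds that remain: a positive index forces the test
to succeed, index 0 forces it to fail. A round costs one jump besides its body; the additional 3
counts the two instructions in front of the body and the last, failing test. -/
theorem Tri.loop {a m : ℕ} (hB : 1 ≤ B) (I : ℕ → Store → Prop) (h0 : I m (s.set 29 1))
    (hstep : ∀ j s', j < m → I (j + 1) s' → 0 < s'.reg a ∧ Tri S B c s' t (I j))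
    (hend : ∀ s', I 0 s' → s'.reg a ≤ 0 ∧ Q s') :
    Tri S B (.loop a c) s (m * (t + 1) + 3) Q := by
  intro hs code k hc
  have hc2 : Sits code (k + 2) (c.compile (k + 2) ++ [.jumpPos a (k + 2)]) := hc.tail.tail
  have hcb := hc2.left
  have hcj := hc2.right.head
  rw [Cmd.length_compile] at hcj
  -- Induction on the remaining rounds, always starting from the test behind the body.
  have key : ∀ j s', j ≤ m → s'.Bd B → I j s' → ∃ t' ≤ j * (t + 1) + 1, ∃ s'',
      Reach code S B (s'.at (k + 2 + c.size)) t' (s''.at (k + 2 + c.size + 1)) ∧ s''.Bd B ∧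
        Q s'' := by
    intro j
    induction j with
    | zero =>
      intro s' _ hb hI
      obtain ⟨h1, h2⟩ := hend s' hI
      refine ⟨1, by omega, s', ?_, hb, h2⟩
      have hsafe : SafeAt code S B (s'.at (k + 2 + c.size)) := by
        refine ⟨hb.1, hb.2, ?_⟩
        intro ins hins
        have : ins = .jumpPos a (k + 2) := by simpa [Store.at, hcj, eq_comm] using hins
        subst this; trivial
      have hn : Config.next code (s'.at (k + 2 + c.size)) = s'.at (k + 2 + c.size + 1) := by
        simp [Config.next, Store.at, hcj, Instr.exec, not_lt.2 h1]
      exact hn ▸ Reach.step hsafe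
    | succ j ih =>
      intro s' hj hb hI
      obtain ⟨h1, h2⟩ := hstep j s' hj hI
      have hsafe : SafeAt code S B (s'.at (k + 2 + c.size)) := by
        refine ⟨hb.1, hb.2, ?_⟩
        intro ins hins
        have : ins = .jumpPos a (k + 2) := by simpa [Store.at, hcj, eq_comm] using hins
        subst this; trivial
      have hn : Config.next code (s'.at (k + 2 + c.size)) = s'.at (k + 2) := by
        simp [Config.next, Store.at, hcj, Instr.exec, h1]
      obtain ⟨u, hu, s1, r1, b1, I1⟩ := h2 hb code (k + 2) hcb
      obtain ⟨u', hu', s2, r2, b2, q2⟩ := ih s1 (by omega) b1 I1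
      refine ⟨1 + u + u', ?_, s2, ((hn ▸ Reach.step hsafe).trans r1).trans r2, b2, q2⟩
      rw [Nat.succ_mul]; omega
  have hb1 : (s.set 29 1).Bd B := ⟨abs_update_le hs.1 (by simpa using hB) _, hs.2⟩
  have hk := hc.head
  have hk1 := hc.tail.head
  have hsafe : SafeAt code S B (s.at k) := by
    refine ⟨hs.1, hs.2, ?_⟩
    intro ins hins
    have : ins = .const 29 1 := by simpa [Store.at, hk, eq_comm] using hins
    subst this; trivial
  have hn : Config.next code (s.at k) = (s.set 29 1).at (k + 1) := by
    simp [Config.next, Store.at, hk, Instr.exec, Store.set]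
  have hsafe1 : SafeAt code S B ((s.set 29 1).at (k + 1)) := by
    refine ⟨hb1.1, hb1.2, ?_⟩
    intro ins hins
    have : ins = .jumpPos 29 (k + 2 + c.size) := by simpa [Store.at, hk1, eq_comm] using hins
    subst this; trivial
  have hn1 : Config.next code ((s.set 29 1).at (k + 1)) = (s.set 29 1).at (k + 2 + c.size) := by
    simp [Config.next, Store.at, hk1, Instr.exec, Store.set]
  obtain ⟨u, hu, s2, r2, b2, q2⟩ := key m _ le_rfl hb1 h0
  refine ⟨1 + 1 + u, by omega, s2, ?_, b2, q2⟩
  have := ((hn ▸ Reach.step hsafe).trans (hn1 ▸ Reach.step hsafe1)).trans r2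
  have e : k + 2 + c.size + 1 = k + (Cmd.loop a c).size := by simp [Cmd.size]; omega
  rwa [e] at this

theorem Tri.imp (h : Tri S B c s t Q) (hQ : ∀ s', s'.Bd B → Q s' → Q' s') : Tri S B c s t Q' :=
  h.mono le_rfl hQ

theorem Tri.le (h : Tri S B c s t Q) (ht : t ≤ t') : Tri S B c s t' Q :=
  h.mono ht fun _ _ => id

end rules

theorem Tri.computes {S t bits : ℕ} {c : Cmd} {input : List ℤ} {f : LaurentPolynomial ℤ}
    (hlen : input.length ≤ S) (hin : ∀ z ∈ input, |z| ≤ 2 ^ bits)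
    (h : Tri S (2 ^ bits) c ⟨fun _ => 0, fun i => input.getD i 0⟩ t fun s =>
      (s.at c.size).Holds S f) :
    Computes (c.compile 0) input f t S bits := by
  refine ⟨hlen, ?_⟩
  have hbd : (⟨fun _ => 0, fun i => input.getD i 0⟩ : Store).Bd (2 ^ bits) := by
    refine ⟨fun i => by simp, fun i => ?_⟩
    by_cases hi : i < input.length
    · simpa [List.getD, hi] using hin _ (List.getElem_mem hi)
    · simp [List.getD, hi]
  obtain ⟨u, hu, s, hr, hb, hh⟩ := h hbd (c.compile 0) 0 ⟨[], [], by simp, rfl⟩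
  rw [Nat.zero_add] at hr
  have e : Config.init input = (⟨fun _ => 0, fun i => input.getD i 0⟩ : Store).at 0 := rfl
  rw [← e] at hr
  refine ⟨u, hu, ?_, ?_, ?_⟩
  · intro v hv
    rcases hv.lt_or_eq with hv | rfl
    · exact hr.2 v hv
    · rw [hr.1]
      refine ⟨hb.1, hb.2, ?_⟩
      intro ins hins
      simp [Store.at, Cmd.length_compile] at hins
  · rw [hr.1, Cmd.length_compile]; exact le_rfl
  · rw [hr.1]; exact hh

/-! ## Adding rows of a table to other rows -/

/-- Successively add `sg` times the cell `src q` to the cell `dst q`. -/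
def seqMem (sg : ℤ) (src dst : ℕ → ℕ) (mem : ℕ → ℤ) : ℕ → ℕ → ℤ
  | 0 => mem
  | q + 1 => Function.update (seqMem sg src dst mem q) (dst q)
      (seqMem sg src dst mem q (dst q) + sg * seqMem sg src dst mem q (src q))

section seqMem

variable {sg : ℤ} {src dst : ℕ → ℕ} {mem : ℕ → ℤ}

theorem seqMem_other {Q x : ℕ} (h : ∀ q < Q, x ≠ dst q) : seqMem sg src dst mem Q x = mem x := by
  induction Q with
  | zero => rfl
  | succ Q ih =>
    rw [seqMem, Function.update_of_ne (h Q (by omega)), ih fun q hq => h q (by omega)]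

/-- When no cell is written twice and none is read after an earlier write to it, the successive
updates act like one simultaneous update from the original contents. -/
theorem seqMem_dst {Q q : ℕ} (hinj : ∀ q < Q, ∀ q' < q, dst q ≠ dst q')
    (hsrc : ∀ q < Q, ∀ q' < q, src q ≠ dst q') (hq : q < Q) :
    seqMem sg src dst mem Q (dst q) = mem (dst q) + sg * mem (src q) := by
  induction Q with
  | zero => omega
  | succ Q ih =>
    rw [seqMem]
    rcases (Nat.lt_succ_iff.1 hq).lt_or_eq with h | rfl
    · rw [Function.update_of_ne (hinj Q (by omega) q h).symm,
        ih (fun a ha => hinj a (by omega)) (fun a ha => hsrc a (by omega)) h]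
    · rw [Function.update_self, seqMem_other (hinj q hq), seqMem_other (hsrc q hq)]

theorem abs_seqMem_le {Q : ℕ} {M : ℤ} (hinj : ∀ q < Q, ∀ q' < q, dst q ≠ dst q')
    (hsrc : ∀ q < Q, ∀ q' < q, src q ≠ dst q') (hsg : |sg| = 1) (hM : ∀ x, |mem x| ≤ M) (x : ℕ) :
    |seqMem sg src dst mem Q x| ≤ 2 * M := by
  have h0 : 0 ≤ M := (abs_nonneg _).trans (hM 0)
  by_cases h : ∃ q < Q, x = dst q
  · obtain ⟨q, hq, rfl⟩ := h
    rw [seqMem_dst hinj hsrc hq]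
    refine (abs_add_le _ _).trans ?_
    rw [abs_mul, hsg, one_mul]
    linarith [hM (dst q), hM (src q)]
  · push Not at h
    rw [seqMem_other h]
    linarith [hM x]

end seqMem

/-- The address of the `q`-th cell in rows of length `cnt` that begin at `s`, `s + w`, ... -/
def rowCell (cnt s w q : ℕ) : ℕ := s + q / cnt * w + q % cnt

theorem rowCell_eq {cnt s w r i : ℕ} (hi : i < cnt) :
    rowCell cnt s w (r * cnt + i) = s + r * w + i := by
  have hc : 0 < cnt := by omega
  rw [rowCell, Nat.mul_comm r, Nat.mul_add_div hc, Nat.div_eq_of_lt hi, Nat.mul_add_mod,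
    Nat.mod_eq_of_lt hi, Nat.add_zero]

/-- Registers outside `l` are unchanged. -/
def Same (l : List ℕ) (s s' : Store) : Prop := ∀ i, i ∉ l → s'.reg i = s.reg i

def sign (neg : Bool) : ℤ := if neg then -1 else 1

theorem abs_sign (neg : Bool) : |sign neg| = 1 := by cases neg <;> simp [sign]

/-- Registers 17 and 18 point to the current source and target cell, and 16 counts the cells left in
the row. Throughout the table operations register 3 holds 1 and register 30 holds 0. -/
def scatInner (neg : Bool) : Cmd :=
  .block [.load 19 17, .load 20 18, if neg then .sub 20 20 19 else .add 20 20 19, .store 18 20,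
    .add 17 17 3, .add 18 18 3, .sub 16 16 3]

/-- Add or subtract the rows starting at the address in register 11 to the rows starting at the
address in register 12. -/
def scatCmd (neg : Bool) : Cmd :=
  .loop 15 (((Cmd.block [.add 16 7 30, .add 17 11 30, .add 18 12 30]).seq
    (.loop 16 (scatInner neg))).seq (.block [.add 11 11 13, .add 12 12 14, .sub 15 15 3]))

section scatter

variable {S : ℕ} {B M : ℤ} {neg : Bool} {cnt s d ss ds R : ℕ}

/-- The cells that are read have not been written before, and no cell is written twice. -/
def NoClash (cnt s d ss ds R : ℕ) : Prop :=
  ∀ q < R * cnt, ∀ q' < q, rowCell cnt d ds q ≠ rowCell cnt d ds q' ∧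
    rowCell cnt s ss q ≠ rowCell cnt d ds q'

theorem abs_natCast_le {x S : ℕ} {B : ℤ} (h : x ≤ S) (hS : (S : ℤ) ≤ B) : |(x : ℤ)| ≤ B := by
  rw [Nat.abs_cast]; omega

/-- The memory is tracked exactly, as `seqMem` after `r * cnt + i` additions. By `NoClash` both
cells involved still have their original contents, which bounds the new value by `2 * M`. -/
theorem tri_scatInner {mem : ℕ → ℤ} (hno : NoClash cnt s d ss ds R) (hM : ∀ x, |mem x| ≤ M)
    (hMB : 2 * M ≤ B) (hSB : (S : ℤ) ≤ B) (hs : s + R * ss + cnt ≤ S) (hd : d + R * ds + cnt ≤ S)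
    {st : Store} {r i : ℕ} (hr : r < R) (hi : i < cnt)
    (h3 : st.reg 3 = 1) (h16 : st.reg 16 = (cnt - i : ℕ)) (h17 : st.reg 17 = (s + r * ss + i : ℕ))
    (h18 : st.reg 18 = (d + r * ds + i : ℕ))
    (hmem : st.mem = seqMem (sign neg) (rowCell cnt s ss) (rowCell cnt d ds) mem (r * cnt + i)) :
    Tri S B (scatInner neg) st 7 fun st' =>
      Same [16, 17, 18, 19, 20] st st' ∧ st'.reg 16 = (cnt - (i + 1) : ℕ) ∧
      st'.reg 17 = (s + r * ss + (i + 1) : ℕ) ∧ st'.reg 18 = (d + r * ds + (i + 1) : ℕ) ∧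
      st'.mem = seqMem (sign neg) (rowCell cnt s ss) (rowCell cnt d ds) mem (r * cnt + (i + 1)) := by
  have hss : r * ss ≤ R * ss := Nat.mul_le_mul_right _ hr.le
  have hds : r * ds ≤ R * ds := Nat.mul_le_mul_right _ hr.le
  have hq : r * cnt + i < R * cnt := by
    have : (r + 1) * cnt ≤ R * cnt := Nat.mul_le_mul_right _ hr
    rw [Nat.succ_mul] at this; omega
  have e17 : (st.reg 17).toNat = s + r * ss + i := by rw [h17]; exact Int.toNat_natCast _
  have e18 : (st.reg 18).toNat = d + r * ds + i := by rw [h18]; exact Int.toNat_natCast _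
  have e1 : st.mem (d + r * ds + i) = mem (d + r * ds + i) := by
    rw [hmem, ← rowCell_eq hi, seqMem_other fun q' hq' => (hno _ hq q' hq').1]
  have e2 : st.mem (s + r * ss + i) = mem (s + r * ss + i) := by
    rw [hmem, ← rowCell_eq hi, seqMem_other fun q' hq' => (hno _ hq q' hq').2]
  have hb : |st.mem (d + r * ds + i) + sign neg * st.mem (s + r * ss + i)| ≤ B := by
    rw [e1, e2]
    refine (abs_add_le _ _).trans ?_
    rw [abs_mul, abs_sign, one_mul]
    linarith [hM (d + r * ds + i), hM (s + r * ss + i)]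
  have hfin : Function.update st.mem (d + r * ds + i)
      (st.mem (d + r * ds + i) + sign neg * st.mem (s + r * ss + i)) =
      seqMem (sign neg) (rowCell cnt s ss) (rowCell cnt d ds) mem (r * cnt + (i + 1)) := by
    rw [← add_assoc, seqMem, rowCell_eq hi, rowCell_eq hi, ← hmem]
  refine Tri.cons ?_ (Tri.cons ?_ (Tri.cons ?_ (Tri.cons ?_ (Tri.cons ?_ (Tri.cons ?_
    (Tri.cons ?_ (Tri.nil ?_)))))))
  · simp only [Instr.Ok, h17]; omega
  · simp [Instr.Ok, Instr.act, h18]; omega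
  · cases neg <;> simpa [Instr.Ok, Instr.act, e17, e18, sign, ← sub_eq_add_neg] using hb
  · cases neg <;> simp [Instr.Ok, Instr.act, h18] <;> omega
  · cases neg <;> simp [Instr.Ok, Instr.act, h17, h3] <;> rw [abs_le] <;> constructor <;> omega
  · cases neg <;> simp [Instr.Ok, Instr.act, h18, h3] <;> rw [abs_le] <;> constructor <;> omega
  · cases neg <;> simp [Instr.Ok, Instr.act, h16, h3] <;> rw [abs_le] <;> constructor <;> omega
  · refine ⟨?_, ?_, ?_, ?_, ?_⟩
    · intro j hj
      simp only [List.mem_cons, List.not_mem_nil, not_or, or_false] at hj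
      cases neg <;> simp [Instr.act, hj]
    · cases neg <;> simp [Instr.act, h16, h3] <;> omega
    · cases neg <;> simp [Instr.act, h17, h3] <;> omega
    · cases neg <;> simp [Instr.act, h18, h3] <;> omega
    · rw [← hfin]
      cases neg <;> simp [Instr.act, e17, e18, sign, ← sub_eq_add_neg]

theorem tri_scat {st : Store} (hno : NoClash cnt s d ss ds R) (hM : ∀ x, |st.mem x| ≤ M)
    (hMB : 2 * M ≤ B) (hSB : (S : ℤ) ≤ B) (hB : 1 ≤ B) (hRS : R ≤ S)
    (hs : s + R * ss + cnt ≤ S) (hd : d + R * ds + cnt ≤ S)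
    (h3 : st.reg 3 = 1) (h30 : st.reg 30 = 0) (h7 : st.reg 7 = cnt) (h11 : st.reg 11 = s)
    (h12 : st.reg 12 = d) (h13 : st.reg 13 = ss) (h14 : st.reg 14 = ds) (h15 : st.reg 15 = R) :
    Tri S B (scatCmd neg) st (R * (cnt * 8 + 10) + 3) fun st' =>
      Same [11, 12, 15, 16, 17, 18, 19, 20, 29] st st' ∧
      st'.mem = seqMem (sign neg) (rowCell cnt s ss) (rowCell cnt d ds) st.mem (R * cnt) := by
  let mm := seqMem (sign neg) (rowCell cnt s ss) (rowCell cnt d ds) st.mem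
  have hcS : (cnt : ℤ) ≤ B := by omega
  refine Tri.mono (Tri.loop (m := R) (t := cnt * 8 + 9) hB (fun j s' =>
    j ≤ R ∧ Same [11, 12, 15, 16, 17, 18, 19, 20, 29] st s' ∧ s'.reg 15 = (j : ℤ) ∧
    s'.reg 11 = (s + (R - j) * ss : ℕ) ∧ s'.reg 12 = (d + (R - j) * ds : ℕ) ∧
    s'.mem = mm ((R - j) * cnt)) ?_ ?_ (Q := fun st' =>
      Same [11, 12, 15, 16, 17, 18, 19, 20, 29] st st' ∧ st'.mem = mm (R * cnt)) ?_) (by ring_nf; rfl)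
      fun _ _ h => h
  · refine ⟨le_rfl, ?_, ?_, ?_, ?_, ?_⟩
    · intro i hi
      simp only [List.mem_cons, List.not_mem_nil, not_or, or_false] at hi
      simp [Store.set, hi]
    · simp [Store.set, h15]
    · simp [Store.set, h11]
    · simp [Store.set, h12]
    · simp [Store.set, mm, seqMem]
  · rintro j s1 hj ⟨hjR, hsame, k15, k11, k12, kmem⟩
    obtain ⟨r, rfl⟩ : ∃ r, R = j + 1 + r := ⟨R - (j + 1), by omega⟩
    have er : j + 1 + r - (j + 1) = r := by omega
    have er' : j + 1 + r - j = r + 1 := by omega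
    rw [er] at k11 k12 kmem
    refine ⟨by rw [k15]; omega, ?_⟩
    have k3 : s1.reg 3 = 1 := (hsame 3 (by decide)).trans h3
    have k7 : s1.reg 7 = cnt := (hsame 7 (by decide)).trans h7
    have k30 : s1.reg 30 = 0 := (hsame 30 (by decide)).trans h30
    have k13 : s1.reg 13 = ss := (hsame 13 (by decide)).trans h13
    have k14 : s1.reg 14 = ds := (hsame 14 (by decide)).trans h14
    have hss : r * ss + ss ≤ (j + 1 + r) * ss := by
      rw [← Nat.succ_mul]; exact Nat.mul_le_mul_right _ (by omega)
    have hds : r * ds + ds ≤ (j + 1 + r) * ds := by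
      rw [← Nat.succ_mul]; exact Nat.mul_le_mul_right _ (by omega)
    refine Tri.mono (Tri.seq (t := 3 + (cnt * 8 + 3)) (t' := 3) (Tri.seq (t := 3) (t' := cnt * 8 + 3)
      (Tri.cons ?_ (Tri.cons ?_ (Tri.cons ?_ (Tri.nil ?_)))))) (by omega) (fun _ _ h => h)
    · simp only [Instr.Ok, k7, k30]; rw [abs_le]; constructor <;> omega
    · simp [Instr.Ok, Instr.act, k11, k30]; rw [abs_le]; constructor <;> omega
    · simp [Instr.Ok, Instr.act, k12, k30]; rw [abs_le]; constructor <;> omega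
    refine Tri.imp (Tri.loop (m := cnt) (t := 7) hB (fun i s' => i ≤ cnt ∧
      Same [16, 17, 18, 19, 20, 29] s1 s' ∧ s'.reg 16 = (i : ℤ) ∧
      s'.reg 17 = (s + r * ss + (cnt - i) : ℕ) ∧ s'.reg 18 = (d + r * ds + (cnt - i) : ℕ) ∧
      s'.mem = mm (r * cnt + (cnt - i))) ?_ ?_ (Q := fun s' =>
        Same [16, 17, 18, 19, 20, 29] s1 s' ∧ s'.mem = mm (r * cnt + cnt)) ?_) ?_
    · refine ⟨le_rfl, ?_, ?_, ?_, ?_, ?_⟩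
      · intro i hi
        simp only [List.mem_cons, List.not_mem_nil, not_or, or_false] at hi
        simp [Store.set, Instr.act, hi]
      · simp [Store.set, Instr.act, k7, k30]
      · simp [Store.set, Instr.act, k11, k30]
      · simp [Store.set, Instr.act, k12, k30]
      · simp [Store.set, Instr.act, kmem]
    · rintro i s2 hi ⟨hic, hs2, l16, l17, l18, lmem⟩
      refine ⟨by rw [l16]; omega, ?_⟩
      refine Tri.imp (tri_scatInner (neg := neg) hno hM hMB hSB hs hd (r := r)
        (i := cnt - (i + 1)) (by omega) (by omega) ((hs2 3 (by decide)).trans k3) ?_ l17 l18 lmem) ?_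
      · rw [l16]; congr 1; omega
      · rintro s3 - ⟨g1, g2, g3, g4, g5⟩
        have e : cnt - (i + 1) + 1 = cnt - i := by omega
        rw [e] at g2 g3 g4 g5
        refine ⟨by omega, ?_, by rw [g2]; congr 1; omega, g3, g4, g5⟩
        intro x hx
        rw [g1 x (by simp at hx ⊢; tauto), hs2 x hx]
    · rintro s2 ⟨_, hs2, l16, _, _, lmem⟩
      exact ⟨by rw [l16]; simp, hs2, by simpa using lmem⟩
    · rintro s2 - ⟨hs2, hm2⟩
      refine Tri.cons ?_ (Tri.cons ?_ (Tri.cons ?_ (Tri.nil ?_)))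
      · have := abs_natCast_le (x := s + r * ss + ss) (by omega) hSB
        simpa [Instr.Ok, hs2 11 (by decide), hs2 13 (by decide), k11, k13] using this
      · have := abs_natCast_le (x := d + r * ds + ds) (by omega) hSB
        simpa [Instr.Ok, Instr.act, hs2 12 (by decide), hs2 14 (by decide), k12, k14] using this
      · simp [Instr.Ok, Instr.act, hs2 15 (by decide), hs2 3 (by decide), k15, k3]
        omega
      · refine ⟨by omega, ?_, ?_, ?_, ?_, ?_⟩
        · intro x hx
          have hx' := hx
          simp only [List.mem_cons, List.not_mem_nil, not_or, or_false] at hx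
          simp [Instr.act, hx]
          rw [hs2 x (by simp; tauto), hsame x hx']
        · simp [Instr.act, hs2 15 (by decide), hs2 3 (by decide), k15, k3]
        · simp [Instr.act, hs2 11 (by decide), hs2 13 (by decide), k11, k13, er']; ring
        · simp [Instr.act, hs2 12 (by decide), hs2 14 (by decide), k12, k14, er']; ring
        · simp [Instr.act, hm2, er', Nat.succ_mul]
  · rintro s2 ⟨_, hs2, l15, _, _, lmem⟩
    exact ⟨by rw [l15]; simp, hs2, by simpa using lmem⟩

end scatter

/-! ## Tables of Laurent polynomials in the memory -/

abbrev LP := LaurentPolynomial ℤ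

theorem coeff_T_mul (k : ℤ) (f : LP) (e : ℤ) :
    (LaurentPolynomial.T k * f).coeff e = f.coeff (e - k) := by
  induction f using LaurentPolynomial.induction_on' with
  | add p q hp hq => rw [mul_add, AddMonoidAlgebra.coeff_add, AddMonoidAlgebra.coeff_add,
      Finsupp.add_apply, Finsupp.add_apply, hp, hq]
  | C_mul_T m a =>
    rw [mul_left_comm, ← LaurentPolynomial.T_add, ← LaurentPolynomial.single_eq_C_mul_T,
      ← LaurentPolynomial.single_eq_C_mul_T]
    simp only [AddMonoidAlgebra.coeff_single, Finsupp.single_apply]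
    congr 1
    apply propext; constructor <;> intro h <;> omega

theorem coeff_C_mul (z : ℤ) (f : LP) (e : ℤ) :
    (LaurentPolynomial.C z * f).coeff e = z * f.coeff e := by
  rw [← LaurentPolynomial.smul_eq_C_mul]; rfl

theorem coeff_add' (f g : LP) (e : ℤ) : (f + g).coeff e = f.coeff e + g.coeff e := rfl

theorem coeff_zero' (e : ℤ) : (0 : LP).coeff e = 0 := rfl

/-- All exponents lie in `[-h, h)`. -/
def SuppIn (h : ℕ) (f : LP) : Prop := ∀ e : ℤ, e < -h ∨ (h : ℤ) ≤ e → f.coeff e = 0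

/-- An entry of a table occupies a row of `4 * h` cells. Exponents in [-h, h) fill only the middle
half, so a shifted copy still fits in the row. Two tables are interleaved, the current one in the
rows of one parity and the next one in the others; both can grow in place. -/
def cell (E h y i : ℕ) : ℕ := E + y * (4 * h) + i

theorem cell_inj {E h y i y' i' : ℕ} (hi : i < 4 * h) (hi' : i' < 4 * h)
    (he : cell E h y i = cell E h y' i') : y = y' ∧ i = i' := by
  unfold cell at he
  have h0 : 0 < 4 * h := by omega
  have e : y * (4 * h) + i = y' * (4 * h) + i' := by omega
  have e1 := congrArg (· / (4 * h)) e
  have e2 := congrArg (· % (4 * h)) e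
  simp only [Nat.mul_comm y, Nat.mul_comm y', Nat.mul_add_div h0, Nat.mul_add_mod,
    Nat.div_eq_of_lt hi, Nat.div_eq_of_lt hi', Nat.mod_eq_of_lt hi, Nat.mod_eq_of_lt hi'] at e1 e2
  exact ⟨by omega, e2⟩

theorem exists_cell {E h x : ℕ} (h0 : 0 < h) (hx : E ≤ x) : ∃ y i, i < 4 * h ∧ x = cell E h y i := by
  refine ⟨(x - E) / (4 * h), (x - E) % (4 * h), Nat.mod_lt _ (by omega), ?_⟩
  have := Nat.div_add_mod (x - E) (4 * h)
  rw [Nat.mul_comm] at this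
  unfold cell; omega

/-- The cells with parity `b` of the table at address `E` hold the coefficients
of the polynomials `f x`. -/
def Tab (E h : ℕ) (mem : ℕ → ℤ) (b : Bool) (f : ℕ → LP) : Prop :=
  ∀ x i, i < 4 * h → mem (cell E h (2 * x + b.toNat) i) = (f x).coeff ((i : ℤ) - 2 * h)

/-- A term of a linear operation on tables: add `± T ^ sh` times the entry number `a r + b` to
the entry number `c r + d` for all `r < R`; the offset `d` is increased by `R` if `hi`. -/
structure Term where
  a : ℕ
  b : ℕ
  c : ℕ
  d : ℕ
  hi : Bool
  sh : ℤ
  neg : Bool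

def Term.off (t : Term) (R : ℕ) : ℕ := t.d + if t.hi then R else 0

def Term.val (t : Term) (R : ℕ) (f : ℕ → LP) (x : ℕ) : LP :=
  ∑ r ∈ Finset.range R, if x = t.c * r + t.off R then
    LaurentPolynomial.C (sign t.neg) * (LaurentPolynomial.T t.sh * f (t.a * r + t.b)) else 0

theorem Term.val_eq {t : Term} {R r : ℕ} (hc : 0 < t.c) (hr : r < R) (f : ℕ → LP) :
    t.val R f (t.c * r + t.off R) =
      LaurentPolynomial.C (sign t.neg) * (LaurentPolynomial.T t.sh * f (t.a * r + t.b)) := by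
  rw [Term.val, Finset.sum_eq_single r]
  · simp
  · intro r' _ hne
    rw [if_neg]
    intro h
    have : t.c * r = t.c * r' := by omega
    exact hne (Nat.eq_of_mul_eq_mul_left hc this).symm
  · intro h; exact absurd (Finset.mem_range.2 hr) h

theorem Term.val_eq_zero {t : Term} {R x : ℕ} (hx : ∀ r < R, x ≠ t.c * r + t.off R)
    (f : ℕ → LP) : t.val R f x = 0 := by
  refine Finset.sum_eq_zero fun r hr => if_neg (hx r (Finset.mem_range.1 hr))

theorem div_mod_lt {q R cnt : ℕ} (hq : q < R * cnt) :
    q / cnt < R ∧ q % cnt < cnt ∧ q = q / cnt * cnt + q % cnt := by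
  have h0 : 0 < cnt := Nat.pos_of_ne_zero fun h => by simp [h] at hq
  exact ⟨Nat.div_lt_of_lt_mul (by rwa [Nat.mul_comm]), Nat.mod_lt _ h0, (Nat.div_add_mod' q cnt).symm⟩

section term

variable {E h : ℕ} {mem : ℕ → ℤ} {b : Bool} {f g : ℕ → LP} {t : Term} {R src dst : ℕ}

/-- Entries of equal parity are `8 * h` cells apart, and copying starts at the middle half of a row,
whence the additional `h`. -/
theorem srcCell (hs : src = E + b.toNat * (4 * h) + h + t.b * (8 * h)) (r i : ℕ) :
    src + r * (t.a * (8 * h)) + i = cell E h (2 * (t.a * r + t.b) + b.toNat) (h + i) := by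
  rw [hs, cell]; ring

theorem dstCell {j : ℕ} (hd : (dst : ℤ) = E + (!b).toNat * (4 * h) + h + t.sh + t.off R * (8 * h))
    {r i : ℕ} (hj : (j : ℤ) = h + i + t.sh) :
    dst + r * (t.c * (8 * h)) + i = cell E h (2 * (t.c * r + t.off R) + (!b).toNat) j := by
  zify
  rw [hd, cell]; push_cast; rw [hj]; ring

theorem not_toNat_ne {b : Bool} {x y : ℕ} : 2 * x + (!b).toNat ≠ 2 * y + b.toNat := by
  cases b <;> simp <;> omega

/-- Sources and targets lie in rows of different parity. Targets are distinct because `t.c` is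
positive and because a shift by at most 8 ≤ h keeps every target in its own row. -/
theorem term_noClash (hh : 8 ≤ h) (hc : 0 < t.c) (hsh : |t.sh| ≤ 8)
    (hs : src = E + b.toNat * (4 * h) + h + t.b * (8 * h))
    (hd : (dst : ℤ) = E + (!b).toNat * (4 * h) + h + t.sh + t.off R * (8 * h)) :
    NoClash (2 * h) src dst (t.a * (8 * h)) (t.c * (8 * h)) R := by
  rw [abs_le] at hsh
  intro q hq q' hq'
  obtain ⟨h1, h2, h3⟩ := div_mod_lt hq
  obtain ⟨h1', h2', h3'⟩ := div_mod_lt (hq'.trans hq)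
  obtain ⟨j, hj⟩ := Int.eq_ofNat_of_zero_le (a := h + (q % (2 * h) : ℕ) + t.sh) (by omega)
  obtain ⟨j', hj'⟩ := Int.eq_ofNat_of_zero_le (a := h + (q' % (2 * h) : ℕ) + t.sh) (by omega)
  unfold rowCell
  rw [dstCell hd hj.symm, dstCell hd hj'.symm, srcCell hs]
  constructor
  · intro he
    obtain ⟨e1, e2⟩ := cell_inj (by omega) (by omega) he
    have e3 : t.c * (q / (2 * h)) = t.c * (q' / (2 * h)) := by omega
    have e4 := Nat.eq_of_mul_eq_mul_left hc e3
    have e5 : q % (2 * h) = q' % (2 * h) := by omega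
    rw [e4, e5] at h3
    omega
  · intro he
    exact not_toNat_ne (cell_inj (by omega) (by omega) he).1.symm

/-- Copying only the middle half of a row is enough, since the exponents of `f x` lie in [-h, h): a
target cell outside the shifted window receives nothing, and the coefficient due there is zero. -/
theorem term_spec (hh : 8 ≤ h) (hc : 0 < t.c) (hsh : |t.sh| ≤ 8)
    (hs : src = E + b.toNat * (4 * h) + h + t.b * (8 * h))
    (hd : (dst : ℤ) = E + (!b).toNat * (4 * h) + h + t.sh + t.off R * (8 * h))
    (hf : Tab E h mem b f) (hg : Tab E h mem (!b) g) (hsupp : ∀ x, SuppIn h (f x)) :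
    let mem' := seqMem (sign t.neg) (rowCell (2 * h) src (t.a * (8 * h)))
      (rowCell (2 * h) dst (t.c * (8 * h))) mem (R * (2 * h))
    Tab E h mem' b f ∧ Tab E h mem' (!b) (fun x => g x + t.val R f x) ∧
      ∀ x < E, mem' x = mem x := by
  have hno := term_noClash (R := R) hh hc hsh hs hd
  rw [abs_le] at hsh
  have hdst : ∀ q < R * (2 * h), ∃ r < R, ∃ j < 4 * h, ∃ i < 2 * h, q = r * (2 * h) + i ∧
      (j : ℤ) = h + i + t.sh ∧
      rowCell (2 * h) dst (t.c * (8 * h)) q =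
        cell E h (2 * (t.c * r + t.off R) + (!b).toNat) j := by
    intro q hq
    obtain ⟨h1, h2, h3⟩ := div_mod_lt hq
    obtain ⟨j, hj⟩ := Int.eq_ofNat_of_zero_le (a := h + (q % (2 * h) : ℕ) + t.sh) (by omega)
    exact ⟨_, h1, j, by omega, _, h2, h3, hj.symm, dstCell hd hj.symm⟩
  refine ⟨?_, ?_, ?_⟩
  · intro x i hi
    rw [seqMem_other, hf x i hi]
    intro q hq he
    obtain ⟨r, -, j, hj, -, -, -, -, hr⟩ := hdst q hq
    rw [hr] at he
    exact not_toNat_ne (cell_inj hi hj he).1.symm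
  · intro x i hi
    change _ = (g x + t.val R f x).coeff ((i : ℤ) - 2 * h)
    by_cases hx : ∃ r < R, x = t.c * r + t.off R
    · obtain ⟨r, hr, rfl⟩ := hx
      rw [Term.val_eq hc hr, coeff_add', coeff_C_mul, coeff_T_mul]
      by_cases hi' : (h : ℤ) ≤ i - t.sh ∧ (i : ℤ) - t.sh < 3 * h
      · obtain ⟨k, hk⟩ := Int.eq_ofNat_of_zero_le (a := (i : ℤ) - t.sh - h) (by omega)
        have hk2 : k < 2 * h := by omega
        have hq : r * (2 * h) + k < R * (2 * h) := by
          have : (r + 1) * (2 * h) ≤ R * (2 * h) := Nat.mul_le_mul_right _ hr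
          rw [Nat.succ_mul] at this; omega
        have e1 : cell E h (2 * (t.c * r + t.off R) + (!b).toNat) i =
            rowCell (2 * h) dst (t.c * (8 * h)) (r * (2 * h) + k) := by
          rw [rowCell_eq hk2, dstCell hd (j := i) (by omega)]
        rw [e1, seqMem_dst (fun q hq q' hq' => (hno q hq q' hq').1)
          (fun q hq q' hq' => (hno q hq q' hq').2) hq, ← e1, rowCell_eq hk2, srcCell hs,
          hg _ i hi, hf _ (h + k) (by omega)]
        congr 3
        push_cast; omega
      · rw [hsupp _ _ (by omega), mul_zero, add_zero, seqMem_other, hg _ i hi]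
        intro q hq he
        obtain ⟨r', -, j, hj, k, hk, -, hjk, hr'⟩ := hdst q hq
        rw [hr'] at he
        have := (cell_inj hi hj he).2
        omega
    · push Not at hx
      rw [Term.val_eq_zero hx, add_zero, seqMem_other, hg x i hi]
      intro q hq he
      obtain ⟨r, hr, j, hj, -, -, -, -, hr'⟩ := hdst q hq
      rw [hr'] at he
      exact hx r hr (by have := (cell_inj hi hj he).1; omega)
  · intro x hx
    rw [seqMem_other]
    intro q hq he
    obtain ⟨r, -, j, hj, -, -, -, -, hr⟩ := hdst q hq
    rw [hr, cell] at he
    omega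

theorem zero_noClash (hs : src = E + b.toNat * (4 * h) + h) :
    NoClash (2 * h) src src (8 * h) (8 * h) R := by
  intro q hq q' hq'
  obtain ⟨h1, h2, h3⟩ := div_mod_lt hq
  obtain ⟨h1', h2', h3'⟩ := div_mod_lt (hq'.trans hq)
  have e : ∀ r i, src + r * (8 * h) + i = cell E h (2 * r + b.toNat) (h + i) := fun r i => by
    rw [hs, cell]; ring
  have : rowCell (2 * h) src (8 * h) q ≠ rowCell (2 * h) src (8 * h) q' := by
    unfold rowCell
    rw [e, e]
    intro he
    obtain ⟨e1, e2⟩ := cell_inj (by omega) (by omega) he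
    have e3 : q / (2 * h) = q' / (2 * h) := by omega
    have e5 : q % (2 * h) = q' % (2 * h) := by omega
    rw [e3, e5] at h3
    omega
  exact ⟨this, this⟩

/-- The old table is cleared by subtracting every row from itself. Outside the middle halves, and
from row `R` on, it is zero already. -/
theorem zero_spec (hs : src = E + b.toNat * (4 * h) + h)
    (hf : Tab E h mem b f) (hg : Tab E h mem (!b) g) (hsupp : ∀ x, SuppIn h (f x))
    (hR : ∀ x, R ≤ x → f x = 0) :
    let mem' := seqMem (sign true) (rowCell (2 * h) src (8 * h))
      (rowCell (2 * h) src (8 * h)) mem (R * (2 * h))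
    Tab E h mem' b (fun _ => 0) ∧ Tab E h mem' (!b) g ∧ ∀ x < E, mem' x = mem x := by
  have hno := zero_noClash (R := R) hs
  have e : ∀ r i, src + r * (8 * h) + i = cell E h (2 * r + b.toNat) (h + i) := fun r i => by
    rw [hs, cell]; ring
  have hdst : ∀ q < R * (2 * h), ∃ r < R, ∃ i < 2 * h, q = r * (2 * h) + i ∧
      rowCell (2 * h) src (8 * h) q = cell E h (2 * r + b.toNat) (h + i) := by
    intro q hq
    obtain ⟨h1, h2, h3⟩ := div_mod_lt hq
    exact ⟨_, h1, _, h2, h3, e _ _⟩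
  refine ⟨?_, ?_, ?_⟩
  · intro x i hi
    rw [coeff_zero']
    by_cases hx : x < R ∧ h ≤ i ∧ i < 3 * h
    · obtain ⟨hx, hi1, hi2⟩ := hx
      obtain ⟨k, rfl⟩ := Nat.exists_eq_add_of_le hi1
      have hk2 : k < 2 * h := by omega
      have hq : x * (2 * h) + k < R * (2 * h) := by
        have : (x + 1) * (2 * h) ≤ R * (2 * h) := Nat.mul_le_mul_right _ hx
        rw [Nat.succ_mul] at this; omega
      rw [← e, ← rowCell_eq hk2, seqMem_dst (fun q hq q' hq' => (hno q hq q' hq').1)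
        (fun q hq q' hq' => (hno q hq q' hq').2) hq]
      simp [sign]
    · rw [seqMem_other, hf x i hi]
      · by_cases hxR : R ≤ x
        · rw [hR x hxR]; rfl
        · exact hsupp x _ (by omega)
      · intro q hq he
        obtain ⟨r, hr, k, hk, -, hr'⟩ := hdst q hq
        rw [hr'] at he
        have := cell_inj hi (by omega) he
        omega
  · intro x i hi
    rw [seqMem_other, hg x i hi]
    intro q hq he
    obtain ⟨r, hr, k, hk, -, hr'⟩ := hdst q hq
    rw [hr'] at he
    exact not_toNat_ne (cell_inj hi (by omega) he).1
  · intro x hx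
    rw [seqMem_other]
    intro q hq he
    obtain ⟨r, hr, k, hk, -, hr'⟩ := hdst q hq
    rw [hr', cell] at he
    omega

end term

@[simp] theorem Store.reg_set (s : Store) (i : ℕ) (z : ℤ) :
    (s.set i z).reg = Function.update s.reg i z := rfl

@[simp] theorem Store.mem_set (s : Store) (i : ℕ) (z : ℤ) : (s.set i z).mem = s.mem := rfl

theorem Store.set_set (s : Store) (i : ℕ) (z w : ℤ) : (s.set i z).set i w = s.set i w := by
  simp [Store.set]

section blocks

variable {S : ℕ} {B : ℤ} {s : Store} {Q : Store → Prop} {t : ℕ} {l : List Instr}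

theorem Tri.const {d : ℕ} {z : ℤ} (hz : |z| ≤ B) (h : Tri S B (.block l) (s.set d z) t Q) :
    Tri S B (.block (.const d z :: l)) s (t + 1) Q := Tri.cons hz h

theorem Tri.add {d a b : ℕ} {x y : ℤ} (ha : s.reg a = x) (hb : s.reg b = y)
    (hz : |x + y| ≤ B) (h : Tri S B (.block l) (s.set d (x + y)) t Q) :
    Tri S B (.block (.add d a b :: l)) s (t + 1) Q := by
  subst ha hb; exact Tri.cons hz h

theorem Tri.sub {d a b : ℕ} {x y : ℤ} (ha : s.reg a = x) (hb : s.reg b = y)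
    (hz : |x - y| ≤ B) (h : Tri S B (.block l) (s.set d (x - y)) t Q) :
    Tri S B (.block (.sub d a b :: l)) s (t + 1) Q := by
  subst ha hb; exact Tri.cons hz h

theorem Tri.load {d a x : ℕ} (ha : s.reg a = x) (hx : x < S)
    (h : Tri S B (.block l) (s.set d (s.mem x)) t Q) :
    Tri S B (.block (.load d a :: l)) s (t + 1) Q := by
  refine Tri.cons ?_ ?_
  · simp [Instr.Ok, ha, hx]
  · simpa [Instr.act, ha, Store.set] using h

/-- Multiplication by a fixed number is repeated addition, as the machine cannot multiply. -/
theorem Tri.replicate {a b k : ℕ} (hab : a ≠ b) {x y : ℤ} (ha : s.reg a = x) (hb : s.reg b = y)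
    (hx : 0 ≤ x) (hy : 0 ≤ y) (hB : x + k * y ≤ B)
    (h : Tri S B (.block l) (s.set a (x + k * y)) t Q) :
    Tri S B (.block (List.replicate k (.add a a b) ++ l)) s (t + k) Q := by
  induction k generalizing s x with
  | zero =>
    have e : s.set a (x + ((0 : ℕ) : ℤ) * y) = s := by
      simp [Store.set, ← ha]
    rw [e] at h
    exact h
  | succ k ih =>
    rw [List.replicate_succ, List.cons_append, ← add_assoc]
    have hk : 0 ≤ (k : ℤ) * y := by positivity
    push_cast at hB
    refine Tri.add ha hb (by rw [abs_le]; constructor <;> linarith) (ih (s := s.set a (x + y))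
      (x := x + y) (by simp) (by simp [hab.symm, hb]) (by linarith) (by linarith) ?_)
    have e : x + y + k * y = x + ((k + 1 : ℕ) : ℤ) * y := by push_cast; ring
    rwa [Store.set_set, e]

end blocks

/-! ## Linear operations on tables -/

/-- Registers 4 and 5 hold the addresses of the middle halves of the first rows of the two tables, 6
the distance `8 * h` of successive entries, 9 the number R of rows to be treated, and 10 the product
of R and this distance, which is the offset of a new highest digit. -/
def termCmd (t : Term) : Cmd :=
  (Cmd.block (.add 11 4 30 :: (List.replicate t.b (.add 11 11 6) ++ .const 19 t.sh :: .add 12 5 19 ::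
    (List.replicate t.d (.add 12 12 6) ++ (List.replicate (if t.hi then 1 else 0) (.add 12 12 10) ++
      .const 13 0 :: (List.replicate t.a (.add 13 13 6) ++ .const 14 0 ::
        (List.replicate t.c (.add 14 14 6) ++ [.add 15 9 30]))))))).seq (scatCmd t.neg)

def Term.Small (t : Term) : Prop :=
  t.a ≤ 16 ∧ t.b ≤ 16 ∧ 0 < t.c ∧ t.c ≤ 16 ∧ t.d ≤ 16 ∧ |t.sh| ≤ 8

/-- The constant registers of the table operations. -/
def Consts (h : ℕ) (s : Store) : Prop :=
  s.reg 3 = 1 ∧ s.reg 30 = 0 ∧ s.reg 7 = (2 * h : ℕ) ∧ s.reg 6 = (8 * h : ℕ)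

theorem Consts.of_same {h : ℕ} {s s' : Store} {l : List ℕ} (hc : Consts h s) (hs : Same l s s')
    (hl : 3 ∉ l ∧ 30 ∉ l ∧ 7 ∉ l ∧ 6 ∉ l) : Consts h s' :=
  ⟨(hs 3 hl.1).trans hc.1, (hs 30 hl.2.1).trans hc.2.1, (hs 7 hl.2.2.1).trans hc.2.2.1,
    (hs 6 hl.2.2.2).trans hc.2.2.2⟩

theorem Same.trans {l : List ℕ} {s s' s'' : Store} (h : Same l s s') (h' : Same l s' s'') :
    Same l s s'' := fun i hi => (h' i hi).trans (h i hi)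

theorem Same.mono {l l' : List ℕ} {s s' : Store} (h : Same l s s') (hl : l ⊆ l') : Same l' s s' :=
  fun i hi => h i fun hi' => hi (hl hi')

theorem Same.refl (l : List ℕ) (s : Store) : Same l s s := fun _ _ => rfl

theorem Same.set {l : List ℕ} {s s' : Store} (h : Same l s s') {i : ℕ} (hi : i ∈ l) (z : ℤ) :
    Same l s (s'.set i z) := by
  intro j hj
  have hne : j ≠ i := by rintro rfl; exact hj hi
  rw [Store.reg_set, Function.update_of_ne hne, h j hj]

section op

variable {S : ℕ} {B M : ℤ} {E h R m o nw : ℕ} {t : Term} {st : Store} {b : Bool} {f g : ℕ → LP}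

/-- Forming multiples of the row distance takes at most 16 additions for each of the four parameters
of the term; the constant 80 covers them. -/
theorem tri_term_raw (ht : t.Small) (hh : 8 ≤ h) (hc : Consts h st) (h4 : st.reg 4 = o)
    (h5 : st.reg 5 = nw) (h9 : st.reg 9 = R) (h10 : st.reg 10 = (R * (8 * h) : ℕ))
    {src dst : ℕ} (hsrc : src = o + t.b * (8 * h)) (hdst : (dst : ℤ) = nw + t.sh + t.off R * (8 * h))
    (hnw : 8 ≤ nw)
    (hSo : o + 32 * (R + 1) * (8 * h) + 2 * h + 8 ≤ S)
    (hSn : nw + 32 * (R + 1) * (8 * h) + 2 * h + 8 ≤ S) (hSB : (S : ℤ) ≤ B)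
    (hno : NoClash (2 * h) src dst (t.a * (8 * h)) (t.c * (8 * h)) R)
    (hM : ∀ x, |st.mem x| ≤ M) (hMB : 2 * M ≤ B) :
    Tri S B (termCmd t) st (R * (16 * h + 10) + 80) fun st' =>
      Same [11, 12, 13, 14, 15, 16, 17, 18, 19, 20, 29] st st' ∧
      st'.mem = seqMem (sign t.neg) (rowCell (2 * h) src (t.a * (8 * h)))
        (rowCell (2 * h) dst (t.c * (8 * h))) st.mem (R * (2 * h)) := by
  obtain ⟨h3, h30, h7, h6⟩ := hc
  obtain ⟨ha, hb, hc0, hc, hd, hsh⟩ := ht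
  rw [abs_le] at hsh
  set H := 8 * h with hH
  have hRH : 32 * (R + 1) * H = 32 * (R * H) + 32 * H := by ring
  have haH : t.a * H ≤ 16 * H := Nat.mul_le_mul_right _ ha
  have hbH : t.b * H ≤ 16 * H := Nat.mul_le_mul_right _ hb
  have hcH : t.c * H ≤ 16 * H := Nat.mul_le_mul_right _ hc
  have hdH : t.d * H ≤ 16 * H := Nat.mul_le_mul_right _ hd
  have hRa : R * (t.a * H) ≤ 16 * (R * H) := by
    calc R * (t.a * H) = t.a * (R * H) := by ring
      _ ≤ 16 * (R * H) := Nat.mul_le_mul_right _ ha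
  have hRc : R * (t.c * H) ≤ 16 * (R * H) := by
    calc R * (t.c * H) = t.c * (R * H) := by ring
      _ ≤ 16 * (R * H) := Nat.mul_le_mul_right _ hc
  have hR : R ≤ R * H := Nat.le_mul_of_pos_right _ (by omega)
  have hof : t.off R * H = t.d * H + (if t.hi then 1 else 0) * (R * H) := by
    unfold Term.off; split_ifs <;> ring
  have hofz : (t.off R : ℤ) * (8 * h) = t.d * H + (if t.hi then 1 else 0 : ℕ) * (R * H : ℕ) := by
    have := congrArg (Nat.cast (R := ℤ)) hof
    push_cast [hH] at this ⊢
    linarith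
  have hhi : (if t.hi then 1 else 0) * (R * H) ≤ R * H := by split_ifs <;> simp
  have zb : (t.b : ℤ) * H = (t.b * H : ℕ) := by push_cast; ring
  have zd : (t.d : ℤ) * H = (t.d * H : ℕ) := by push_cast; ring
  have za : (t.a : ℤ) * H = (t.a * H : ℕ) := by push_cast; ring
  have zc : (t.c : ℤ) * H = (t.c * H : ℕ) := by push_cast; ring
  have zh : ((if t.hi then 1 else 0 : ℕ) : ℤ) * (R * H : ℕ) =
    ((if t.hi then 1 else 0) * (R * H) : ℕ) := by push_cast; ring
  rw [zd, zh] at hofz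
  refine Tri.mono (Tri.seq (t := ((((((((0 + 1) + t.c) + 1) + t.a) + 1) +
      (if t.hi then 1 else 0)) + t.d) + 1 + 1 + t.b) + 1) (t' := R * (2 * h * 8 + 10) + 3) ?_)
    (by split_ifs <;> ring_nf <;> omega) fun _ _ hq => hq
  refine Tri.add h4 h30 (by rw [abs_le]; constructor <;> omega) (Tri.replicate (by decide)
    (x := o) (y := H) (by simp) (by simpa using h6) (by omega) (by omega) (by rw [zb]; omega)
    (Tri.const (by rw [abs_le]; constructor <;> omega) (Tri.add (x := nw) (y := t.sh)
      (by simpa using h5) (by simp) (by rw [abs_le]; constructor <;> omega)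
      (Tri.replicate (by decide) (x := nw + t.sh) (y := H) (by simp) (by simpa using h6) (by omega)
        (by omega) (by rw [zd]; omega) (Tri.replicate (by decide) (x := nw + t.sh + t.d * H)
          (y := (R * H : ℕ)) (by simp) (by simpa using h10) (by rw [zd]; omega) (by omega)
          (by rw [zh, zd]; omega) (Tri.const (by simp; omega) (Tri.replicate (by decide) (x := 0)
            (y := H) (by simp) (by simpa using h6) (by omega)
        (by omega) (by rw [za]; omega) (Tri.const (by simp; omega) (Tri.replicate (by decide)
            (x := 0)
            (y := H) (by simp) (by simpa using h6) (by omega)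
        (by omega) (by rw [zc]; omega) (Tri.add (x := R) (y := 0) (by simpa using h9)
          (by simpa using h30) (by rw [abs_le]; constructor <;> omega) (Tri.nil ?_)))))))))))
  have hdst' : dst + R * (t.c * H) + 2 * h ≤ S := by
    rw [hofz] at hdst
    omega
  refine Tri.imp (tri_scat (cnt := 2 * h) (s := src) (d := dst) (ss := t.a * H) (ds := t.c * H)
    (R := R) hno hM hMB hSB (by omega) (by omega) (by omega) hdst'
    (by simpa using h3) (by simpa using h30) (by simpa using h7) ?_ ?_ ?_ ?_ ?_) ?_
  · simp [hsrc]
  · rw [hdst, hofz]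
    simp [hH]
    ring_nf
  · simp
  · simp
  · simp
  · rintro s' - ⟨h1, h2⟩
    refine ⟨?_, h2⟩
    refine Same.trans ?_ (h1.mono (by decide))
    repeat' first | exact Same.refl _ _ | refine Same.set ?_ (by decide) _

end op

def termsCmd : List Term → Cmd
  | [] => .block []
  | t :: ts => (termCmd t).seq (termsCmd ts)

def termsVal (R : ℕ) (ts : List Term) (f : ℕ → LP) (x : ℕ) : LP := (ts.map fun t => t.val R f x).sum

/-- If the table has 2^(kin + r) entries, registers 9 and 10 become 2^r and `2 ^ r * (8 * h)` by
repeated doubling; r is the number of spins beyond the `kin` ones that the operation consumes. -/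
def powCmd (kin : ℕ) : Cmd :=
  (Cmd.block [.const 9 1, .add 10 6 30, .const 19 kin, .sub 21 8 19]).seq
    (.loop 21 (.block [.add 9 9 9, .add 10 10 10, .sub 21 21 3]))

/-- Register 9 holds 2^r, while the old table has 2^(kin + r) rows; hence the `kin` doublings of the
row count. -/
def zeroCmd (kin : ℕ) : Cmd :=
  (Cmd.block (.add 11 4 30 :: .add 12 4 30 :: .add 13 6 30 :: .add 14 6 30 :: .add 15 9 30 ::
    List.replicate kin (.add 15 15 15))).seq (scatCmd true)

/-- Apply a linear operation to a table with `2 ^ m` entries, where `m` is in register 8 and the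
addresses of the table and of an empty one are in the registers 4 and 5. -/
def opCmd (kin kout : ℕ) (ts : List Term) : Cmd :=
  (powCmd kin).seq ((termsCmd ts).seq ((zeroCmd kin).seq
    (.block [.add 19 4 30, .add 4 5 30, .add 5 19 30, .const 19 (kout - kin), .add 8 8 19])))

/-- The table `f` with `2 ^ m` entries is stored at the cells of parity `b`, and the other ones
are zero. -/
structure TabState (E h : ℕ) (b : Bool) (m : ℕ) (f : ℕ → LP) (s : Store) : Prop where
  consts : Consts h s
  r4 : s.reg 4 = (E + b.toNat * (4 * h) + h : ℕ)
  r5 : s.reg 5 = (E + (!b).toNat * (4 * h) + h : ℕ)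
  r8 : s.reg 8 = m
  tab : Tab E h s.mem b f
  tab' : Tab E h s.mem (!b) fun _ => 0
  zero : ∀ x, 2 ^ m ≤ x → f x = 0

section op

variable {S : ℕ} {B M : ℤ} {E h R m o nw : ℕ} {t : Term} {st : Store} {b : Bool} {f g : ℕ → LP}

theorem tri_pow {kin r : ℕ} (hc : Consts h st) (h8 : st.reg 8 = (kin + r : ℕ))
    (hB : 1 ≤ B) (hB1 : (2 ^ r * (8 * h) : ℕ) ≤ B) (hkin : (kin + r : ℕ) ≤ B) (hh : 1 ≤ h) :
    Tri S B (powCmd kin) st (4 * r + 7) fun st' =>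
      Same [9, 10, 19, 21, 29] st st' ∧ st'.mem = st.mem ∧ st'.reg 9 = (2 ^ r : ℕ) ∧
      st'.reg 10 = (2 ^ r * (8 * h) : ℕ) := by
  obtain ⟨h3, h30, h7, h6⟩ := hc
  have hpos : 1 ≤ 2 ^ r := Nat.one_le_two_pow
  have h8h : 8 * h ≤ 2 ^ r * (8 * h) := Nat.le_mul_of_pos_left _ (by omega)
  have hrS : 2 ^ r ≤ 2 ^ r * (8 * h) := Nat.le_mul_of_pos_right _ (by omega)
  refine Tri.mono (Tri.seq (t := 0 + 1 + 1 + 1 + 1) (t' := r * (3 + 1) + 3)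
    (Tri.const (by simpa using hB) (Tri.add (x := (8 * h : ℕ)) (y := 0) (by simpa using h6)
      (by simpa using h30) (by rw [abs_le]; constructor <;> omega)
      (Tri.const (by rw [abs_le]; constructor <;> omega) (Tri.sub (x := (kin + r : ℕ)) (y := kin)
        (by simpa using h8) (by simp) (by rw [abs_le]; constructor <;> omega) (Tri.nil ?_))))))
    (by omega) fun _ _ h => h
  refine Tri.loop hB (fun j s' => j ≤ r ∧ Same [9, 10, 19, 21, 29] st s' ∧ s'.mem = st.mem ∧
    s'.reg 9 = (2 ^ (r - j) : ℕ) ∧ s'.reg 10 = (2 ^ (r - j) * (8 * h) : ℕ) ∧ s'.reg 21 = j)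
    ?_ ?_ ?_
  · refine ⟨le_rfl, ?_, rfl, by simp, by simp, by simp⟩
    repeat' first | exact Same.refl _ _ | refine Same.set ?_ (by decide) _
  · rintro j s1 hj ⟨-, hs, hm, k9, k10, k21⟩
    refine ⟨by rw [k21]; omega, ?_⟩
    have e : 2 ^ (r - j) = 2 ^ (r - (j + 1)) + 2 ^ (r - (j + 1)) := by
      rw [← two_mul, ← pow_succ']; congr 1; omega
    have hle : 2 ^ (r - j) ≤ 2 ^ r := Nat.pow_le_pow_right (by omega) (by omega)
    have hle' : 2 ^ (r - j) * (8 * h) ≤ 2 ^ r * (8 * h) := Nat.mul_le_mul_right _ hle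
    have e' : 2 ^ (r - j) * (8 * h) = 2 ^ (r - (j + 1)) * (8 * h) + 2 ^ (r - (j + 1)) * (8 * h) := by
      rw [e, Nat.add_mul]
    have p1 := Nat.zero_le (2 ^ (r - (j + 1)) * (8 * h))
    have q1 : ((2 ^ (r - (j + 1)) : ℕ) : ℤ) + (2 ^ (r - (j + 1)) : ℕ) = (2 ^ (r - j) : ℕ) := by
      rw [e]; push_cast; rfl
    have q2 : ((2 ^ (r - (j + 1)) * (8 * h) : ℕ) : ℤ) + (2 ^ (r - (j + 1)) * (8 * h) : ℕ) =
        (2 ^ (r - j) * (8 * h) : ℕ) := by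
      rw [e']; push_cast; rfl
    refine Tri.add k9 k9 (by rw [q1, Nat.abs_cast]; omega) (Tri.add
      (x := (2 ^ (r - (j + 1)) * (8 * h) : ℕ)) (y := (2 ^ (r - (j + 1)) * (8 * h) : ℕ))
      (by simpa using k10) (by simpa using k10) (by rw [q2, Nat.abs_cast]; omega) (Tri.sub (x := (j + 1 : ℕ)) (y := 1)
        (by simpa using k21) (by simpa using (hs 3 (by decide)).trans h3)
        (by rw [abs_le]; constructor <;> omega) (Tri.nil ⟨by omega, ?_, hm, ?_, ?_, ?_⟩)))
    · repeat' first | exact hs | refine Same.set ?_ (by decide) _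
    · simp [e]
    · simp [e]; ring
    · simp
  · rintro s1 ⟨-, hs, hm, k9, k10, k21⟩
    exact ⟨by rw [k21]; simp, hs, hm, by simpa using k9, by simpa using k10⟩

theorem tri_term (ht : t.Small) (hh : 8 ≤ h) (hc : Consts h st)
    (h4 : st.reg 4 = (E + b.toNat * (4 * h) + h : ℕ))
    (h5 : st.reg 5 = (E + (!b).toNat * (4 * h) + h : ℕ))
    (h9 : st.reg 9 = R) (h10 : st.reg 10 = (R * (8 * h) : ℕ))
    (hS : E + 4 * h + h + 32 * (R + 1) * (8 * h) + 2 * h + 8 ≤ S) (hSB : (S : ℤ) ≤ B)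
    (hM : ∀ x, |st.mem x| ≤ M) (hMB : 2 * M ≤ B)
    (hf : Tab E h st.mem b f) (hg : Tab E h st.mem (!b) g) (hsupp : ∀ x, SuppIn h (f x)) :
    Tri S B (termCmd t) st (R * (16 * h + 10) + 80) fun st' =>
      Same [11, 12, 13, 14, 15, 16, 17, 18, 19, 20, 29] st st' ∧
      Tab E h st'.mem b f ∧ Tab E h st'.mem (!b) (fun x => g x + t.val R f x) ∧
      (∀ x < E, st'.mem x = st.mem x) ∧ ∀ x, |st'.mem x| ≤ 2 * M := by
  obtain ⟨ha, hb, hc0, hc', hd, hsh⟩ := ht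
  have hsh' := abs_le.1 hsh
  have hbt : ∀ b : Bool, b.toNat * (4 * h) ≤ 4 * h := by intro b; cases b <;> simp
  have h1 := hbt b
  have h2 := hbt (!b)
  obtain ⟨dst, hdst⟩ := Int.eq_ofNat_of_zero_le
    (a := (E + (!b).toNat * (4 * h) + h : ℕ) + t.sh + (t.off R * (8 * h) : ℕ)) (by omega)
  have hdst' : (dst : ℤ) = E + (!b).toNat * (4 * h) + h + t.sh + t.off R * (8 * h) := by
    rw [← hdst]; push_cast; ring
  refine Tri.imp (tri_term_raw ⟨ha, hb, hc0, hc', hd, hsh⟩ hh hc h4 h5 h9 h10 (dst := dst) rfl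
    (by rw [hdst']; push_cast; ring) (by omega) (by omega) (by omega) hSB
    (term_noClash hh hc0 hsh rfl hdst') hM hMB) ?_
  rintro s' - ⟨hs, hm⟩
  obtain ⟨k1, k2, k3⟩ := term_spec (R := R) hh hc0 hsh rfl hdst' hf hg hsupp
  rw [← hm] at k1 k2 k3
  refine ⟨hs, k1, k2, k3, ?_⟩
  rw [hm]
  have hno := term_noClash (R := R) hh hc0 hsh (b := b) rfl hdst'
  exact abs_seqMem_le (fun q hq q' hq' => (hno q hq q' hq').1)
    (fun q hq q' hq' => (hno q hq q' hq').2) (abs_sign _) hM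

/-- All terms read the same table `f` and leave it intact. Each of them can at most double the
integers in memory. -/
theorem tri_terms (ts : List Term) (ht : ∀ t ∈ ts, t.Small) (hh : 8 ≤ h) (hc : Consts h st)
    (h4 : st.reg 4 = (E + b.toNat * (4 * h) + h : ℕ))
    (h5 : st.reg 5 = (E + (!b).toNat * (4 * h) + h : ℕ))
    (h9 : st.reg 9 = R) (h10 : st.reg 10 = (R * (8 * h) : ℕ))
    (hS : E + 4 * h + h + 32 * (R + 1) * (8 * h) + 2 * h + 8 ≤ S) (hSB : (S : ℤ) ≤ B)
    (hM : ∀ x, |st.mem x| ≤ M) (hMB : 2 ^ ts.length * M ≤ B)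
    (hf : Tab E h st.mem b f) (hg : Tab E h st.mem (!b) g) (hsupp : ∀ x, SuppIn h (f x)) :
    Tri S B (termsCmd ts) st (ts.length * (R * (16 * h + 10) + 80)) fun st' =>
      Same [11, 12, 13, 14, 15, 16, 17, 18, 19, 20, 29] st st' ∧
      Tab E h st'.mem b f ∧ Tab E h st'.mem (!b) (fun x => g x + termsVal R ts f x) ∧
      (∀ x < E, st'.mem x = st.mem x) ∧ ∀ x, |st'.mem x| ≤ 2 ^ ts.length * M := by
  induction ts generalizing st g M with
  | nil =>
    refine Tri.le (Tri.nil ⟨Same.refl _ _, hf, ?_, fun _ _ => rfl, by simpa using hM⟩) (by simp)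
    simpa [termsVal] using hg
  | cons t ts ih =>
    have h0 : 0 ≤ M := (abs_nonneg _).trans (hM 0)
    rw [List.length_cons, pow_succ] at hMB
    have h1 : (1 : ℤ) ≤ 2 ^ ts.length := one_le_pow₀ (by norm_num)
    have h2 : 2 * M ≤ B := le_trans (by nlinarith) hMB
    refine Tri.mono (Tri.seq (Tri.imp (tri_term (ht t (by simp)) hh hc h4 h5 h9 h10 hS hSB hM h2
      hf hg hsupp) ?_) (t' := ts.length * (R * (16 * h + 10) + 80)))
      (by rw [List.length_cons]; ring_nf; rfl) fun _ _ h => h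
    rintro s1 - ⟨k1, k2, k3, k4, k5⟩
    refine Tri.imp (ih (fun t ht' => ht t (by simp [ht'])) (hc.of_same k1 (by decide))
      ((k1 4 (by decide)).trans h4) ((k1 5 (by decide)).trans h5) ((k1 9 (by decide)).trans h9)
      ((k1 10 (by decide)).trans h10) k5 (by linarith) k2 k3) ?_
    rintro s2 - ⟨l1, l2, l3, l4, l5⟩
    refine ⟨k1.trans l1, l2, ?_, fun x hx => (l4 x hx).trans (k4 x hx), fun x => ?_⟩
    · convert l3 using 2 with x
      simp [termsVal, add_assoc]
    · rw [List.length_cons, pow_succ]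
      linarith [l5 x]

theorem tri_doubling {S : ℕ} {B : ℤ} {s : Store} {k : ℕ} {x : ℤ} (hx : 0 ≤ x) (hr : s.reg 15 = x)
    (hB : 2 ^ k * x ≤ B) :
    Tri S B (.block (List.replicate k (.add 15 15 15))) s k fun s' =>
      s' = s.set 15 (2 ^ k * x) := by
  induction k generalizing s x with
  | zero => exact Tri.nil (by simp [Store.set, ← hr])
  | succ k ih =>
    have h1 : (1 : ℤ) ≤ 2 ^ k := one_le_pow₀ (by norm_num)
    rw [pow_succ] at hB
    refine Tri.add hr hr (by rw [abs_le]; constructor <;> nlinarith) (Tri.imp (ih (x := x + x)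
      (by linarith) (by simp) (by linarith)) ?_)
    rintro s' - rfl
    rw [Store.set_set]; congr 1; ring

theorem tri_zero {kin : ℕ} (hh : 8 ≤ h) (hc : Consts h st)
    (h4 : st.reg 4 = (E + b.toNat * (4 * h) + h : ℕ)) (h9 : st.reg 9 = R)
    (hS : E + 4 * h + h + 2 ^ kin * R * (8 * h) + 8 * h ≤ S) (hSB : (S : ℤ) ≤ B)
    (hM : ∀ x, |st.mem x| ≤ M) (hMB : 2 * M ≤ B)
    (hf : Tab E h st.mem b f) (hg : Tab E h st.mem (!b) g) (hsupp : ∀ x, SuppIn h (f x))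
    (hR : ∀ x, 2 ^ kin * R ≤ x → f x = 0) :
    Tri S B (zeroCmd kin) st (kin + 8 + 2 ^ kin * R * (16 * h + 10)) fun st' =>
      Same [11, 12, 13, 14, 15, 16, 17, 18, 19, 20, 29] st st' ∧
      Tab E h st'.mem b (fun _ => 0) ∧ Tab E h st'.mem (!b) g ∧
      ∀ x < E, st'.mem x = st.mem x := by
  have hc' := hc
  obtain ⟨h3, h30, h7, h6⟩ := hc
  have h1 : b.toNat * (4 * h) ≤ 4 * h := by cases b <;> simp
  have h2 : 1 ≤ 2 ^ kin := Nat.one_le_two_pow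
  have h5 : R ≤ 2 ^ kin * R := Nat.le_mul_of_pos_left _ (by omega)
  have h10 : 2 ^ kin * R ≤ 2 ^ kin * R * (8 * h) := Nat.le_mul_of_pos_right _ (by omega)
  refine Tri.mono (Tri.seq (t := kin + 1 + 1 + 1 + 1 + 1)
    (t' := 2 ^ kin * R * (2 * h * 8 + 10) + 3)
    (Tri.add h4 h30 (by rw [abs_le]; constructor <;> omega)
    (Tri.add (x := (E + b.toNat * (4 * h) + h : ℕ)) (y := 0) (by simpa using h4) (by simpa using h30) (by rw [abs_le]; constructor <;> omega)
    (Tri.add (x := (8 * h : ℕ)) (y := 0) (by simpa using h6) (by simpa using h30) (by rw [abs_le]; constructor <;> omega)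
    (Tri.add (x := (8 * h : ℕ)) (y := 0) (by simpa using h6) (by simpa using h30) (by rw [abs_le]; constructor <;> omega)
    (Tri.add (x := R) (y := 0) (by simpa using h9) (by simpa using h30) (by rw [abs_le]; constructor <;> omega)
    (Tri.imp (tri_doubling (x := R) (by omega) (by simp) ?_) ?_)))))))
    (by ring_nf; omega) fun _ _ h => h
  · have : ((2 ^ kin * R : ℕ) : ℤ) ≤ B := by omega
    simpa using this
  rintro s1 - rfl
  have hno := zero_noClash (R := 2 ^ kin * R) (E := E) (h := h) (b := b) rfl
  refine Tri.imp (tri_scat (cnt := 2 * h) (R := 2 ^ kin * R) hno (by simpa using hM) hMB hSB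
    (by omega) (by omega) (by omega) (by omega) (by simpa using h3) (by simpa using h30)
    (by simpa using h7) (by simp) (by simp) (by simp) (by simp) (by simp)) ?_
  rintro s2 - ⟨k1, k2⟩
  obtain ⟨l1, l2, l3⟩ := zero_spec (R := 2 ^ kin * R) rfl hf hg hsupp hR
  simp only [Store.mem_set] at k2
  rw [← k2] at l1 l2 l3
  refine ⟨?_, l1, l2, l3⟩
  refine Same.trans ?_ (k1.mono (by decide))
  repeat' first | exact Same.refl _ _ | refine Same.set ?_ (by decide) _

/-- The terms fill the empty table, the old one is cleared, and the two addresses are exchanged; so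
the next operation finds the same situation with the parities swapped. In the time bound, 16 of the
17 additional rounds pay for clearing 2^kin ≤ 16 times as many rows, and one for the overhead. -/
theorem tri_op {kin kout r : ℕ} {ts : List Term} (ht : ∀ t ∈ ts, t.Small) (hh : 8 ≤ h)
    (hts : TabState E h b (kin + r) f st) (hkin : kin ≤ 4) (hkout : kout ≤ 4)
    (hS : E + 4 * h + h + 32 * (2 ^ r + 1) * (8 * h) + 2 * h + 8 ≤ S) (hSB : (S : ℤ) ≤ B)
    (hM : ∀ x, |st.mem x| ≤ M) (hMB : 2 * (2 ^ ts.length * M) ≤ B) (hsupp : ∀ x, SuppIn h (f x))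
    (hz : ∀ x, 2 ^ (kout + r) ≤ x → termsVal (2 ^ r) ts f x = 0) :
    Tri S B (opCmd kin kout ts) st
      ((ts.length + 17) * (2 ^ r * (16 * h + 10) + 80) + 4 * r) fun st' =>
      Same [4, 5, 8, 9, 10, 11, 12, 13, 14, 15, 16, 17, 18, 19, 20, 21, 29] st st' ∧
      TabState E h (!b) (kout + r) (termsVal (2 ^ r) ts f) st' ∧
      ∀ x < E, st'.mem x = st.mem x := by
  obtain ⟨hc, h4, h5, h8, hf, hg, hz0⟩ := hts
  have h0 : 0 ≤ M := (abs_nonneg _).trans (hM 0)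
  have hb1 : ∀ b : Bool, b.toNat * (4 * h) ≤ 4 * h := by intro b; cases b <;> simp
  have hb2 := hb1 b
  have hb3 := hb1 !b
  have e : 32 * (2 ^ r + 1) * (8 * h) = 32 * (2 ^ r * (8 * h)) + 32 * (8 * h) := by ring
  have hr : r < 2 ^ r := Nat.lt_two_pow_self
  have hr2 : 2 ^ r ≤ 2 ^ r * (8 * h) := Nat.le_mul_of_pos_right _ (by omega)
  have hp : 2 ^ kin ≤ 2 ^ 4 := Nat.pow_le_pow_right (by omega) hkin
  have hp2 : 2 ^ kin * 2 ^ r * (8 * h) ≤ 16 * (2 ^ r * (8 * h)) := by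
    rw [Nat.mul_assoc]; exact Nat.mul_le_mul_right _ hp
  have hp3 : 2 ^ kin * 2 ^ r * (16 * h + 10) ≤ 16 * (2 ^ r * (16 * h + 10)) := by
    rw [Nat.mul_assoc]; exact Nat.mul_le_mul_right _ hp
  refine Tri.mono (Tri.seq (t := 4 * r + 7)
    (t' := ts.length * (2 ^ r * (16 * h + 10) + 80) +
      ((kin + 8 + 2 ^ kin * 2 ^ r * (16 * h + 10)) + (0 + 1 + 1 + 1 + 1 + 1)))
    (Tri.imp (tri_pow hc h8 (by omega) (by omega) (by omega) (by omega)) ?_)) ?_ fun _ _ h => h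
  swap
  · have : (ts.length + 17) * (2 ^ r * (16 * h + 10) + 80) = ts.length * (2 ^ r * (16 * h + 10) + 80)
        + 17 * (2 ^ r * (16 * h + 10)) + 17 * 80 := by ring
    omega
  rintro s1 - ⟨k1, k2, k3, k4⟩
  have hc1 := hc.of_same k1 (by decide)
  have k14 := (k1 4 (by decide)).trans h4
  have k15 := (k1 5 (by decide)).trans h5
  have h1 : (1 : ℤ) ≤ 2 ^ ts.length := one_le_pow₀ (by norm_num)
  refine Tri.seq (Tri.imp (tri_terms ts ht hh hc1 k14 k15 k3 k4 hS hSB (by rwa [k2])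
    (by nlinarith) (by rwa [k2]) (by rwa [k2]) hsupp) ?_)
  rintro s2 - ⟨l1, l2, l3, l4, l5⟩
  have hc2 := hc1.of_same l1 (by decide)
  simp only [zero_add] at l3
  refine Tri.seq (Tri.imp (tri_zero (kin := kin) (R := 2 ^ r) hh hc2 ((l1 4 (by decide)).trans k14)
    ((l1 9 (by decide)).trans k3) (by omega) hSB l5 hMB l2 l3 hsupp ?_) ?_)
  · rw [← pow_add]; exact hz0
  rintro s3 - ⟨m1, m2, m3, m4⟩
  have hc3 := hc2.of_same m1 (by decide)
  have e4 := (m1 4 (by decide)).trans ((l1 4 (by decide)).trans k14)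
  have e5 := (m1 5 (by decide)).trans ((l1 5 (by decide)).trans k15)
  have e8 := (m1 8 (by decide)).trans ((l1 8 (by decide)).trans ((k1 8 (by decide)).trans h8))
  refine Tri.add e4 hc3.2.1 (by rw [abs_le]; constructor <;> omega) (Tri.add
    (x := (E + (!b).toNat * (4 * h) + h : ℕ)) (y := 0) (by simpa using e5)
    (by simpa using hc3.2.1) (by rw [abs_le]; constructor <;> omega) (Tri.add
    (x := (E + b.toNat * (4 * h) + h : ℕ) + 0) (y := 0) (by simp)
    (by simpa using hc3.2.1) (by simp only [add_zero]; rw [abs_le]; constructor <;> omega)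
    (Tri.const (by rw [abs_le]; constructor <;> omega) (Tri.add (x := (kin + r : ℕ)) (y := (kout - kin : ℤ)) (by simpa using e8)
    (by simp) (by rw [abs_le]; constructor <;> omega) (Tri.nil ?_)))))
  have hS3 : Same [4, 5, 8, 9, 10, 11, 12, 13, 14, 15, 16, 17, 18, 19, 20, 21, 29] st s3 :=
    (k1.mono (by decide)).trans ((l1.mono (by decide)).trans (m1.mono (by decide)))
  refine ⟨?_, ⟨?_, ?_, ?_, ?_, m3, ?_, hz⟩, ?_⟩
  · repeat' first | exact hS3 | refine Same.set ?_ (by decide) _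
  · refine hc3.of_same (l := [4, 5, 8, 19]) ?_ (by decide)
    repeat' first | exact Same.refl _ _ | refine Same.set ?_ (by decide) _
  · simp
  · simp
  · simp; ring
  · simpa using m2
  · intro x hx
    exact (m4 x hx).trans ((l4 x hx).trans (by rw [k2]))

end op

/-! ## The spin model -/

/-- The value of a circle. -/
def loopVal : LP := -T 2 - T (-2)

/-- The weights of an arc whose ends, in counterclockwise order, have spins `s` and `t`. -/
def cupW (s t : Bool) : LP := if s = t then 0 else if s then 1 else -T (-2)

/-- The weights of an arc outside of the disk. -/
def capW (s t : Bool) : LP := if s = t then 0 else if s then -T 2 else 1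

/-- The weight of an arc depends on which end comes first. When the first boundary point becomes the
last one, its arc exchanges the order of its ends, and this factor compensates for it. -/
def rotW (s : Bool) : LP := if s then -T (-2) else -T 2

theorem T_two_mul_T_neg_two : (T 2 : LP) * T (-2) = 1 := by
  rw [← LaurentPolynomial.T_add]; rfl

theorem rotW_mul_cupW (s t : Bool) : rotW s * cupW s t = cupW t s := by
  have h := T_two_mul_T_neg_two
  cases s <;> cases t <;> simp [rotW, cupW, -LaurentPolynomial.T_mul, h]

/-- An arc inside and an arc outside the disk with the same ends: the sum over the two spin
configurations is the value of a circle. -/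
theorem cap_cup_same : capW true false * cupW true false + capW false true * cupW false true =
    loopVal := by
  simp [capW, cupW, loopVal, sub_eq_add_neg, -LaurentPolynomial.T_mul]

/-- The zigzag identity: two nested arcs whose first ends are joined outside the disk straighten to
a single arc. -/
theorem cap_cup_cup (s t : Bool) : capW true false * (cupW true t * cupW false s) +
    capW false true * (cupW false t * cupW true s) = cupW s t := by
  have h := T_two_mul_T_neg_two
  cases s <;> cases t <;> simp [capW, cupW, -LaurentPolynomial.T_mul, h]

/-- Functions of the spins of the boundary points. -/
abbrev SpinFun := List Bool → LP

/-- In the new list the moved point is the last one. The default `false` matters only for the empty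
list, for which there is no rotation step. -/
def opRot (F : SpinFun) : SpinFun := fun l =>
  rotW (l.getLastD false) * F (l.getLastD false :: l.dropLast)

theorem opRot_append (F : SpinFun) (l : List Bool) (s : Bool) :
    opRot F (l ++ [s]) = rotW s * F (s :: l) := by
  simp [opRot]

def opCup (F : SpinFun) : SpinFun
  | s :: t :: l => cupW s t * F l
  | _ => 0

def opCap (F : SpinFun) : SpinFun := fun l =>
  capW true false * F (true :: false :: l) + capW false true * F (false :: true :: l)

/-- A smoothed crossing consists of two arcs on the first four points: side by side if `b` holds,
nested otherwise. -/
def opX (b : Bool) (F : SpinFun) : SpinFun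
  | s₀ :: s₁ :: s₂ :: s₃ :: l =>
      (if b then cupW s₀ s₁ * cupW s₂ s₃ else cupW s₁ s₂ * cupW s₀ s₃) * F l
  | _ => 0

/-! ## Weights of planar matchings -/

section val

open Classical in
def lnk {α : Type*} (R : α → α → Prop) (x : α) (s : Bool) : List α → List Bool → LP
  | y :: l, t :: ts => (if R x y then cupW s t else 1) * lnk R x s l ts
  | _, _ => 1

/-- The product of the weights of the arcs between related points of a list. -/
def val {α : Type*} (R : α → α → Prop) : List α → List Bool → LP
  | x :: l, s :: ts => lnk R x s l ts * val R l ts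
  | _, _ => 1

/-- The pairs of related points form a planar matching. -/
inductive Planar {α : Type*} (R : α → α → Prop) : List α → Prop
  | nil : Planar R []
  | arc (x : α) (u : List α) (y : α) (v : List α) : R x y → (∀ z ∈ u, ¬ R x z) →
      (∀ z ∈ v, ¬ R x z) → (∀ z ∈ u, ∀ w ∈ v, ¬ R z w) → Planar R u → Planar R v →
      Planar R (x :: u ++ y :: v)

variable {α : Type*} {R R' : α → α → Prop}

theorem lnk_append (x : α) (s : Bool) (u v : List α) (a b : List Bool) (h : u.length = a.length) :
    lnk R x s (u ++ v) (a ++ b) = lnk R x s u a * lnk R x s v b := by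
  induction u generalizing a with
  | nil =>
    obtain rfl : a = [] := by simpa [eq_comm] using h
    simp [lnk]
  | cons y u ih =>
    cases a with
    | nil => simp at h
    | cons t a =>
      simp only [List.cons_append, lnk]
      rw [ih a (by simpa using h), mul_assoc]

theorem lnk_eq_one {x : α} {s : Bool} {l : List α} {a : List Bool} (h : ∀ z ∈ l, ¬ R x z) :
    lnk R x s l a = 1 := by
  induction l generalizing a with
  | nil => simp [lnk]
  | cons y l ih =>
    cases a with
    | nil => simp [lnk]
    | cons t a =>
      simp only [lnk]
      rw [ih fun z hz => h z (by simp [hz]), if_neg (h y (by simp)), one_mul]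

theorem val_append {u v : List α} {a b : List Bool} (h : u.length = a.length)
    (huv : ∀ z ∈ u, ∀ w ∈ v, ¬ R z w) : val R (u ++ v) (a ++ b) = val R u a * val R v b := by
  induction u generalizing a with
  | nil =>
    obtain rfl : a = [] := by simpa [eq_comm] using h
    simp [val]
  | cons y u ih =>
    cases a with
    | nil => simp at h
    | cons t a =>
      simp only [List.cons_append, val]
      rw [ih (by simpa using h) fun z hz => huv z (by simp [hz]),
        lnk_append _ _ _ _ _ _ (by simpa using h), lnk_eq_one (huv y (by simp))]
      ring

/-- The recursion that corresponds to `Planar.arc`. As `R` is an equivalence relation, the partner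
of `x` is unrelated to the remaining points as well, so the outer arc contributes a single factor.
-/
theorem val_arc (hR : Equivalence R) {x y : α} {u v : List α} {s t : Bool} {a b : List Bool}
    (hua : u.length = a.length)
    (hxy : R x y) (hu : ∀ z ∈ u, ¬ R x z) (hv : ∀ z ∈ v, ¬ R x z)
    (huv : ∀ z ∈ u, ∀ w ∈ v, ¬ R z w) :
    val R (x :: u ++ y :: v) (s :: a ++ t :: b) = cupW s t * (val R u a * val R v b) := by
  have h1 : ∀ z ∈ u, ∀ w ∈ y :: v, ¬ R z w := by
    intro z hz w hw h
    rcases List.mem_cons.1 hw with rfl | hw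
    · exact hu z hz (hR.trans hxy (hR.symm h))
    · exact huv z hz w hw h
  have h2 : ∀ z ∈ v, ¬ R y z := fun z hz h => hv z hz (hR.trans hxy h)
  simp only [List.cons_append, val]
  rw [lnk_append _ _ _ _ _ _ hua, lnk_eq_one hu, val_append hua h1]
  simp only [val, lnk]
  rw [lnk_eq_one hv, lnk_eq_one h2, if_pos hxy]
  ring

theorem lnk_congr {x : α} {s : Bool} {l : List α} {a : List Bool} (h : ∀ z ∈ l, R x z ↔ R' x z) :
    lnk R x s l a = lnk R' x s l a := by
  induction l generalizing a with
  | nil => simp [lnk]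
  | cons y l ih =>
    cases a with
    | nil => simp [lnk]
    | cons t a =>
      simp only [lnk]
      rw [ih fun z hz => h z (by simp [hz])]
      congr 2
      exact propext (h y (by simp))

theorem val_congr {l : List α} {a : List Bool} (h : ∀ z ∈ l, ∀ w ∈ l, R z w ↔ R' z w) :
    val R l a = val R' l a := by
  induction l generalizing a with
  | nil => simp [val]
  | cons y l ih =>
    cases a with
    | nil => simp [val]
    | cons t a =>
      simp only [val]
      rw [ih fun z hz w hw => h z (by simp [hz]) w (by simp [hw]),
        lnk_congr fun z hz => h y (by simp) z (by simp [hz])]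

theorem Planar.congr {l : List α} (hl : Planar R l) (h : ∀ z ∈ l, ∀ w ∈ l, R z w ↔ R' z w) :
    Planar R' l := by
  induction hl with
  | nil => exact .nil
  | arc x u y v hxy hu hv huv _ _ ihu ihv =>
    have hx : x ∈ x :: u ++ y :: v := by simp
    have hy : y ∈ x :: u ++ y :: v := by simp
    have hmu : ∀ z ∈ u, z ∈ x :: u ++ y :: v := fun z hz => by simp [hz]
    have hmv : ∀ z ∈ v, z ∈ x :: u ++ y :: v := fun z hz => by simp [hz]
    refine .arc x u y v ((h _ hx _ hy).1 hxy) (fun z hz h' => hu z hz ((h _ hx _ (hmu z hz)).2 h'))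
      (fun z hz h' => hv z hz ((h _ hx _ (hmv z hz)).2 h'))
      (fun z hz w hw h' => huv z hz w hw ((h _ (hmu z hz) _ (hmv w hw)).2 h'))
      (ihu fun z hz w hw => h z (hmu z hz) w (hmu w hw))
      (ihv fun z hz w hw => h z (hmv z hz) w (hmv w hw))

theorem Planar.append {u v : List α} (hu : Planar R u) (hv : Planar R v)
    (h : ∀ z ∈ u, ∀ w ∈ v, ¬ R z w) : Planar R (u ++ v) := by
  induction hu with
  | nil => exact hv
  | arc x a y b hxy ha hb hab hpa _ _ ihb =>
    rw [List.append_assoc, List.cons_append]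
    refine .arc x a y (b ++ v) hxy ha ?_ ?_ hpa
      (ihb fun z hz w hw => h z (by simp [hz]) w hw)
    · intro z hz
      rcases List.mem_append.1 hz with hz | hz
      · exact hb z hz
      · exact h x (by simp) z hz
    · intro z hz w hw
      rcases List.mem_append.1 hw with hw | hw
      · exact hab z hz w hw
      · exact h z (by simp [hz]) w hw

theorem exists_split {u v : List α} {a : List Bool} (h : (u ++ v).length = a.length) :
    ∃ b c, a = b ++ c ∧ u.length = b.length ∧ v.length = c.length :=
  ⟨a.take u.length, a.drop u.length, (List.take_append_drop _ _).symm,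
    by rw [List.length_append] at h; simp; omega, by rw [List.length_append] at h; simp; omega⟩

theorem exists_split_cons {u v : List α} {x : α} {a : List Bool}
    (h : (u ++ x :: v).length = a.length) :
    ∃ b s c, a = b ++ s :: c ∧ u.length = b.length ∧ v.length = c.length := by
  obtain ⟨b, c, rfl, h1, h2⟩ := exists_split h
  cases c with
  | nil => simp at h2
  | cons s c => exact ⟨b, s, c, rfl, h1, by simpa using h2⟩

/-- Moving `x` to the end turns the arc from `x` to `y` around `u` into an arc from `y` to `x`
around `v`. All other arcs keep the order of their ends, so only one factor changes. -/
theorem planar_rotate (hR : Equivalence R) {x : α} {r : List α} (h : Planar R (x :: r)) :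
    Planar R (r ++ [x]) ∧ ∀ (s : Bool) (a : List Bool), r.length = a.length →
      rotW s * val R (x :: r) (s :: a) = val R (r ++ [x]) (a ++ [s]) := by
  generalize hl : x :: r = l at h
  cases h with
  | nil => simp at hl
  | arc x' u y v hxy hu hv huv hpu hpv =>
    simp only [List.cons_append, List.cons.injEq] at hl
    obtain ⟨rfl, rfl⟩ := hl
    have h1 : ∀ z ∈ v, ¬ R y z := fun z hz h => hv z hz (hR.trans hxy h)
    have h2 : ∀ z ∈ u, ∀ w ∈ y :: v ++ [x], ¬ R z w := by
      intro z hz w hw h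
      simp only [List.cons_append, List.mem_cons, List.mem_append, List.not_mem_nil,
        or_false] at hw
      rcases hw with rfl | hw | rfl
      · exact hu z hz (hR.trans hxy (hR.symm h))
      · exact huv z hz w hw h
      · exact hu z hz (hR.symm h)
    constructor
    · rw [List.append_assoc]
      refine Planar.append hpu ?_ h2
      exact .arc y v x [] (hR.symm hxy) h1 (by simp) (by simp) hpv .nil
    · intro s a ha
      obtain ⟨b, t, c, rfl, hb, hc⟩ := exists_split_cons ha
      rw [List.append_assoc, List.append_assoc, val_append hb h2]
      have e1 := val_arc (s := s) (t := t) (a := b) (b := c) hR hb hxy hu hv huv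
      have e2 := val_arc (x := y) (y := x) (u := v) (v := []) (s := t) (t := s) (a := c) (b := [])
        hR hc (hR.symm hxy) h1 (by simp) (by simp)
      simp only [List.cons_append] at e1 e2 ⊢
      rw [e1, e2, ← rotW_mul_cupW s t]
      simp only [val]
      ring

/-- The equivalence relation generated by `R` and the pair `x`, `y`. -/
def mrg (R : α → α → Prop) (x y z w : α) : Prop := R z w ∨ (R z x ∧ R y w) ∨ (R z y ∧ R x w)

theorem mrg_equivalence (hR : Equivalence R) (x y : α) : Equivalence (mrg R x y) := by
  refine ⟨fun z => Or.inl (hR.refl z), ?_, ?_⟩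
  · rintro z w (h | ⟨h, h'⟩ | ⟨h, h'⟩)
    · exact Or.inl (hR.symm h)
    · exact Or.inr (Or.inr ⟨hR.symm h', hR.symm h⟩)
    · exact Or.inr (Or.inl ⟨hR.symm h', hR.symm h⟩)
  · rintro z w v (h | ⟨h, h'⟩ | ⟨h, h'⟩) (k | ⟨k, k'⟩ | ⟨k, k'⟩)
    · exact Or.inl (hR.trans h k)
    · exact Or.inr (Or.inl ⟨hR.trans h k, k'⟩)
    · exact Or.inr (Or.inr ⟨hR.trans h k, k'⟩)
    · exact Or.inr (Or.inl ⟨h, hR.trans h' k⟩)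
    · exact Or.inl (hR.trans h (hR.trans (hR.symm (hR.trans h' k)) k'))
    · exact Or.inl (hR.trans h k')
    · exact Or.inr (Or.inr ⟨h, hR.trans h' k⟩)
    · exact Or.inl (hR.trans h k')
    · exact Or.inl (hR.trans h (hR.trans (hR.symm (hR.trans h' k)) k'))

theorem mrg_iff_of_not (hR : Equivalence R) {x y z w : α} (hx : ¬ R x z) (hy : ¬ R y z) :
    mrg R x y z w ↔ R z w :=
  ⟨fun h => h.resolve_right fun h => h.elim (fun h => hx (hR.symm h.1)) fun h => hy (hR.symm h.1),
    Or.inl⟩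

/-- Two neighbours that are partners bound an arc with nothing inside it; joining them splits off a
circle and leaves the rest of the matching as it is. -/
theorem planar_cap_same (hR : Equivalence R) {x y : α} {r : List α} (h : Planar R (x :: y :: r))
    (hxy : R x y) : Planar R r ∧ ∀ a : List Bool, r.length = a.length →
      opCap (val R (x :: y :: r)) a = loopVal * val R r a := by
  generalize hl : x :: y :: r = l at h
  cases h with
  | nil => simp at hl
  | arc x' u y' v hxy' hu hv huv hpu hpv =>
    simp only [List.cons_append, List.cons.injEq] at hl
    obtain ⟨rfl, hl⟩ := hl
    cases u with
    | cons z u =>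
      simp only [List.cons_append, List.cons.injEq] at hl
      obtain ⟨rfl, -⟩ := hl
      exact absurd hxy (hu y (by simp))
    | nil =>
      simp only [List.nil_append, List.cons.injEq] at hl
      obtain ⟨rfl, rfl⟩ := hl
      refine ⟨hpv, fun a ha => ?_⟩
      have e : ∀ s t, val R (x :: y :: r) (s :: t :: a) = cupW s t * (val R [] [] * val R r a) := by
        intro s t
        have := val_arc (s := s) (t := t) (a := []) (b := a) hR rfl hxy hu hv huv
        simpa only [List.cons_append, List.nil_append] using this
      simp only [opCap, List.cons_append, List.nil_append]
      rw [e, e, ← cap_cup_same]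
      simp only [val]
      ring

/-- Planarity forces the order x, y, p, y₁, q, x₁, v, where x₁ and y₁ are the partners of x and y.
Joining x and y makes y₁ and x₁ partners, with q inside the new arc, and the zigzag identity gives
its weight. -/
theorem planar_cap_diff (hR : Equivalence R) {x y : α} {r : List α} (h : Planar R (x :: y :: r))
    (hxy : ¬ R x y) : Planar (mrg R x y) r ∧ ∀ a : List Bool, r.length = a.length →
      opCap (val R (x :: y :: r)) a = val (mrg R x y) r a := by
  generalize hl : x :: y :: r = l at h
  cases h with
  | nil => simp at hl
  | arc x' u x₁ v hxx hu hv huv hpu hpv =>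
    simp only [List.cons_append, List.cons.injEq] at hl
    obtain ⟨rfl, hl⟩ := hl
    cases hpu with
    | nil =>
      simp only [List.nil_append, List.cons.injEq] at hl
      obtain ⟨rfl, rfl⟩ := hl
      exact absurd hxx hxy
    | arc y' p y₁ q hyy hp hq hpq hpp hpq' =>
      simp only [List.cons_append, List.cons.injEq] at hl
      obtain ⟨rfl, rfl⟩ := hl
      have xp : ∀ z ∈ p, ¬ R x z := fun z hz => hu z (by simp [hz])
      have xq : ∀ z ∈ q, ¬ R x z := fun z hz => hu z (by simp [hz])
      have yv : ∀ z ∈ v, ¬ R y z := huv y (by simp)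
      have pv : ∀ z ∈ p, ∀ w ∈ v, ¬ R z w := fun z hz => huv z (by simp [hz])
      have qv : ∀ z ∈ q, ∀ w ∈ v, ¬ R z w := fun z hz => huv z (by simp [hz])
      have hM := mrg_equivalence hR x y
      have mp : ∀ z ∈ p, ∀ w, mrg R x y z w ↔ R z w := fun z hz w =>
        mrg_iff_of_not hR (xp z hz) (hp z hz)
      have mq : ∀ z ∈ q, ∀ w, mrg R x y z w ↔ R z w := fun z hz w =>
        mrg_iff_of_not hR (xq z hz) (hq z hz)
      have mv : ∀ z ∈ v, ∀ w, mrg R x y z w ↔ R z w := fun z hz w =>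
        mrg_iff_of_not hR (hv z hz) (yv z hz)
      have m1 : mrg R x y y₁ x₁ := Or.inr (Or.inr ⟨hR.symm hyy, hxx⟩)
      have m2 : ∀ z ∈ q, ¬ mrg R x y y₁ z := fun z hz h =>
        hq z hz (hR.trans hyy (hR.symm ((mq z hz _).1 (hM.symm h))))
      have m3 : ∀ z ∈ v, ¬ mrg R x y y₁ z := fun z hz h =>
        yv z hz (hR.trans hyy (hR.symm ((mv z hz _).1 (hM.symm h))))
      have m4 : ∀ z ∈ q, ∀ w ∈ v, ¬ mrg R x y z w := fun z hz w hw h =>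
        qv z hz w hw ((mq z hz w).1 h)
      have m5 : ∀ z ∈ p, ∀ w ∈ y₁ :: q ++ x₁ :: v, ¬ mrg R x y z w := by
        intro z hz w hw h
        rw [mp z hz] at h
        simp only [List.cons_append, List.mem_cons, List.mem_append] at hw
        rcases hw with rfl | hw | rfl | hw
        · exact hp z hz (hR.trans hyy (hR.symm h))
        · exact hpq z hz w hw h
        · exact xp z hz (hR.trans hxx (hR.symm h))
        · exact pv z hz w hw h
      rw [show p ++ y₁ :: q ++ x₁ :: v = p ++ (y₁ :: q ++ x₁ :: v) by simp]
      constructor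
      · refine Planar.append (hpp.congr fun z hz w _ => (mp z hz w).symm) ?_ m5
        exact .arc y₁ q x₁ v m1 m2 m3 m4 (hpq'.congr fun z hz w _ => (mq z hz w).symm)
          (hpv.congr fun z hz w _ => (mv z hz w).symm)
      · intro a ha
        obtain ⟨b, a', rfl, hb, ha'⟩ := exists_split ha
        rw [List.cons_append] at ha'
        cases a' with
        | nil => simp at ha'
        | cons s a' =>
        obtain ⟨c, t, d, rfl, hc, hd⟩ := exists_split_cons (u := q) (v := v) (x := x₁)
          (a := a') (by simpa using ha')
        rw [val_append hb m5]
        have e1 := val_arc (s := s) (t := t) (a := c) (b := d) hM hc m1 m2 m3 m4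
        simp only [List.cons_append] at e1 ⊢
        rw [e1, val_congr (l := p) fun z hz w _ => mp z hz w,
          val_congr (l := q) fun z hz w _ => mq z hz w,
          val_congr (l := v) fun z hz w _ => mv z hz w]
        have e2 : ∀ s₀ s₁, val R (x :: y :: (p ++ y₁ :: (q ++ x₁ :: v)))
            (s₀ :: s₁ :: (b ++ s :: (c ++ t :: d))) =
            cupW s₀ t * (cupW s₁ s * (val R p b * val R q c) * val R v d) := by
          intro s₀ s₁
          have h1 := val_arc (s := s₀) (t := t) (a := s₁ :: b ++ s :: c) (b := d) hR
            (by simp [hb, hc]) hxx hu hv huv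
          have h2 := val_arc (s := s₁) (t := s) (a := b) (b := c) hR hb hyy hp hq hpq
          rw [h2] at h1
          simpa using h1
        simp only [opCap, List.append_assoc, List.cons_append]
        rw [e2, e2, ← cap_cup_cup s t]
        ring

end val

/-! ## Elementary steps of a cutting -/

/-- A step of a cutting is composed of: moving the cut point of the boundary, adding an
arc or a crossing at the cut point, and joining the first two boundary points. -/
inductive Micro (n : ℕ)
  | rot
  | cup
  | cap
  | x (c : Fin n) (j : Fin 4)

inductive MStep {n : ℕ} : Micro n → Tangle n → Tangle n → Prop
  | rot (b js k) : b ≠ [] → MStep .rot ⟨b, js, k⟩ ⟨b.rotate 1, js, k⟩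
  | cup (b js k) : MStep .cup ⟨b, js, k⟩ ⟨.cup k false :: .cup k true :: b, js, k + 1⟩
  | cap (x y b js k) : MStep .cap ⟨x :: y :: b, js, k⟩ ⟨b, (x, y) :: js, k⟩
  | x (c j b js k) : MStep (.x c j) ⟨b, js, k⟩
      ⟨[.dart (c, j), .dart (c, j + 1), .dart (c, j + 2), .dart (c, j + 3)] ++ b, js, k⟩

/-- A sequence of elementary steps in which the tangles have at most `G` boundary points. -/
inductive MRun {n : ℕ} (G : ℕ) : List (Micro n) → Tangle n → Tangle n → Prop
  | nil (T) : MRun G [] T T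
  | cons {m ms T T' T''} : MStep m T T' → T'.boundary.length ≤ G → MRun G ms T' T'' →
      MRun G (m :: ms) T T''

def even4 (j : Fin 4) : Bool := decide (j.val % 2 = 0)

/-- The effect of an elementary step on the state vector, when the smoothings of `c` have the
weights `w c`. -/
def Micro.op {n : ℕ} (w : Fin n → Bool → LP) : Micro n → SpinFun → SpinFun
  | .rot, F => opRot F
  | .cup, F => opCup F
  | .cap, F => opCap F
  | .x c j, F => fun l => w c true * opX (even4 j) F l + w c false * opX (!even4 j) F l

def Micro.crossing? {n : ℕ} : Micro n → Option (Fin n)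
  | .x c _ => some c
  | _ => none

/-- The state vector of the empty tangle. -/
def spinOne : SpinFun := fun _ => 1

def runOp {n : ℕ} (w : Fin n → Bool → LP) (ms : List (Micro n)) (F : SpinFun) : SpinFun :=
  ms.foldl (fun F m => m.op w F) F

section eqv

/-- With one additional generating pair, a chain needs to use that pair at most once, so `mrg`
describes the new closure. -/
theorem eqvGen_insert {α : Type*} {r r' : α → α → Prop} {x y : α}
    (h : ∀ a b, r' a b ↔ r a b ∨ a = x ∧ b = y) (a b : α) :
    Relation.EqvGen r' a b ↔ mrg (Relation.EqvGen r) x y a b := by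
  have hR := Relation.EqvGen.is_equivalence r
  constructor
  · intro hab
    induction hab with
    | rel a b hab =>
      rcases (h a b).1 hab with hab | ⟨rfl, rfl⟩
      · exact Or.inl (.rel _ _ hab)
      · exact Or.inr (Or.inl ⟨hR.refl _, hR.refl _⟩)
    | refl a => exact (mrg_equivalence hR x y).refl a
    | symm a b _ ih => exact (mrg_equivalence hR x y).symm ih
    | trans a b c _ _ ih ih' => exact (mrg_equivalence hR x y).trans ih ih'
  · have hR' := Relation.EqvGen.is_equivalence r'
    have hm : ∀ a b, Relation.EqvGen r a b → Relation.EqvGen r' a b := fun a b hab =>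
      hab.mono fun a b hab => (h a b).2 (Or.inl hab)
    have hxy : Relation.EqvGen r' x y := .rel _ _ ((h x y).2 (Or.inr ⟨rfl, rfl⟩))
    rintro (h | ⟨h, h'⟩ | ⟨h, h'⟩)
    · exact hm _ _ h
    · exact hR'.trans (hm _ _ h) (hR'.trans hxy (hm _ _ h'))
    · exact hR'.trans (hm _ _ h) (hR'.trans (hR'.symm hxy) (hm _ _ h'))

end eqv

/-! ### Pieces of a smoothed, partially built diagram -/

section smoothed

variable {n : ℕ} {s : Fin n → Bool}

theorem smoothing_smoothing (b : Bool) (j : Fin 4) : smoothing b (smoothing b j) = j := by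
  revert b j; decide

/-- The other end of the arc at a half-edge of a smoothed crossing. -/
def smEnd (s : Fin n → Bool) : StrandEnd n → StrandEnd n
  | .dart d => .dart (d.1, smoothing (s d.1) d.2)
  | .cup k b => .cup k b

theorem smEnd_smEnd (x : StrandEnd n) : smEnd s (smEnd s x) = x := by
  cases x <;> simp [smEnd, smoothing_smoothing]

/-- The ends are on a common piece: joined, on a crossingless arc, or at a smoothed crossing. -/
def edge (s : Fin n → Bool) (js : List (StrandEnd n × StrandEnd n)) (k : ℕ)
    (x y : StrandEnd n) : Prop :=
  (x, y) ∈ js ∨ (∃ i < k, x = .cup i false ∧ y = .cup i true) ∨ y = smEnd s x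

/-- The crossings count as smoothed from the beginning, even before they are added. So the relation
changes only with joins and new arcs, and a crossing step merely exposes half-edges. -/
def Rel (s : Fin n → Bool) (js : List (StrandEnd n × StrandEnd n)) (k : ℕ) :
    StrandEnd n → StrandEnd n → Prop :=
  Relation.EqvGen (edge s js k)

theorem rel_equivalence (s : Fin n → Bool) (js k) : Equivalence (Rel s js k) :=
  Relation.EqvGen.is_equivalence _

theorem rel_cap {js : List (StrandEnd n × StrandEnd n)} {k : ℕ} {x y : StrandEnd n} :
    Rel s ((x, y) :: js) k = mrg (Rel s js k) x y := by
  ext a b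
  refine eqvGen_insert (fun a b => ?_) a b
  simp only [edge, List.mem_cons, Prod.mk.injEq, or_assoc, or_comm, or_left_comm]

theorem rel_cup {js : List (StrandEnd n × StrandEnd n)} {k : ℕ} :
    Rel s js (k + 1) = mrg (Rel s js k) (.cup k false) (.cup k true) := by
  ext a b
  refine eqvGen_insert (fun a b => ?_) a b
  have : (∃ i < k + 1, a = .cup i false ∧ b = .cup i true) ↔
      (∃ i < k, a = .cup i false ∧ b = .cup i true) ∨ a = .cup k false ∧ b = .cup k true := by
    constructor
    · rintro ⟨i, hi, h⟩
      rcases (Nat.lt_succ_iff.1 hi).lt_or_eq with h' | rfl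
      · exact Or.inl ⟨i, h', h⟩
      · exact Or.inr h
    · rintro (⟨i, hi, h⟩ | h)
      · exact ⟨i, by omega, h⟩
      · exact ⟨k, by omega, h⟩
  simp only [edge, this, or_comm, or_left_comm]

/-- The end has been introduced already. -/
def Intro (added : List (Fin n)) (k : ℕ) : StrandEnd n → Prop
  | .dart d => d.1 ∈ added
  | .cup i _ => i < k

theorem intro_smEnd {added : List (Fin n)} {k : ℕ} (x : StrandEnd n) :
    Intro added k (smEnd s x) ↔ Intro added k x := by
  cases x <;> rfl

/-- Joins involve introduced ends only; an end not yet introduced is therefore related to nothing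
but itself and its partner in the smoothing. -/
theorem rel_of_not_intro {added : List (Fin n)} {js : List (StrandEnd n × StrandEnd n)} {k : ℕ}
    (hj : ∀ p ∈ js, Intro added k p.1 ∧ Intro added k p.2) {x y : StrandEnd n}
    (h : Rel s js k x y) :
    (Intro added k x ↔ Intro added k y) ∧ (¬ Intro added k x → y = x ∨ y = smEnd s x) := by
  induction h with
  | rel x y h =>
    rcases h with h | ⟨i, hi, rfl, rfl⟩ | rfl
    · have := hj _ h
      exact ⟨iff_of_true this.1 this.2, fun h => absurd this.1 h⟩
    · exact ⟨Iff.rfl, fun h => absurd hi h⟩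
    · exact ⟨(intro_smEnd x).symm, fun _ => Or.inr rfl⟩
  | refl x => exact ⟨Iff.rfl, fun _ => Or.inl rfl⟩
  | symm x y _ ih =>
    refine ⟨ih.1.symm, fun h => ?_⟩
    rcases ih.2 (fun h' => h (ih.1.1 h')) with rfl | rfl
    · exact Or.inl rfl
    · exact Or.inr (smEnd_smEnd x).symm
  | trans x y z _ _ ih ih' =>
    refine ⟨ih.1.trans ih'.1, fun h => ?_⟩
    have h' := ih'.2 fun h' => h (ih.1.2 h')
    rcases ih.2 h with rfl | rfl
    · exact h'
    · rw [smEnd_smEnd] at h'; exact h'.symm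

open Classical in
/-- All half-edges of crossings and the ends of the first `k` crossingless arcs. -/
def ends (n k : ℕ) : Finset (StrandEnd n) :=
  Finset.univ.image StrandEnd.dart ∪
    (Finset.range k ×ˢ Finset.univ).image fun p : ℕ × Bool => StrandEnd.cup p.1 p.2

@[simp] theorem dart_mem_ends {k : ℕ} (d : Dart n) : StrandEnd.dart d ∈ ends n k := by
  simp [ends]

@[simp] theorem cup_mem_ends {k i : ℕ} {b : Bool} : StrandEnd.cup i b ∈ ends n k ↔ i < k := by
  simp [ends]

theorem Intro.mem_ends {added : List (Fin n)} {k : ℕ} {x : StrandEnd n} (h : Intro added k x) :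
    x ∈ ends n k := by
  cases x with
  | dart d => simp
  | cup i b => exact cup_mem_ends.2 h

theorem Intro.mono {added added' : List (Fin n)} {k k' : ℕ} (ha : added ⊆ added') (hk : k ≤ k')
    {x : StrandEnd n} (h : Intro added k x) : Intro added' k' x := by
  cases x with
  | dart d => exact ha h
  | cup i b => exact lt_of_lt_of_le h hk

/-- Relation between a partially built smoothed diagram and its state vector `F`; there are `ℓ`
circles. -/
structure PInv (s : Fin n → Bool) (added : List (Fin n)) (t : Tangle n) (ℓ : ℕ)
    (F : SpinFun) : Prop where
  val : ∀ a : List Bool, t.boundary.length = a.length →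
    F a = loopVal ^ ℓ * val (Rel s t.joins t.cups) t.boundary a
  planar : Planar (Rel s t.joins t.cups) t.boundary
  bdry : ∀ x ∈ t.boundary, Intro added t.cups x
  joins : ∀ p ∈ t.joins, Intro added t.cups p.1 ∧ Intro added t.cups p.2
  count : ∃ lab : StrandEnd n → ℕ, (∀ x ∈ ends n t.cups, ∀ y ∈ ends n t.cups,
      Rel s t.joins t.cups x y ↔ lab x = lab y) ∧
    -- Every class is a circle, or an arc with two boundary points, or one of the two arcs at a
    -- crossing that has not been added. Twice the number of classes is thus twice the number of
    -- circles, plus the boundary points, plus 4 for each missing crossing.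
    2 * ((ends n t.cups).image lab).card + 4 * added.length = 2 * ℓ + t.boundary.length + 4 * n

variable {added : List (Fin n)} {t t' : Tangle n} {ℓ : ℕ} {F : SpinFun}

theorem PInv.rot {b : List (StrandEnd n)} {js k} (h : PInv s added ⟨b, js, k⟩ ℓ F) (hb : b ≠ []) :
    PInv s added ⟨b.rotate 1, js, k⟩ ℓ (opRot F) := by
  obtain ⟨x, r, rfl⟩ := List.exists_cons_of_ne_nil hb
  have e : (x :: r).rotate 1 = r ++ [x] := by simp
  rw [e]
  obtain ⟨h1, h2, h3, h4, h5⟩ := h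
  obtain ⟨k1, k2⟩ := planar_rotate (rel_equivalence s js k) h2
  refine ⟨fun a ha => ?_, k1, ?_, h4, ?_⟩
  · obtain ⟨a', c, rfl, e1, e2⟩ := exists_split ha
    obtain ⟨z, rfl⟩ : ∃ z, c = [z] := List.length_eq_one_iff.1 (by simpa using e2.symm)
    rw [opRot_append, h1 _ (by simp [e1]), ← k2 z a' e1]
    ring
  · intro z hz
    exact h3 z (by simp at hz ⊢; tauto)
  · simpa using h5

theorem PInv.cup {b : List (StrandEnd n)} {js k} (h : PInv s added ⟨b, js, k⟩ ℓ F) :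
    PInv s added ⟨.cup k false :: .cup k true :: b, js, k + 1⟩ ℓ (opCup F) := by
  obtain ⟨h1, h2, h3, h4, h5⟩ := h
  simp only at h1 h2 h3 h4 h5
  have hR := rel_equivalence s js k
  have hfr : ∀ c x, Rel s js k (.cup k c) x → x = .cup k c := by
    intro c x hx
    have := (rel_of_not_intro h4 hx).2 (lt_irrefl k)
    simpa [smEnd] using this
  have hfr' : ∀ c x, Intro added k x → ¬ Rel s js k (.cup k c) x := by
    intro c x hx hr
    rw [hfr c x hr] at hx
    exact lt_irrefl k hx
  have hm : ∀ z, Intro added k z → ∀ w, mrg (Rel s js k) (.cup k false) (.cup k true) z w ↔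
      Rel s js k z w := fun z hz w => mrg_iff_of_not hR (hfr' _ _ hz) (hfr' _ _ hz)
  have hM := mrg_equivalence hR (.cup k false) (.cup k true)
  have hb : ∀ z ∈ b, ¬ mrg (Rel s js k) (.cup k false) (.cup k true) (.cup k false) z :=
    fun z hz h => hfr' _ _ (h3 z hz) (hR.symm ((hm z (h3 z hz) _).1 (hM.symm h)))
  have hcc : mrg (Rel s js k) (.cup k false) (.cup k true) (.cup k false) (.cup k true) :=
    Or.inr (Or.inl ⟨hR.refl _, hR.refl _⟩)
  refine ⟨fun a ha => ?_, ?_, ?_, ?_, ?_⟩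
  · simp only at ha ⊢
    match a, ha with
    | p :: q :: a, ha =>
      have := val_arc (u := []) (v := b) (s := p) (t := q) (a := []) (b := a) hM rfl hcc (by simp)
        hb (by simp)
      simp only [List.nil_append, List.cons_append] at this
      rw [rel_cup, this, opCup, h1 a (by simpa using ha),
        val_congr (l := b) fun z hz w _ => hm z (h3 z hz) w]
      simp only [KauffmanGirth.val]
      ring
  · simp only [rel_cup]
    exact .arc _ [] _ b hcc (by simp) hb (by simp) .nil
      (h2.congr fun z hz w _ => (hm z (h3 z hz) w).symm)
  · intro x hx
    simp only [List.mem_cons] at hx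
    rcases hx with rfl | rfl | hx
    · exact Nat.lt_succ_self k
    · exact Nat.lt_succ_self k
    · exact (h3 x hx).mono (fun _ => id) (by simp)
  · intro p hp
    exact ⟨(h4 p hp).1.mono (fun _ => id) (by simp), (h4 p hp).2.mono (fun _ => id) (by simp)⟩
  · obtain ⟨lab, hl, hc⟩ := h5
    classical
    obtain ⟨N, hN⟩ := Infinite.exists_notMem_finset ((ends n k).image lab)
    have hN' : ∀ x ∈ ends n k, lab x ≠ N := fun x hx e =>
      hN (Finset.mem_image.2 ⟨x, hx, e⟩)
    have hcup : ∀ x ∈ ends n (k + 1), x ∈ ends n k ∨ ∃ c, x = .cup k c := by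
      intro x hx
      cases x with
      | dart d => exact Or.inl (by simp)
      | cup i c =>
        rw [cup_mem_ends] at hx
        rcases (Nat.lt_succ_iff.1 hx).lt_or_eq with h | rfl
        · exact Or.inl (by simpa using h)
        · exact Or.inr ⟨c, rfl⟩
    have hne : ∀ x ∈ ends n k, ∀ c, x ≠ .cup k c := by
      rintro x hx c rfl
      simp at hx
    have hmE : ∀ z ∈ ends n k, ∀ w, mrg (Rel s js k) (.cup k false) (.cup k true) z w ↔
        Rel s js k z w := fun z hz w =>
      mrg_iff_of_not hR (fun h => hne z hz _ (hfr _ _ h)) (fun h => hne z hz _ (hfr _ _ h))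
    -- The new arc is a class of its own and gets the fresh label `N`.
    let lab' : StrandEnd n → ℕ := fun x => if x = .cup k false ∨ x = .cup k true then N else lab x
    have l1 : ∀ x ∈ ends n k, lab' x = lab x := fun x hx =>
      if_neg (by rintro (h | h) <;> exact hne x hx _ h)
    have l2 : ∀ c, lab' (.cup k c) = N := fun c => if_pos (by cases c <;> simp)
    have hcc' : ∀ c c', mrg (Rel s js k) (.cup k false) (.cup k true) (.cup k c) (.cup k c') := by
      intro c c'
      cases c <;> cases c'
      · exact hM.refl _
      · exact hcc
      · exact hM.symm hcc
      · exact hM.refl _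
    refine ⟨lab', ?_, ?_⟩
    · simp only [rel_cup]
      intro x hx y hy
      rcases hcup x hx with hx | ⟨c, rfl⟩ <;> rcases hcup y hy with hy | ⟨c', rfl⟩
      · rw [hmE x hx, hl x hx y hy, l1 x hx, l1 y hy]
      · rw [hmE x hx, l1 x hx, l2]
        exact iff_of_false (fun h => hne x hx _ (hfr _ _ (hR.symm h))) (hN' x hx)
      · rw [l2, l1 y hy]
        exact iff_of_false (fun h => hne y hy _ (hfr _ _ (hR.symm ((hmE y hy _).1 (hM.symm h)))))
          (hN' y hy).symm
      · rw [l2, l2]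
        exact iff_of_true (hcc' c c') rfl
    · have e : (ends n (k + 1)).image lab' = insert N ((ends n k).image lab) := by
        ext v
        simp only [Finset.mem_image, Finset.mem_insert]
        constructor
        · rintro ⟨x, hx, rfl⟩
          rcases hcup x hx with hx | ⟨c, rfl⟩
          · exact Or.inr ⟨x, hx, (l1 x hx).symm⟩
          · exact Or.inl (l2 c)
        · rintro (rfl | ⟨x, hx, rfl⟩)
          · exact ⟨.cup k false, by simp, l2 _⟩
          · refine ⟨x, ?_, l1 x hx⟩
            cases x with
            | dart d => simp
            | cup i c => simp at hx ⊢; omega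
      simp only [e, Finset.card_insert_of_notMem hN, List.length_cons]
      omega

/-- If the two points lie on the same arc, a circle arises and the classes remain; otherwise two
classes merge. In particular the number of circles never decreases, which the a priori bounds rely
on. -/
theorem PInv.cap {x y : StrandEnd n} {b : List (StrandEnd n)} {js k}
    (h : PInv s added ⟨x :: y :: b, js, k⟩ ℓ F) :
    ∃ ℓ' ≥ ℓ, PInv s added ⟨b, (x, y) :: js, k⟩ ℓ' (opCap F) := by
  obtain ⟨h1, h2, h3, h4, h5⟩ := h
  simp only at h1 h2 h3 h4 h5
  have hR := rel_equivalence s js k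
  have hx := h3 x (by simp)
  have hy := h3 y (by simp)
  have hF : ∀ a : List Bool, b.length = a.length → opCap F a =
      loopVal ^ ℓ * opCap (KauffmanGirth.val (Rel s js k) (x :: y :: b)) a := by
    intro a ha
    simp only [opCap]
    rw [h1 _ (by simp [ha]), h1 _ (by simp [ha])]
    ring
  have hj : ∀ p ∈ (x, y) :: js, Intro added k p.1 ∧ Intro added k p.2 := by
    intro p hp
    rcases List.mem_cons.1 hp with rfl | hp
    · exact ⟨hx, hy⟩
    · exact h4 p hp
  by_cases hxy : Rel s js k x y
  · obtain ⟨k1, k2⟩ := planar_cap_same hR h2 hxy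
    have e : mrg (Rel s js k) x y = Rel s js k := by
      ext z w
      constructor
      · rintro (h | ⟨h, h'⟩ | ⟨h, h'⟩)
        · exact h
        · exact hR.trans h (hR.trans hxy h')
        · exact hR.trans h (hR.trans (hR.symm hxy) h')
      · exact Or.inl
    refine ⟨ℓ + 1, by omega, ⟨fun a ha => ?_, ?_, fun z hz => h3 z (by simp [hz]), hj, ?_⟩⟩
    · simp only [rel_cap, e]
      rw [hF a ha, k2 a ha, pow_succ]
      ring
    · simp only [rel_cap, e]; exact k1
    · simp only [rel_cap, e]
      obtain ⟨lab, hl, hc⟩ := h5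
      refine ⟨lab, hl, ?_⟩
      simp only [List.length_cons] at hc
      omega
  · obtain ⟨k1, k2⟩ := planar_cap_diff hR h2 hxy
    refine ⟨ℓ, le_rfl, ⟨fun a ha => ?_, ?_, fun z hz => h3 z (by simp [hz]), hj, ?_⟩⟩
    · simp only [rel_cap]
      rw [hF a ha, k2 a ha]
    · simp only [rel_cap]; exact k1
    · simp only [rel_cap]
      obtain ⟨lab, hl, hc⟩ := h5
      classical
      have hxE := hx.mem_ends
      have hyE := hy.mem_ends
      have hne : lab x ≠ lab y := fun h => hxy ((hl x hxE y hyE).2 h)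
      let lab' : StrandEnd n → ℕ := fun z => if lab z = lab y then lab x else lab z
      refine ⟨lab', ?_, ?_⟩
      · intro z hz w hw
        simp only [mrg, hl z hz w hw, hl z hz x hxE, hl y hyE w hw, hl z hz y hyE, hl x hxE w hw,
          lab']
        split_ifs with h1 h2 h2
        · simp [h1, h2]
        · simp only [h1]
          constructor
          · rintro (h | ⟨h, h'⟩ | ⟨h, h'⟩)
            · exact absurd h.symm h2
            · exact absurd h.symm hne
            · exact h'
          · intro h; exact Or.inr (Or.inr ⟨trivial, h⟩)
        · simp only [h2]
          constructor
          · rintro (h | ⟨h, h'⟩ | ⟨h, h'⟩)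
            · exact absurd h h1
            · exact h
            · exact absurd h h1
          · intro h; exact Or.inr (Or.inl ⟨h, trivial⟩)
        · constructor
          · rintro (h | ⟨h, h'⟩ | ⟨h, h'⟩)
            · exact h
            · exact absurd h'.symm h2
            · exact absurd h h1
          · exact Or.inl
      · have e : (ends n k).image lab' = ((ends n k).image lab).erase (lab y) := by
          ext v
          simp only [Finset.mem_image, Finset.mem_erase, lab']
          constructor
          · rintro ⟨z, hz, rfl⟩
            split_ifs with h
            · exact ⟨hne, x, hxE, rfl⟩
            · exact ⟨h, z, hz, rfl⟩
          · rintro ⟨hv, z, hz, rfl⟩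
            exact ⟨z, hz, if_neg hv⟩
        have hy' : lab y ∈ (ends n k).image lab := Finset.mem_image.2 ⟨y, hyE, rfl⟩
        have := Finset.card_erase_add_one hy'
        simp only [e, List.length_cons] at hc ⊢
        omega

end smoothed

/-! ## The state vector of a smoothed diagram -/

section crossing

variable {n : ℕ} {s : Fin n → Bool} {added : List (Fin n)} {t t' : Tangle n} {ℓ : ℕ} {F : SpinFun}

theorem smoothing_even {b : Bool} {j : Fin 4} (h : b = even4 j) :
    smoothing b j = j + 1 ∧ smoothing b (j + 1) = j ∧ smoothing b (j + 2) = j + 3 ∧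
      smoothing b (j + 3) = j + 2 := by
  revert b j; decide

theorem smoothing_odd {b : Bool} {j : Fin 4} (h : b ≠ even4 j) :
    smoothing b j = j + 3 ∧ smoothing b (j + 1) = j + 2 ∧ smoothing b (j + 2) = j + 1 ∧
      smoothing b (j + 3) = j := by
  revert b j; decide

theorem fin4_ne (j : Fin 4) : j + 1 ≠ j ∧ j + 2 ≠ j ∧ j + 3 ≠ j ∧ j + 1 ≠ j + 2 ∧ j + 1 ≠ j + 3 ∧
    j + 2 ≠ j + 3 := by
  revert j; decide

/-- The relation stays the same. The half-edges of the new crossing are related only through its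
smoothing, which pairs them side by side or nested, depending on `s c` and on the parity of the
first half-edge. -/
theorem PInv.x {c : Fin n} {j : Fin 4} {b : List (StrandEnd n)} {js k}
    (h : PInv s added ⟨b, js, k⟩ ℓ F) (hc : c ∉ added) :
    PInv s (c :: added) ⟨[.dart (c, j), .dart (c, j + 1), .dart (c, j + 2), .dart (c, j + 3)] ++ b,
      js, k⟩ ℓ (opX (s c == even4 j) F) := by
  obtain ⟨h1, h2, h3, h4, h5⟩ := h
  simp only at h1 h2 h3 h4 h5
  have hR := rel_equivalence s js k
  have hd : ∀ i z, Rel s js k (.dart (c, i)) z → z = .dart (c, i) ∨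
      z = .dart (c, smoothing (s c) i) := fun i z hz =>
    (rel_of_not_intro h4 hz).2 hc
  have hd' : ∀ i, Rel s js k (.dart (c, i)) (.dart (c, smoothing (s c) i)) := fun i =>
    .rel _ _ (Or.inr (Or.inr rfl))
  have hb : ∀ i, ∀ z ∈ b, ¬ Rel s js k (.dart (c, i)) z := by
    intro i z hz hr
    have hzi := h3 z hz
    rcases hd i z hr with rfl | rfl <;> exact hc hzi
  have hsub : added ⊆ c :: added := fun x hx => List.mem_cons_of_mem _ hx
  obtain ⟨n1, n2, n3, n4, n5, n6⟩ := fin4_ne j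
  have key : Planar (Rel s js k) ([.dart (c, j), .dart (c, j + 1), .dart (c, j + 2),
      .dart (c, j + 3)] ++ b) ∧ ∀ p q u v (a : List Bool), b.length = a.length →
      KauffmanGirth.val (Rel s js k) ([.dart (c, j), .dart (c, j + 1), .dart (c, j + 2),
        .dart (c, j + 3)] ++ b) (p :: q :: u :: v :: a) =
      (if s c == even4 j then cupW p q * cupW u v else cupW q u * cupW p v) *
        KauffmanGirth.val (Rel s js k) b a := by
    by_cases hs : s c = even4 j
    · obtain ⟨e0, e1, e2, e3⟩ := smoothing_even hs
      have r0 := hd' j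
      have r2 := hd' (j + 2)
      rw [e0] at r0
      rw [e2] at r2
      have q0 : ∀ z ∈ StrandEnd.dart (c, j + 2) :: StrandEnd.dart (c, j + 3) :: b,
          ¬ Rel s js k (.dart (c, j)) z := by
        intro z hz h
        simp only [List.mem_cons] at hz
        have h' := hd _ _ h
        rw [e0] at h'
        rcases hz with rfl | rfl | hz
        · simp [n2, n4.symm] at h'
        · simp [n3, n5.symm] at h'
        · exact hb _ z hz h
      refine ⟨.arc _ [] _ _ r0 (by simp) q0 (by simp) .nil
        (.arc _ [] _ _ r2 (by simp) (hb _) (by simp) .nil h2), ?_⟩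
      intro p q u v a ha
      have v1 := val_arc (u := []) (v := .dart (c, j + 2) :: .dart (c, j + 3) :: b) (s := p)
        (t := q) (a := []) (b := u :: v :: a) hR rfl r0 (by simp) q0 (by simp)
      have v2 := val_arc (u := []) (v := b) (s := u)
        (t := v) (a := []) (b := a) hR rfl r2 (by simp) (hb _) (by simp)
      simp only [List.cons_append, List.nil_append] at v1 v2 ⊢
      rw [v1, v2]
      simp only [KauffmanGirth.val, hs, beq_self_eq_true, if_true]
      ring
    · obtain ⟨e0, e1, e2, e3⟩ := smoothing_odd hs
      have r0 := hd' j
      have r1 := hd' (j + 1)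
      rw [e0] at r0
      rw [e1] at r1
      have q0 : ∀ z ∈ [StrandEnd.dart (c, j + 1), StrandEnd.dart (c, j + 2)],
          ¬ Rel s js k (.dart (c, j)) z := by
        intro z hz h
        simp only [List.mem_cons, List.not_mem_nil, or_false] at hz
        have h' := hd _ _ h
        rw [e0] at h'
        rcases hz with rfl | rfl
        · simp [n1, n5] at h'
        · simp [n2, n6] at h'
      have q1 : ∀ z ∈ [StrandEnd.dart (c, j + 1), StrandEnd.dart (c, j + 2)], ∀ w ∈ b,
          ¬ Rel s js k z w := by
        intro z hz w hw
        simp only [List.mem_cons, List.not_mem_nil, or_false] at hz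
        rcases hz with rfl | rfl <;> exact hb _ w hw
      refine ⟨.arc _ [.dart (c, j + 1), .dart (c, j + 2)] _ _ r0 q0 (hb _) q1
        (.arc _ [] _ [] r1 (by simp) (by simp) (by simp) .nil .nil) h2, ?_⟩
      intro p q u v a ha
      have v1 := val_arc (u := [.dart (c, j + 1), .dart (c, j + 2)]) (v := b) (s := p)
        (t := v) (a := [q, u]) (b := a) hR rfl r0 q0 (hb _) q1
      have v2 := val_arc (u := []) (v := []) (s := q)
        (t := u) (a := []) (b := []) hR rfl r1 (by simp) (by simp) (by simp)
      simp only [List.cons_append, List.nil_append] at v1 v2 ⊢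
      rw [v1, v2]
      simp only [KauffmanGirth.val, hs, beq_iff_eq, if_false]
      ring
  refine ⟨fun a ha => ?_, key.1, ?_, ?_, ?_⟩
  · simp only at ha ⊢
    match a, ha with
    | p :: q :: u :: v :: a, ha =>
      have ha' : b.length = a.length := by simpa using ha
      rw [key.2 _ _ _ _ a ha', opX, h1 a ha']
      ring
  · intro z hz
    simp only [List.mem_append, List.mem_cons, List.not_mem_nil, or_false] at hz
    rcases hz with (rfl | rfl | rfl | rfl) | hz
    · exact List.mem_cons_self
    · exact List.mem_cons_self
    · exact List.mem_cons_self
    · exact List.mem_cons_self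
    · exact (h3 z hz).mono hsub le_rfl
  · intro p hp
    exact ⟨(h4 p hp).1.mono hsub le_rfl, (h4 p hp).2.mono hsub le_rfl⟩
  · obtain ⟨lab, hl, hcard⟩ := h5
    refine ⟨lab, hl, ?_⟩
    simp only [List.length_cons, List.length_append, List.length_nil] at hcard ⊢
    omega

end crossing

/-! ### Runs of elementary steps for a fixed smoothing -/

section run

variable {n : ℕ}

/-- The weights that select the smoothing `s`. -/
def pureW (s : Fin n → Bool) (c : Fin n) (b : Bool) : LP := if s c = b then 1 else 0

theorem op_pureW_x (s : Fin n → Bool) (c : Fin n) (j : Fin 4) (F : SpinFun) :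
    (Micro.x c j).op (pureW s) F = opX (s c == even4 j) F := by
  ext1 l
  simp only [Micro.op, pureW]
  cases s c <;> cases even4 j <;> simp

theorem MStep.pinv {s : Fin n → Bool} {added : List (Fin n)} {m : Micro n} {t t' : Tangle n} {ℓ : ℕ}
    {F : SpinFun} (hm : MStep m t t') (h : PInv s added t ℓ F)
    (hc : ∀ c ∈ m.crossing?, c ∉ added) :
    ∃ ℓ' ≥ ℓ, PInv s (m.crossing?.toList ++ added) t' ℓ' (m.op (pureW s) F) := by
  cases hm with
  | rot b js k hb => exact ⟨ℓ, le_rfl, h.rot hb⟩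
  | cup b js k => exact ⟨ℓ, le_rfl, h.cup⟩
  | cap x y b js k => exact h.cap
  | x c j b js k =>
    refine ⟨ℓ, le_rfl, ?_⟩
    rw [op_pureW_x]
    exact h.x (hc c rfl)

theorem MRun.pinv {G : ℕ} {s : Fin n → Bool} {ms : List (Micro n)} {t t' : Tangle n}
    (hm : MRun G ms t t') {added : List (Fin n)} {ℓ : ℕ}
    {F : SpinFun} (h : PInv s added t ℓ F) (hnd : (ms.filterMap Micro.crossing?).Nodup)
    (hc : ∀ c ∈ ms.filterMap Micro.crossing?, c ∉ added) :
    ∃ ℓ' ≥ ℓ, PInv s ((ms.filterMap Micro.crossing?).reverse ++ added) t' ℓ'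
      (runOp (pureW s) ms F) := by
  induction hm generalizing added ℓ F with
  | nil t => exact ⟨ℓ, le_rfl, h⟩
  | @cons m ms t t₁ t₂ hm _ _ ih =>
    rcases hx : m.crossing? with _ | c
    · obtain ⟨ℓ₁, h1, k1⟩ := hm.pinv h (by simp [hx])
      rw [List.filterMap_cons_none hx] at hnd hc ⊢
      rw [hx] at k1
      obtain ⟨ℓ₂, h2, k2⟩ := ih k1 hnd hc
      exact ⟨ℓ₂, h1.trans h2, k2⟩
    · rw [List.filterMap_cons_some hx] at hnd hc ⊢
      obtain ⟨ℓ₁, h1, k1⟩ := hm.pinv h (by simpa [hx] using hc c (by simp))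
      rw [hx] at k1
      obtain ⟨ℓ₂, h2, k2⟩ := ih k1 (List.nodup_cons.1 hnd).2 (by
        intro c' hc' h'
        simp only [Option.toList_some, List.cons_append, List.nil_append, List.mem_cons] at h'
        rcases h' with rfl | h'
        · exact (List.nodup_cons.1 hnd).1 hc'
        · exact hc c' (by simp [hc']) h')
      refine ⟨ℓ₂, h1.trans h2, ?_⟩
      simpa [runOp] using k2

/-- Number of the arc at a half-edge of a smoothed crossing. -/
def arcNo : Bool → Fin 4 → ℕ
  | true => ![0, 0, 1, 1]
  | false => ![0, 1, 1, 0]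

theorem arcNo_eq_iff (b : Bool) (i j : Fin 4) :
    arcNo b i = arcNo b j ↔ j = i ∨ j = smoothing b i := by
  revert b i j; decide

theorem arcNo_lt (b : Bool) (i : Fin 4) : arcNo b i < 2 := by revert b i; decide

theorem arcNo_surj (b : Bool) (v : ℕ) (hv : v < 2) : ∃ i, arcNo b i = v := by
  interval_cases v
  · exact ⟨0, by cases b <;> rfl⟩
  · exact ⟨2, by cases b <;> rfl⟩

theorem PInv.empty (s : Fin n → Bool) : PInv s [] (Tangle.empty n) 0 spinOne := by
  refine ⟨?_, .nil, by simp [Tangle.empty], by simp [Tangle.empty], ?_⟩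
  · intro a _
    simp [Tangle.empty, spinOne, KauffmanGirth.val]
  let lab : StrandEnd n → ℕ := fun x => match x with
    | .dart d => 2 * d.1 + arcNo (s d.1) d.2
    | .cup _ _ => 0
  have hends : ∀ x ∈ ends n 0, ∃ d, x = .dart d := by
    intro x hx
    cases x with
    | dart d => exact ⟨d, rfl⟩
    | cup i b => simp at hx
  refine ⟨lab, ?_, ?_⟩
  · intro x hx y hy
    obtain ⟨⟨c, i⟩, rfl⟩ := hends x hx
    obtain ⟨⟨c', i'⟩, rfl⟩ := hends y hy
    simp only [lab]
    constructor
    · intro h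
      rcases (rel_of_not_intro (added := []) (by simp [Tangle.empty]) h).2 (by simp [Intro])
        with h | h
      · simp only [StrandEnd.dart.injEq, Prod.mk.injEq] at h
        rw [h.1, h.2]
      · simp only [smEnd, StrandEnd.dart.injEq, Prod.mk.injEq] at h
        obtain ⟨rfl, rfl⟩ := h
        have := (arcNo_eq_iff (s c') i _).2 (Or.inr rfl)
        omega
    · intro h
      have h1 := arcNo_lt (s c) i
      have h2 := arcNo_lt (s c') i'
      obtain rfl : c = c' := Fin.ext (by omega)
      rcases (arcNo_eq_iff (s c) i i').1 (by omega) with rfl | rfl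
      · exact (rel_equivalence _ _ _).refl _
      · exact .rel _ _ (Or.inr (Or.inr rfl))
  -- Initially the classes are the two arcs at each of the `n` smoothed crossings.
  · have e : (ends n 0).image lab = Finset.range (2 * n) := by
      ext v
      simp only [Finset.mem_image, Finset.mem_range]
      constructor
      · rintro ⟨x, hx, rfl⟩
        obtain ⟨⟨c, i⟩, rfl⟩ := hends x hx
        have h1 := arcNo_lt (s c) i
        simp only [lab]
        omega
      · intro hv
        obtain ⟨i, hi⟩ := arcNo_surj (s ⟨v / 2, by omega⟩) (v % 2) (Nat.mod_lt _ (by omega))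
        refine ⟨.dart (⟨v / 2, by omega⟩, i), by simp, ?_⟩
        simp only [lab, hi]
        omega
    simp only [Tangle.empty] at e ⊢
    rw [e]
    simp
    ring

end run

section final

variable {n : ℕ} {L : LinkDiagram n} {s : Fin n → Bool} {t : Tangle n}

theorem Tangle.sameEdge_equivalence (t : Tangle n) : Equivalence t.SameEdge :=
  Relation.EqvGen.is_equivalence _

theorem SameEdge.rel {x y : StrandEnd n} (h : t.SameEdge x y) : Rel s t.joins t.cups x y := by
  have h' : Relation.EqvGen _ x y := h
  refine h'.mono ?_
  rintro a b (h | ⟨i, hi, h⟩)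
  · exact Or.inl h
  · exact Or.inr (Or.inl ⟨i, hi, h⟩)

/-- With no boundary and no missing crossing, the count in `PInv` makes ℓ the number of classes. By
`Presents` the joins connect half-edges exactly along the edges of L, and every crossingless arc
lies on such an edge; so the classes of ends correspond to the classes of half-edges that
`loopCount` counts. -/
theorem PInv.loopCount {ℓ : ℕ} {F : SpinFun} {added : List (Fin n)} (h : PInv s added t ℓ F)
    (hadd : added.length = n) (ht : t.Presents L) : ℓ = L.loopCount s := by
  obtain ⟨hb, hL, hcup⟩ := ht
  obtain ⟨lab, hl, hcard⟩ := h.count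
  rw [hb, hadd, List.length_nil] at hcard
  have hS := t.sameEdge_equivalence
  let r : Dart n → Dart n → Prop := fun d e => e = L.link d ∨ e = (d.1, smoothing (s d.1) d.2)
  have hlink : ∀ d e, t.SameEdge (.dart d) (.dart e) → Quot.mk r d = Quot.mk r e := by
    intro d e h
    rcases (hL d e).1 h with rfl | rfl
    · rfl
    · exact Quot.sound (Or.inl rfl)
  -- Sending an end to the class of any half-edge on its edge is well defined and constant along
  -- `Rel`.
  have key : ∀ x y, Rel s t.joins t.cups x y →
      ((∃ d, t.SameEdge x (.dart d)) ↔ ∃ d, t.SameEdge y (.dart d)) ∧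
      ∀ d e, t.SameEdge x (.dart d) → t.SameEdge y (.dart e) → Quot.mk r d = Quot.mk r e := by
    have hsame : ∀ x y, t.SameEdge x y →
        ((∃ d, t.SameEdge x (.dart d)) ↔ ∃ d, t.SameEdge y (.dart d)) ∧
        ∀ d e, t.SameEdge x (.dart d) → t.SameEdge y (.dart e) → Quot.mk r d = Quot.mk r e := by
      intro x y h
      refine ⟨⟨fun ⟨d, hd⟩ => ⟨d, hS.trans (hS.symm h) hd⟩, fun ⟨d, hd⟩ => ⟨d, hS.trans h hd⟩⟩, ?_⟩
      intro d e hd he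
      exact hlink d e (hS.trans (hS.symm hd) (hS.trans h he))
    intro x y h
    induction h with
    | rel x y h =>
      rcases h with h | ⟨i, hi, h⟩ | h
      · exact hsame x y (.rel _ _ (Or.inl h))
      · exact hsame x y (.rel _ _ (Or.inr ⟨i, hi, h⟩))
      · subst h
        cases x with
        | cup i b => exact hsame _ _ (hS.refl _)
        | dart d₀ =>
          refine ⟨iff_of_true ⟨_, hS.refl _⟩ ⟨_, hS.refl _⟩, ?_⟩
          intro d e hd he
          rw [← hlink _ _ hd, ← hlink _ _ he]
          exact Quot.sound (Or.inr rfl)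
    | refl x => exact hsame x x (hS.refl x)
    | symm x y _ ih => exact ⟨ih.1.symm, fun d e hd he => (ih.2 e d he hd).symm⟩
    | trans x y z _ _ ih ih' =>
      refine ⟨ih.1.trans ih'.1, fun d e hd he => ?_⟩
      obtain ⟨f, hf⟩ := ih.1.1 ⟨d, hd⟩
      exact (ih.2 d f hd hf).trans (ih'.2 f e hf he)
  have hlab : ∀ d e, lab (.dart d) = lab (.dart e) ↔ Quot.mk r d = Quot.mk r e := by
    intro d e
    rw [← hl _ (dart_mem_ends d) _ (dart_mem_ends e)]
    constructor
    · intro h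
      exact (key _ _ h).2 d e (hS.refl _) (hS.refl _)
    · intro h
      have h' := Quot.eqvGen_exact h
      have hR := rel_equivalence s t.joins t.cups
      clear h
      induction h' with
      | rel a b h =>
        rcases h with rfl | rfl
        · exact SameEdge.rel ((hL a _).2 (Or.inr rfl))
        · exact .rel _ _ (Or.inr (Or.inr rfl))
      | refl a => exact hR.refl _
      | symm a b _ ih => exact hR.symm ih
      | trans a b c _ _ ih ih' => exact hR.trans ih ih'
  have hmem : ∀ d, lab (.dart d) ∈ (ends n t.cups).image lab := fun d =>
    Finset.mem_image.2 ⟨_, dart_mem_ends d, rfl⟩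
  let f : Quot r → (ends n t.cups).image lab :=
    Quot.lift (fun d => ⟨lab (.dart d), hmem d⟩) fun d e h =>
      Subtype.ext ((hlab d e).2 (Quot.sound h))
  have hf : Function.Bijective f := by
    constructor
    · rintro ⟨d⟩ ⟨e⟩ h
      exact (hlab d e).1 (congrArg Subtype.val h)
    · rintro ⟨v, hv⟩
      obtain ⟨x, hx, rfl⟩ := Finset.mem_image.1 hv
      obtain ⟨d, hd⟩ : ∃ d, t.SameEdge x (.dart d) := by
        cases x with
        | dart d => exact ⟨d, hS.refl _⟩
        | cup i b =>
          rw [cup_mem_ends] at hx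
          obtain ⟨d, hd⟩ := hcup i hx
          cases b with
          | false => exact ⟨d, hd⟩
          | true => exact ⟨d, hS.trans (hS.symm (.rel _ _ (Or.inr ⟨i, hx, rfl, rfl⟩))) hd⟩
      refine ⟨Quot.mk r d, Subtype.ext ?_⟩
      exact ((hl x hx _ (dart_mem_ends d)).1 (SameEdge.rel hd)).symm
  have hc := Nat.card_congr (Equiv.ofBijective f hf)
  have : L.loopCount s = Nat.card (Quot r) := rfl
  rw [this, hc, Nat.card_eq_fintype_card, Fintype.card_coe]
  omega

theorem LinkDiagram.loopCount_le (L : LinkDiagram n) (s : Fin n → Bool) : L.loopCount s ≤ 4 * n := by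
  have h := Nat.card_le_card_of_surjective (Quot.mk fun d e : Dart n => e = L.link d ∨
    e = (d.1, smoothing (s d.1) d.2)) Quot.mk_surjective
  simpa [LinkDiagram.loopCount, Nat.card_prod, mul_comm] using h

end final

/-! ## Expansion over the smoothings -/

section expansion

variable {n : ℕ}

/-- The weights of the smoothings of a crossing in the bracket. -/
def braW (_ : Fin n) (b : Bool) : LP := T (if b then 1 else -1)

theorem opX_sum {ι : Type*} (b : Bool) (P : Finset ι) (a : ι → LP) (F : ι → SpinFun)
    (l : List Bool) :
    opX b (fun l => ∑ i ∈ P, a i * F i l) l = ∑ i ∈ P, a i * opX b (F i) l := by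
  match l with
  | [] | [_] | [_, _] | [_, _, _] => simp [opX]
  | s₀ :: s₁ :: s₂ :: s₃ :: l =>
    simp only [opX, Finset.mul_sum]
    exact Finset.sum_congr rfl fun i _ => by ring

theorem op_sum {ι : Type*} {w : Fin n → Bool → LP} {m : Micro n} (P : Finset ι)
    (a : ι → LP) (F : ι → SpinFun) :
    m.op w (fun l => ∑ i ∈ P, a i * F i l) = fun l => ∑ i ∈ P, a i * m.op w (F i) l := by
  ext1 l
  cases m with
  | rot =>
    simp only [Micro.op, opRot, Finset.mul_sum]
    exact Finset.sum_congr rfl fun i _ => by ring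
  | cup =>
    match l with
    | [] | [_] => simp [Micro.op, opCup]
    | s :: t :: l =>
      simp only [Micro.op, opCup, Finset.mul_sum]
      exact Finset.sum_congr rfl fun i _ => by ring
  | cap =>
    simp only [Micro.op, opCap, Finset.mul_sum, ← Finset.sum_add_distrib]
    exact Finset.sum_congr rfl fun i _ => by ring
  | x c j =>
    simp only [Micro.op, opX_sum, Finset.mul_sum, ← Finset.sum_add_distrib]
    exact Finset.sum_congr rfl fun i _ => by ring

theorem op_congr_of_crossing {w w' : Fin n → Bool → LP} {m : Micro n}
    (h : ∀ c ∈ m.crossing?, w c = w' c) : m.op w = m.op w' := by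
  cases m with
  | x c j =>
    have := h c rfl
    funext F l
    simp only [Micro.op, this]
  | _ => funext F l; simp only [Micro.op]

theorem runOp_congr {w w' : Fin n → Bool → LP} {ms : List (Micro n)} {F : SpinFun}
    (h : ∀ c ∈ ms.filterMap Micro.crossing?, w c = w' c) : runOp w ms F = runOp w' ms F := by
  induction ms generalizing F with
  | nil => simp only [runOp, List.foldl_nil]
  | cons m ms ih =>
    have h1 : m.op w = m.op w' := op_congr_of_crossing fun c hc => h c
      (List.mem_filterMap.2 ⟨m, by simp, hc⟩)
    have h2 : ∀ w : Fin n → Bool → LP, runOp w (m :: ms) F = runOp w ms (m.op w F) := fun w => by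
      simp only [runOp, List.foldl_cons]
    rw [h2, h2, h1]
    refine ih fun c hc => h c ?_
    obtain ⟨m', hm', e⟩ := List.mem_filterMap.1 hc
    exact List.mem_filterMap.2 ⟨m', by simp [hm'], e⟩

theorem runOp_append (w : Fin n → Bool → LP) (ms ms' : List (Micro n)) (F : SpinFun) :
    runOp w (ms ++ ms') F = runOp w ms' (runOp w ms F) := by
  simp [runOp]

theorem runOp_singleton (w : Fin n → Bool → LP) (m : Micro n) (F : SpinFun) :
    runOp w [m] F = m.op w F := rfl

/-- The weight of the smoothing in which exactly the crossings in `A` are `A`-smoothed. -/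
def smW (C A : Finset (Fin n)) : LP := ∏ c ∈ C, T (if c ∈ A then 1 else -1)

def smSet (A : Finset (Fin n)) (c : Fin n) : Bool := decide (c ∈ A)

/-- Every step is linear, and a crossing step is the weighted sum of its two smoothings. Removing
the last step, the subsets of the crossings are those without `c` and those with `c` inserted; the
earlier steps do not notice the choice at `c`, because no crossing occurs twice. -/
theorem runOp_braW (ms : List (Micro n)) (hnd : (ms.filterMap Micro.crossing?).Nodup) :
    runOp braW ms spinOne = fun l => ∑ A ∈ (ms.filterMap Micro.crossing?).toFinset.powerset,
      smW (ms.filterMap Micro.crossing?).toFinset A * runOp (pureW (smSet A)) ms spinOne l := by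
  induction ms using List.reverseRecOn with
  | nil => funext l; simp [runOp, smW]
  | append_singleton ms m ih =>
    rw [List.filterMap_append] at hnd ⊢
    have hnd' := (List.nodup_append.1 hnd).1
    rcases hx : m.crossing? with _ | c
    · have e0 : [m].filterMap Micro.crossing? = [] := by simp [hx]
      rw [e0, List.append_nil]
      rw [runOp_append, ih hnd', runOp_singleton, op_sum]
      funext l
      refine Finset.sum_congr rfl fun A _ => ?_
      rw [runOp_append, op_congr_of_crossing (w' := pureW (smSet A)) (by simp [hx]), runOp_singleton]
    · obtain ⟨j, rfl⟩ : ∃ j, m = .x c j := by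
        cases m with
        | x c' j => exact ⟨j, by simpa [Micro.crossing?] using hx⟩
        | _ => simp [Micro.crossing?] at hx
      have e0 : [Micro.x c j].filterMap Micro.crossing? = [c] := by simp [hx]
      rw [e0] at hnd ⊢
      have hc : c ∉ ms.filterMap Micro.crossing? := fun h =>
        (List.nodup_append.1 hnd).2.2 c h c (by simp) rfl
      have hc' : c ∉ (ms.filterMap Micro.crossing?).toFinset := by simpa using hc
      have e1 : (ms.filterMap Micro.crossing? ++ [c]).toFinset =
          insert c (ms.filterMap Micro.crossing?).toFinset := by
        ext x; simp
      rw [e1, runOp_append, ih hnd', runOp_singleton]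
      funext l
      rw [Finset.sum_powerset_insert hc']
      simp only [Micro.op, opX_sum, Finset.mul_sum]
      rw [add_comm]
      have hA : ∀ A ∈ (ms.filterMap Micro.crossing?).toFinset.powerset, c ∉ A := fun A hA h =>
        hc' (Finset.mem_powerset.1 hA h)
      refine congrArg₂ (· + ·) ?_ ?_
      · refine Finset.sum_congr rfl fun A hA' => ?_
        have h1 : smSet A c = false := by simp [smSet, hA A hA']
        rw [runOp_append, runOp_singleton, op_pureW_x, h1, smW, smW, Finset.prod_insert hc', if_neg (hA A hA')]
        cases even4 j <;> simp [braW, -LaurentPolynomial.T_mul] <;> ring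
      · refine Finset.sum_congr rfl fun A hA' => ?_
        have h1 : smSet (insert c A) c = true := by simp [smSet]
        have h2 : runOp (pureW (smSet (insert c A))) ms spinOne = runOp (pureW (smSet A)) ms spinOne := by
          refine runOp_congr fun c' hc'' => ?_
          have : c' ≠ c := by rintro rfl; exact hc hc''
          have e : smSet (insert c A) c' = smSet A c' := by simp [smSet, this]
          funext b
          unfold pureW
          rw [e]
        rw [runOp_append, runOp_singleton, op_pureW_x, h1, h2, smW, smW, Finset.prod_insert hc', if_pos (Finset.mem_insert_self _ _)]
        have h3 : ∏ x ∈ (ms.filterMap Micro.crossing?).toFinset, (T (if x ∈ insert c A then 1 else -1) : LP)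
            = ∏ x ∈ (ms.filterMap Micro.crossing?).toFinset, T (if x ∈ A then 1 else -1) := by
          refine Finset.prod_congr rfl fun x hx' => ?_
          have : x ≠ c := by rintro rfl; exact hc' hx'
          simp [this]
        rw [h3]
        cases even4 j <;> simp [braW, -LaurentPolynomial.T_mul] <;> ring

end expansion

/-! ## Bounds for exponents and coefficients -/

/-- Exponents are bounded by `d`, coefficients by `M`. -/
def Bdd (d : ℕ) (M : ℤ) (f : LP) : Prop :=
  0 ≤ M ∧ ∀ e : ℤ, |f.coeff e| ≤ M ∧ ((d : ℤ) < |e| → f.coeff e = 0)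

section bounds

variable {d d' : ℕ} {M M' : ℤ} {f g : LP}

theorem Bdd.mono (h : Bdd d M f) (hd : d ≤ d') (hM : M ≤ M') : Bdd d' M' f :=
  ⟨h.1.trans hM, fun e => ⟨(h.2 e).1.trans hM, fun he => (h.2 e).2 (by omega)⟩⟩

theorem Bdd.zero (d : ℕ) (hM : 0 ≤ M) : Bdd d M 0 :=
  ⟨hM, fun e => ⟨by simpa using hM, fun _ => rfl⟩⟩

theorem Bdd.one : Bdd 0 1 1 := by
  refine ⟨by norm_num, fun e => ?_⟩
  rw [← LaurentPolynomial.T_zero, LaurentPolynomial.T_apply]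
  constructor
  · split_ifs <;> simp
  · intro he
    rw [if_neg]
    rintro rfl
    simp at he

theorem Bdd.T_mul (h : Bdd d M f) (k : ℤ) : Bdd (d + k.natAbs) M (T k * f) := by
  refine ⟨h.1, fun e => ?_⟩
  rw [coeff_T_mul]
  refine ⟨(h.2 _).1, fun he => (h.2 _).2 ?_⟩
  rw [lt_abs] at he ⊢
  omega

theorem Bdd.neg (h : Bdd d M f) : Bdd d M (-f) := by
  refine ⟨h.1, fun e => ?_⟩
  have : (-f).coeff e = -(f.coeff e) := rfl
  rw [this, abs_neg]
  exact ⟨(h.2 e).1, fun he => by rw [(h.2 e).2 he, neg_zero]⟩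

theorem Bdd.add (hf : Bdd d M f) (hg : Bdd d M' g) : Bdd d (M + M') (f + g) := by
  refine ⟨add_nonneg hf.1 hg.1, fun e => ?_⟩
  rw [coeff_add']
  refine ⟨(abs_add_le _ _).trans (add_le_add (hf.2 e).1 (hg.2 e).1), fun he => ?_⟩
  rw [(hf.2 e).2 he, (hg.2 e).2 he, add_zero]

theorem Bdd.sum {ι : Type*} (P : Finset ι) (f : ι → LP) (h : ∀ i ∈ P, Bdd d M (f i)) :
    Bdd d (P.card * M) (∑ i ∈ P, f i) := by
  classical
  induction P using Finset.induction with
  | empty => exact (Bdd.zero d le_rfl).mono le_rfl (by simp)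
  | insert i P hi ih =>
    rw [Finset.sum_insert hi, Finset.card_insert_of_notMem hi]
    refine ((h i (by simp)).add (ih fun j hj => h j (by simp [hj]))).mono le_rfl ?_
    push_cast
    linarith

theorem Bdd.loopVal_mul (h : Bdd d M f) : Bdd (d + 2) (2 * M) (loopVal * f) := by
  have : loopVal * f = -(T 2 * f) + -(T (-2) * f) := by rw [loopVal]; ring
  rw [this, two_mul]
  exact (h.T_mul 2).neg.add (h.T_mul (-2)).neg

theorem Bdd.loopVal_pow_mul (h : Bdd d M f) (ℓ : ℕ) :
    Bdd (d + 2 * ℓ) (2 ^ ℓ * M) (loopVal ^ ℓ * f) := by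
  induction ℓ with
  | zero => simpa using h
  | succ ℓ ih =>
    have := ih.loopVal_mul
    rw [pow_succ' loopVal, mul_assoc]
    exact this.mono (by omega) (by rw [pow_succ' (2 : ℤ)]; linarith)

theorem Bdd.cupW_mul (h : Bdd d M f) (s t : Bool) : Bdd (d + 2) M (cupW s t * f) := by
  unfold cupW
  split_ifs
  · rw [zero_mul]; exact Bdd.zero _ h.1
  · rw [one_mul]; exact h.mono (by omega) le_rfl
  · rw [neg_mul]; exact (h.T_mul (-2)).neg

theorem Bdd.val_mul {α : Type*} {R : α → α → Prop} (hR : Equivalence R) {l : List α}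
    (hl : Planar R l) {a : List Bool} (ha : l.length = a.length) (h : Bdd d M f) :
    Bdd (d + l.length) M (val R l a * f) := by
  induction hl generalizing a d f with
  | nil => simpa [val] using h
  | arc x u y v hxy hu hv huv _ _ ihu ihv =>
    cases a with
    | nil => simp at ha
    | cons s a =>
      obtain ⟨b, t, c, rfl, hb, hc⟩ := exists_split_cons (u := u) (v := v) (x := y) (a := a)
        (by simpa using ha)
      have e := val_arc (s := s) (t := t) (a := b) (b := c) hR hb hxy hu hv huv
      simp only [List.cons_append] at e ⊢
      rw [e, mul_assoc, mul_assoc]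
      refine ((ihu hb (ihv hc h)).cupW_mul s t).mono ?_ le_rfl
      simp only [List.length_cons, List.length_append]
      omega

theorem Bdd.smW_mul {n : ℕ} (C A : Finset (Fin n)) (h : Bdd d M f) : Bdd (d + C.card) M (smW C A * f) := by
  classical
  unfold smW
  induction C using Finset.induction with
  | empty => simpa using h
  | insert c C hc ih =>
    rw [Finset.prod_insert hc, mul_assoc, Finset.card_insert_of_notMem hc]
    refine (ih.T_mul _).mono ?_ le_rfl
    split_ifs <;> simp

end bounds

/-! ## The state vectors along a cutting -/

section bracket

variable {n G : ℕ} {L : LinkDiagram n} {ms : List (Micro n)} {t t' : Tangle n}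

theorem mrun_append {ms' : List (Micro n)} {t'' : Tangle n} (h : MRun G ms t t')
    (h' : MRun G ms' t' t'') : MRun G (ms ++ ms') t t'' := by
  induction h with
  | nil t => exact h'
  | cons hm hl _ ih => exact .cons hm hl (ih h')

theorem filterMap_crossing_length {ms ms' : List (Micro n)}
    (hperm : ((ms ++ ms').filterMap Micro.crossing?).Perm (List.finRange n)) :
    (ms.filterMap Micro.crossing?).length ≤ n := by
  have := hperm.length_eq
  rw [List.filterMap_append, List.length_append, List.length_finRange] at this
  omega

/-- The remaining steps `ms'` matter: as the number of circles never decreases, it is at most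
`L.loopCount`, hence at most 4 n. For one smoothing the circles contribute exponents up to 8 n and
coefficients up to 2^(4 n), the smoothing weights exponents up to n, and the arcs a signed monomial
or zero; then at most 2^n smoothings are summed. -/
theorem bdd_runOp {ms' : List (Micro n)} (h : MRun G ms (Tangle.empty n) t) (h' : MRun G ms' t t')
    (hperm : ((ms ++ ms').filterMap Micro.crossing?).Perm (List.finRange n))
    (ht' : t'.Presents L) {a : List Bool} (ha : t.boundary.length = a.length) :
    Bdd (9 * n + t.boundary.length) (2 ^ (5 * n)) (runOp braW ms spinOne a) := by
  have hnd := hperm.nodup_iff.2 (List.nodup_finRange n)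
  have hlen := filterMap_crossing_length hperm
  rw [List.filterMap_append] at hnd
  obtain ⟨hnd1, hnd2, hdisj⟩ := List.nodup_append.1 hnd
  rw [runOp_braW ms hnd1]
  have hcard : (ms.filterMap Micro.crossing?).toFinset.card ≤ n :=
    (List.toFinset_card_le _).trans hlen
  refine (Bdd.sum (d := 9 * n + t.boundary.length) (M := 2 ^ (4 * n)) _ _ fun A _ => ?_).mono le_rfl ?_
  · obtain ⟨ℓ, -, k⟩ := h.pinv (PInv.empty (smSet A)) hnd1 (by simp)
    obtain ⟨ℓ', hℓ, k'⟩ := h'.pinv k hnd2 (by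
      intro c hc hc'
      rw [List.append_nil, List.mem_reverse] at hc'
      exact hdisj c hc' c hc rfl)
    have e := k'.loopCount (by
      have := hperm.length_eq
      rw [List.filterMap_append, List.length_append, List.length_finRange] at this
      simp; omega) ht'
    have hle := L.loopCount_le (smSet A)
    rw [k.val a ha]
    have b1 := (((Bdd.val_mul (rel_equivalence _ _ _) k.planar ha Bdd.one).loopVal_pow_mul ℓ).smW_mul
      (ms.filterMap Micro.crossing?).toFinset A)
    rw [mul_one, mul_one] at b1
    exact b1.mono (by omega) (pow_le_pow_right₀ (by norm_num) (by omega))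
  · rw [Finset.card_powerset]
    push_cast
    rw [← pow_add]
    exact pow_le_pow_right₀ (by norm_num) (by omega)

theorem runOp_bracket (h : MRun G ms (Tangle.empty n) t)
    (hperm : (ms.filterMap Micro.crossing?).Perm (List.finRange n)) (ht : t.Presents L) :
    runOp braW ms spinOne [] = L.bracket := by
  have hnd := hperm.nodup_iff.2 (List.nodup_finRange n)
  rw [runOp_braW ms hnd]
  have e : (ms.filterMap Micro.crossing?).toFinset = Finset.univ := by
    ext c
    simp [hperm.mem_iff]
  simp only [e, Finset.powerset_univ]
  have hA : ∀ A : Finset (Fin n), smW Finset.univ A * runOp (pureW (smSet A)) ms spinOne [] =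
      (∏ c, T (if smSet A c then 1 else -1)) * (-T 2 - T (-2)) ^ L.loopCount (smSet A) := by
    intro A
    obtain ⟨ℓ, -, k⟩ := h.pinv (PInv.empty (smSet A)) hnd (by simp)
    have e := k.loopCount (by simpa using hperm.length_eq) ht
    rw [k.val [] (by simp [ht.1]), ht.1, e]
    simp [smW, smSet, KauffmanGirth.val, loopVal]
  rw [Finset.sum_congr rfl fun A _ => hA A]
  unfold LinkDiagram.bracket
  refine Finset.sum_bij' (fun A _ => smSet A) (fun s _ => Finset.univ.filter fun c => s c = true)
    (by simp) (by simp) ?_ ?_ (fun A _ => rfl)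
  · intro A _; ext c; simp [smSet]
  · intro s _; funext c; simp [smSet]

end bracket

/-! ## Spin vectors as tables -/

/-- The binary digits, lowest first. -/
def bits : ℕ → ℕ → List Bool
  | 0, _ => []
  | m + 1, x => decide (x % 2 = 1) :: bits m (x / 2)

theorem length_bits (m x : ℕ) : (bits m x).length = m := by
  induction m generalizing x with
  | zero => rfl
  | succ m ih => simp [bits, ih]

theorem bits_two_mul (m x : ℕ) (b : Bool) : bits (m + 1) (2 * x + b.toNat) = b :: bits m x := by
  have h1 : (2 * x + b.toNat) / 2 = x := by cases b <;> simp; omega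
  have h2 : decide ((2 * x + b.toNat) % 2 = 1) = b := by cases b <;> simp
  rw [bits, h1, h2]

/-- The first spin is the lowest digit and the last spin the highest one. Together with
`bits_two_mul` this says that moving the cut point takes the entry 2 x + b to the entry x + b * 2^m.
-/
theorem bits_append (m x : ℕ) (hx : x < 2 ^ m) (b : Bool) :
    bits (m + 1) (x + b.toNat * 2 ^ m) = bits m x ++ [b] := by
  induction m generalizing x with
  | zero =>
    obtain rfl : x = 0 := by simpa using hx
    cases b <;> simp [bits]
  | succ m ih =>
    have h1 : (x + b.toNat * 2 ^ (m + 1)) / 2 = x / 2 + b.toNat * 2 ^ m := by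
      rw [pow_succ, ← mul_assoc]; omega
    have h2 : (x + b.toNat * 2 ^ (m + 1)) % 2 = x % 2 := by
      rw [pow_succ, ← mul_assoc]; omega
    rw [bits, h1, h2, ih _ (by rw [pow_succ] at hx; omega), show bits (m + 1) x = decide (x % 2 = 1) :: bits m (x / 2) from rfl, List.cons_append]

/-- The values of `F` on the lists of length `m`, indexed by binary numbers. -/
def vec (m : ℕ) (F : SpinFun) (x : ℕ) : LP := if x < 2 ^ m then F (bits m x) else 0

theorem vec_of_le {m x : ℕ} (F : SpinFun) (h : 2 ^ m ≤ x) : vec m F x = 0 := if_neg (by omega)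

theorem vec_of_lt {m x : ℕ} (F : SpinFun) (h : x < 2 ^ m) : vec m F x = F (bits m x) := if_pos h

theorem Term.val_low {t : Term} {R r k : ℕ} (hi : t.hi = false) (hd : t.d < t.c) (hk : k < t.c)
    (hr : r < R) (f : ℕ → LP) : t.val R f (t.c * r + k) =
      if k = t.d then LaurentPolynomial.C (sign t.neg) * (T t.sh * f (t.a * r + t.b)) else 0 := by
  have ho : t.off R = t.d := by simp [Term.off, hi]
  split_ifs with h
  · subst h
    have := Term.val_eq (R := R) (t := t) (by omega) hr f
    rwa [ho] at this
  · refine Term.val_eq_zero (fun r' _ he => h ?_) f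
    rw [ho] at he
    have h1 := congrArg (· % t.c) he
    simpa [Nat.mul_add_mod, Nat.mod_eq_of_lt hk, Nat.mod_eq_of_lt hd] using h1

theorem Term.val_high {t : Term} {R x m : ℕ} (hx : t.c * 2 ^ m ≤ x) (hd : t.off R < t.c)
    (hR : R ≤ 2 ^ m) (f : ℕ → LP) : t.val R f x = 0 := by
  refine Term.val_eq_zero (fun r hr he => ?_) f
  have : t.c * (r + 1) ≤ t.c * 2 ^ m := Nat.mul_le_mul_left _ (by omega)
  rw [Nat.mul_succ] at this
  omega

/-- The first term moves a spin `true` from the lowest digit to the highest one, which is what the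
flag `hi` is for; the second one does the same for `false`. -/
def rotTerms : List Term := [⟨2, 1, 1, 0, true, -2, true⟩, ⟨2, 0, 1, 0, false, 2, true⟩]

/-- In base 4 the digits 1 and 2 are the spin pairs (true, false) and (false, true), the only ones
with nonzero weight. -/
def cupTerms : List Term := [⟨1, 0, 4, 1, false, 0, false⟩, ⟨1, 0, 4, 2, false, -2, true⟩]

def capTerms : List Term := [⟨4, 1, 1, 0, false, 2, true⟩, ⟨4, 2, 1, 0, false, 0, false⟩]

/-- `e` is the exponent of the coefficient of the pairing of neighbours. -/
def xTerms (e : ℤ) : List Term :=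
  -- In base 16 the digits 5, 9, 6, 10 are the spin patterns of two arcs side by side, and 3, 10, 5,
  -- 12 those of two nested arcs.
  [⟨1, 0, 16, 5, false, e, false⟩, ⟨1, 0, 16, 9, false, e - 2, true⟩,
    ⟨1, 0, 16, 6, false, e - 2, true⟩, ⟨1, 0, 16, 10, false, e - 4, false⟩,
    ⟨1, 0, 16, 3, false, -e, false⟩, ⟨1, 0, 16, 10, false, -e - 2, true⟩,
    ⟨1, 0, 16, 5, false, -e - 2, true⟩, ⟨1, 0, 16, 12, false, -e - 4, false⟩]

theorem C_sign (b : Bool) (f : LP) : LaurentPolynomial.C (sign b) * f = if b then -f else f := by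
  cases b <;> simp [sign]

theorem termsVal_cons (R : ℕ) (t : Term) (ts : List Term) (f : ℕ → LP) (x : ℕ) :
    termsVal R (t :: ts) f x = t.val R f x + termsVal R ts f x := by
  simp [termsVal]

theorem termsVal_nil (R : ℕ) (f : ℕ → LP) (x : ℕ) : termsVal R [] f x = 0 := rfl

theorem exists_digit {c m x : ℕ} (hx : x < c * 2 ^ m) : ∃ r k, r < 2 ^ m ∧ k < c ∧ x = c * r + k := by
  have hc : 0 < c := Nat.pos_of_ne_zero fun h => by simp [h] at hx
  exact ⟨x / c, x % c, Nat.div_lt_of_lt_mul hx, Nat.mod_lt _ hc, (Nat.div_add_mod x c).symm⟩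

theorem bits_cup {m r k : ℕ} (hk : k < 4) : bits (m + 2) (4 * r + k) =
    decide (k % 2 = 1) :: decide (k / 2 = 1) :: bits m r := by
  rw [bits, bits]
  have h1 : (4 * r + k) / 2 / 2 = r := by omega
  have h2 : (4 * r + k) % 2 = k % 2 := by omega
  have h3 : (4 * r + k) / 2 % 2 = k / 2 := by omega
  rw [h1, h2, h3]

theorem vec_cup (m : ℕ) (F : SpinFun) : termsVal (2 ^ m) cupTerms (vec m F) = vec (m + 2) (opCup F) := by
  funext x
  have h4 : (2 : ℕ) ^ (m + 2) = 4 * 2 ^ m := by rw [pow_add]; ring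
  by_cases hx : x < 4 * 2 ^ m
  · obtain ⟨r, k, hr, hk, rfl⟩ := exists_digit hx
    rw [vec_of_lt _ (by rwa [h4]), bits_cup hk]
    simp only [cupTerms, termsVal_cons, termsVal_nil]
    rw [Term.val_low (t := ⟨1, 0, 4, 1, false, 0, false⟩) rfl (by decide) hk hr,
      Term.val_low (t := ⟨1, 0, 4, 2, false, -2, true⟩) rfl (by decide) hk hr]
    simp only [C_sign, one_mul, add_zero, vec_of_lt F hr]
    interval_cases k <;> simp [opCup, cupW, -LaurentPolynomial.T_mul]
  · rw [vec_of_le _ (by omega)]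
    simp only [cupTerms, termsVal_cons, termsVal_nil]
    rw [Term.val_high (t := ⟨1, 0, 4, 1, false, 0, false⟩) (m := m) (by simp; omega) (by simp [Term.off]) le_rfl,
      Term.val_high (t := ⟨1, 0, 4, 2, false, -2, true⟩) (m := m) (by simp; omega) (by simp [Term.off]) le_rfl]
    simp

theorem vec_cap (m : ℕ) (F : SpinFun) : termsVal (2 ^ m) capTerms (vec (m + 2) F) = vec m (opCap F) := by
  funext x
  have h4 : (2 : ℕ) ^ (m + 2) = 4 * 2 ^ m := by rw [pow_add]; ring
  simp only [capTerms, termsVal_cons, termsVal_nil]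
  by_cases hx : x < 2 ^ m
  · have e1 := Term.val_low (t := ⟨4, 1, 1, 0, false, 2, true⟩) (k := 0) rfl (by decide) (by decide) hx (vec (m + 2) F)
    have e2 := Term.val_low (t := ⟨4, 2, 1, 0, false, 0, false⟩) (k := 0) rfl (by decide) (by decide) hx (vec (m + 2) F)
    simp only [one_mul, add_zero, if_true] at e1 e2
    rw [e1, e2, C_sign, C_sign, vec_of_lt _ hx, vec_of_lt _ (by omega), vec_of_lt _ (by omega),
      bits_cup (by decide), bits_cup (by decide)]
    simp [opCap, capW, -LaurentPolynomial.T_mul]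
  · rw [vec_of_le _ (by omega)]
    rw [Term.val_high (t := ⟨4, 1, 1, 0, false, 2, true⟩) (m := m) (by simp; omega) (by simp [Term.off]) le_rfl,
      Term.val_high (t := ⟨4, 2, 1, 0, false, 0, false⟩) (m := m) (by simp; omega) (by simp [Term.off]) le_rfl]
    simp

theorem vec_rot (m : ℕ) (F : SpinFun) :
    termsVal (2 ^ m) rotTerms (vec (m + 1) F) = vec (m + 1) (opRot F) := by
  funext x
  have h2 : (2 : ℕ) ^ (m + 1) = 2 * 2 ^ m := by rw [pow_succ]; ring
  simp only [rotTerms, termsVal_cons, termsVal_nil, add_zero]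
  have z1 : ∀ x, (∀ r < 2 ^ m, x ≠ 1 * r + (0 + 2 ^ m)) →
      Term.val ⟨2, 1, 1, 0, true, -2, true⟩ (2 ^ m) (vec (m + 1) F) x = 0 := fun x hx =>
    Term.val_eq_zero hx _
  have z2 : ∀ x, (∀ r < 2 ^ m, x ≠ 1 * r + 0) →
      Term.val ⟨2, 0, 1, 0, false, 2, true⟩ (2 ^ m) (vec (m + 1) F) x = 0 := fun x hx =>
    Term.val_eq_zero hx _
  have v1 : ∀ r < 2 ^ m, Term.val ⟨2, 1, 1, 0, true, -2, true⟩ (2 ^ m) (vec (m + 1) F)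
      (1 * r + (0 + 2 ^ m)) = _ := fun r hr => Term.val_eq (by simp) hr _
  have v2 : ∀ r < 2 ^ m, Term.val ⟨2, 0, 1, 0, false, 2, true⟩ (2 ^ m) (vec (m + 1) F)
      (1 * r + 0) = _ := fun r hr => Term.val_eq (by simp) hr _
  simp only [one_mul, zero_add, add_zero] at z1 z2 v1 v2
  by_cases h1 : x < 2 ^ m
  · have b1 := bits_append m x h1 false
    have b2 := bits_two_mul m x false
    simp only [Bool.toNat_false, zero_mul, add_zero] at b1 b2
    rw [z1 x (fun r hr => by omega), v2 x h1, C_sign, vec_of_lt _ (by omega), vec_of_lt _ (by omega), b1, b2,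
      opRot_append]
    simp [rotW, -LaurentPolynomial.T_mul]
  · by_cases h3 : x < 2 ^ (m + 1)
    · obtain ⟨r, rfl⟩ := Nat.exists_eq_add_of_le' (not_lt.1 h1)
      have hr : r < 2 ^ m := by omega
      have b1 := bits_append m r hr true
      have b2 := bits_two_mul m r true
      simp only [Bool.toNat_true, one_mul] at b1 b2
      rw [z2 _ (fun r hr => by omega), v1 r hr, C_sign, vec_of_lt _ (by omega), vec_of_lt _ (by omega), b1, b2,
        opRot_append]
      simp [rotW, -LaurentPolynomial.T_mul]
    · rw [z1 x (fun r hr => by omega), z2 x (fun r hr => by omega), vec_of_le _ (by omega), add_zero]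

theorem bits_x {m r k : ℕ} (hk : k < 16) : bits (m + 4) (16 * r + k) =
    decide (k % 2 = 1) :: decide (k / 2 % 2 = 1) :: decide (k / 4 % 2 = 1) ::
      decide (k / 8 = 1) :: bits m r := by
  rw [bits, bits, bits, bits]
  have h1 : (16 * r + k) / 2 / 2 / 2 / 2 = r := by omega
  have h2 : (16 * r + k) % 2 = k % 2 := by omega
  have h3 : (16 * r + k) / 2 % 2 = k / 2 % 2 := by omega
  have h4 : (16 * r + k) / 2 / 2 % 2 = k / 4 % 2 := by omega
  have h5 : (16 * r + k) / 2 / 2 / 2 % 2 = k / 8 := by omega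
  rw [h1, h2, h3, h4, h5]

theorem T_sub_mul (a b : ℤ) : (T (a - b) : LP) = T a * T (-b) := LaurentPolynomial.T_sub a b

theorem vec_x (m : ℕ) (F : SpinFun) (e : ℤ) : termsVal (2 ^ m) (xTerms e) (vec m F) =
    vec (m + 4) fun l => T e * opX true F l + T (-e) * opX false F l := by
  funext x
  have h4 : (2 : ℕ) ^ (m + 4) = 16 * 2 ^ m := by rw [pow_add]; ring
  simp only [xTerms, termsVal_cons, termsVal_nil, add_zero]
  have hT : (T (-4) : LP) = T (-2) * T (-2) := by rw [← LaurentPolynomial.T_add]; rfl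
  by_cases hx : x < 16 * 2 ^ m
  · obtain ⟨r, k, hr, hk, rfl⟩ := exists_digit hx
    rw [vec_of_lt _ (by rwa [h4]), bits_x hk]
    have e1 : ∀ (d : ℕ) (sh : ℤ) (b : Bool), d < 16 → Term.val ⟨1, 0, 16, d, false, sh, b⟩ (2 ^ m)
        (vec m F) (16 * r + k) = if k = d then (if b then -(T sh * F (bits m r))
          else T sh * F (bits m r)) else 0 := by
      intro d sh b hd
      have := Term.val_low (t := ⟨1, 0, 16, d, false, sh, b⟩) rfl hd hk hr (vec m F)
      simpa only [C_sign, one_mul, add_zero, vec_of_lt F hr] using this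
    rw [e1 _ _ _ (by decide), e1 _ _ _ (by decide), e1 _ _ _ (by decide), e1 _ _ _ (by decide),
      e1 _ _ _ (by decide), e1 _ _ _ (by decide), e1 _ _ _ (by decide), e1 _ _ _ (by decide)]
    clear e1 hx
    simp only [T_sub_mul, hT]
    interval_cases k <;> simp [opX, cupW, -LaurentPolynomial.T_mul] <;> ring
  · rw [vec_of_le _ (by omega)]
    have e1 : ∀ (d : ℕ) (sh : ℤ) (b : Bool), d < 16 → Term.val ⟨1, 0, 16, d, false, sh, b⟩ (2 ^ m)
        (vec m F) x = 0 := fun d sh b hd =>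
      Term.val_high (m := m) (by simp; omega) (by simp [Term.off]; omega) le_rfl _
    rw [e1 _ _ _ (by decide), e1 _ _ _ (by decide), e1 _ _ _ (by decide), e1 _ _ _ (by decide),
      e1 _ _ _ (by decide), e1 _ _ _ (by decide), e1 _ _ _ (by decide), e1 _ _ _ (by decide)]
    simp

/-! ## Control structures -/

/-- The loop clears its own test register, so it runs at most once. -/
def Cmd.ifPos (a : ℕ) (c : Cmd) : Cmd := .loop a (c.seq (.block [.const a 0]))

def Cmd.repeat (a : ℕ) (c : Cmd) : Cmd := .loop a (c.seq (.block [.sub a a 3]))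

section control

variable {S : ℕ} {B : ℤ} {s : Store} {Q : Store → Prop} {t a m : ℕ} {c : Cmd}

theorem Tri.ifPos (hB : 1 ≤ B)
    (h1 : 0 < s.reg a → Tri S B c (s.set 29 1) t fun s' => Q (s'.set a 0))
    (h0 : s.reg a ≤ 0 → Q (s.set 29 1)) (ha : a ≠ 29) : Tri S B (.ifPos a c) s (t + 5) Q := by
  have hr : (s.set 29 1).reg a = s.reg a := by simp [ha]
  by_cases h : 0 < s.reg a
  · refine Tri.le (Tri.loop (m := 1) (t := t + 1) hB (fun j s' => if j = 0 then s'.reg a ≤ 0 ∧ Q s' else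
      s' = s.set 29 1) (by simp) ?_ ?_) (by omega)
    · intro j s' hj hI
      obtain rfl : j = 0 := by omega
      simp only [zero_add, one_ne_zero, if_false, if_true] at hI ⊢
      subst hI
      refine ⟨by rwa [hr], Tri.seq (t' := 1) (Tri.imp (h1 h) ?_)⟩
      intro s' _ hs'
      exact Tri.const (by simp; omega) (Tri.nil ⟨by simp, hs'⟩)
    · intro s' hs'
      simpa using hs'
  · refine Tri.le (Tri.loop (m := 0) (t := t + 1) hB (fun _ s' => s' = s.set 29 1) rfl ?_ ?_) (by omega)
    · intro j s' hj; omega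
    · rintro s' rfl
      exact ⟨by rw [hr]; omega, h0 (by omega)⟩

theorem Tri.repeat (hB : 1 ≤ B) (hm : (m : ℤ) ≤ B) (I : ℕ → Store → Prop)
    (hreg : ∀ j s', I j s' → s'.reg a = j) (h0 : I m (s.set 29 1))
    (hstep : ∀ j s', j < m → I (j + 1) s' → Tri S B c s' t fun s'' =>
      s''.reg a = (j + 1 : ℕ) ∧ s''.reg 3 = 1 ∧ I j (s''.set a j))
    (hend : ∀ s', I 0 s' → Q s') : Tri S B (.repeat a c) s (m * (t + 2) + 3) Q := by
  refine Tri.loop (t := t + 1) hB I h0 ?_ fun s' hs' => ⟨by rw [hreg 0 s' hs']; simp, hend s' hs'⟩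
  intro j s' hj hI
  refine ⟨by rw [hreg _ _ hI]; omega, Tri.seq (t' := 1) (Tri.imp (hstep j s' hj hI) ?_)⟩
  rintro s1 - ⟨h1, h2, h3⟩
  refine Tri.sub h1 h2 (by rw [abs_le]; constructor <;> omega) (Tri.nil ?_)
  simpa using h3

end control

/-! ## Moves as sequences of elementary steps -/

def Micro.cmd {n : ℕ} : Micro n → Cmd
  | .rot => opCmd 1 1 rotTerms
  | .cup => opCmd 0 2 cupTerms
  | .cap => opCmd 2 0 capTerms
  | .x _ j => opCmd 0 4 (xTerms (if even4 j then 1 else -1))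

/-- `Tangle.close` rotates the boundary and does not rotate it back, so a join is exactly `q`
rotations and one cap at the cut point. -/
def capMicros {n : ℕ} (q : ℕ) : List (Micro n) := List.replicate q .rot ++ [.cap]

def Move.micros {n : ℕ} : Move n → List (Micro n)
  | .cup p => List.replicate p .rot ++ [.cup]
  | .cap q => capMicros q
  | .crossing c j p qs => List.replicate p .rot ++ [.x c j] ++ qs.flatMap capMicros

section micros

variable {n G : ℕ} {T T' : Tangle n}

theorem mrun_rot (p : ℕ) (b : List (StrandEnd n)) (js k) (hp : p = 0 ∨ b ≠ []) (hG : b.length ≤ G) :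
    MRun G (List.replicate p .rot) ⟨b, js, k⟩ ⟨b.rotate p, js, k⟩ := by
  induction p generalizing b with
  | zero => simpa using .nil _
  | succ p ih =>
    have hb : b ≠ [] := by simpa using hp
    have := ih (b.rotate 1) (Or.inr (by simpa [List.rotate_eq_nil_iff] using hb)) (by simpa)
    rw [List.rotate_rotate, add_comm 1 p] at this
    exact .cons (.rot b js k hb) (by simpa) this

theorem mrun_close {ok : StrandEnd n → StrandEnd n → Bool} {q : ℕ} (h : T.close ok q = some T')
    (hG : T.boundary.length ≤ G) : MRun G (capMicros q) T T' ∧ q ≤ G ∧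
      T.boundary.length = T'.boundary.length + 2 := by
  unfold Tangle.close at h
  split_ifs at h with hq
  split at h
  · rename_i x y rest e
    split_ifs at h with hok
    simp only [Option.some.injEq] at h
    subst h
    have hl := congrArg List.length e
    simp only [List.length_rotate, List.length_cons] at hl
    refine ⟨mrun_append (mrun_rot q T.boundary T.joins T.cups (Or.inr ?_) hG) ?_, by omega, by simp; omega⟩
    · rintro h0; rw [h0] at hq; simp at hq
    · rw [e]; exact .cons (.cap _ _ _ _ _) (by simp; omega) (.nil _)
  · simp at h

theorem mrun_closes {ok : StrandEnd n → StrandEnd n → Bool} {qs : List ℕ}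
    (h : qs.foldlM (Tangle.close ok) T = some T') (hG : T.boundary.length ≤ G) :
    MRun G (qs.flatMap capMicros) T T' ∧ ∀ q ∈ qs, q ≤ G := by
  induction qs generalizing T with
  | nil =>
    simp only [List.foldlM_nil, Option.pure_def, Option.some.injEq] at h
    subst h
    exact ⟨.nil _, by simp⟩
  | cons q qs ih =>
    rw [List.foldlM_cons, Option.bind_eq_bind, Option.bind_eq_some_iff] at h
    obtain ⟨T1, h1, h2⟩ := h
    obtain ⟨k1, k2, k3⟩ := mrun_close h1 hG
    obtain ⟨l1, l2⟩ := ih h2 (by omega)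
    exact ⟨mrun_append k1 l1, by simpa [k2] using l2⟩

/-- The numbers that occur in the move are bounded by `G`. -/
def Move.Small (G : ℕ) : Move n → Prop
  | .cup p => p ≤ G
  | .cap q => q ≤ G
  | .crossing _ _ p qs => p ≤ G ∧ ∀ q ∈ qs, q ≤ G

/-- A crossing step exposes all four half-edges before it joins any, so up to four points more than
before the step can occur. -/
theorem mrun_move {mv : Move n} (h : mv.apply T = some T') (hG : T.boundary.length + 4 ≤ G) :
    MRun G mv.micros T T' ∧ mv.Small G := by
  cases mv with
  | cup p =>
    simp only [Move.apply] at h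
    split_ifs at h with hp
    simp only [Option.some.injEq] at h
    subst h
    refine ⟨mrun_append (mrun_rot p T.boundary T.joins T.cups ?_ (by omega)) (.cons (.cup _ _ _) ?_ (.nil _)), ?_⟩
    · by_cases h : T.boundary = []
      · rw [h] at hp; left; simpa using hp
      · exact Or.inr h
    · simp; omega
    · simp only [Move.Small]; omega
  | cap q =>
    obtain ⟨h1, h2, -⟩ := mrun_close h (by omega : T.boundary.length ≤ G)
    exact ⟨h1, h2⟩
  | crossing c j p qs =>
    simp only [Move.apply] at h
    split_ifs at h with hp
    obtain ⟨h1, h2⟩ := mrun_closes h (G := G) (by simp; omega)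
    refine ⟨mrun_append (mrun_append (mrun_rot p T.boundary T.joins T.cups ?_ (by omega))
      (.cons (.x c j _ _ _) ?_ (.nil _))) h1, by omega, h2⟩
    · by_cases h : T.boundary = []
      · rw [h] at hp; left; simpa using hp
      · exact Or.inr h
    · simp; omega

theorem filterMap_replicate_rot (p : ℕ) :
    (List.replicate p Micro.rot : List (Micro n)).filterMap Micro.crossing? = [] := by
  rw [List.filterMap_eq_nil_iff]
  intro m hm
  rw [List.eq_of_mem_replicate hm]; rfl

theorem filterMap_capMicros (q : ℕ) : (capMicros q : List (Micro n)).filterMap Micro.crossing? = [] := by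
  rw [capMicros, List.filterMap_append, filterMap_replicate_rot]; rfl

theorem filterMap_micros (mv : Move n) :
    mv.micros.filterMap Micro.crossing? = [mv].filterMap Move.crossing? := by
  cases mv with
  | cup p => rw [Move.micros, List.filterMap_append, filterMap_replicate_rot]; rfl
  | cap q => rw [Move.micros, filterMap_capMicros]; rfl
  | crossing c j p qs =>
    rw [Move.micros, List.filterMap_append, List.filterMap_append, filterMap_replicate_rot,
      List.filterMap_flatMap]
    simp [filterMap_capMicros, Micro.crossing?, Move.crossing?]

end micros

/-! ## The state of the computation -/

/-- Bounds for the computation: there are at most `G` boundary points, the table is stored at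
address `E`, the input is `inp`, cells below `S` and integers up to `B` are available. -/
structure Params (n G E S : ℕ) (B M : ℤ) (inp : ℕ → ℤ) : Prop where
  pos : 1 ≤ n
  -- Rows are laid out with h = 32 n; by `bdd_runOp` this condition keeps all exponents of the
  -- states in [-h, h).
  girth : 9 * n + G < 32 * n
  space : E + 4 * (32 * n) + 32 * n + 32 * (2 ^ G + 1) * (8 * (32 * n)) + 2 * (32 * n) + 8 ≤ S
  le : (S : ℤ) ≤ B
  coeffs : 2 ^ (5 * n) ≤ M
  -- An operation has at most eight terms, each of which may double the integers, and the clearing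
  -- of the old table allows for one more doubling.
  values : 2 * (2 ^ 8 * M) ≤ B
  input : ∀ x < E, |inp x| ≤ M

/-- The steps `ms` have been carried out, and the steps `ms'` remain. -/
structure RunState {n : ℕ} (L : LinkDiagram n) (G E : ℕ) (inp : ℕ → ℤ) (ms ms' : List (Micro n))
    (s : Store) : Prop where
  perm : ((ms ++ ms').filterMap Micro.crossing?).Perm (List.finRange n)
  run : ∃ T T', MRun G ms (Tangle.empty n) T ∧ MRun G ms' T T' ∧ T'.Presents L ∧
    T.boundary.length ≤ G ∧ ∃ b, TabState E (32 * n) b T.boundary.length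
      (vec T.boundary.length (runOp braW ms spinOne)) s
  inp : ∀ x < E, s.mem x = inp x

/-- The registers that are changed by the operations on tables. -/
abbrev opRegs : List ℕ := [4, 5, 8, 9, 10, 11, 12, 13, 14, 15, 16, 17, 18, 19, 20, 21, 29]

/-- A bound for the time that an elementary step takes. -/
def stepTime (n G : ℕ) : ℕ := 25 * (2 ^ G * (16 * (32 * n) + 10) + 80) + 4 * G

section state

variable {n G E S : ℕ} {B M : ℤ} {inp : ℕ → ℤ} {L : LinkDiagram n} {ms ms' : List (Micro n)}
  {m : Micro n} {s : Store}

theorem RunState.consts (h : RunState L G E inp ms ms' s) : Consts (32 * n) s := by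
  obtain ⟨-, ⟨T, T', -, -, -, -, b, h⟩, -⟩ := h
  exact h.consts

theorem TabState.set {E h m i : ℕ} {b : Bool} {f : ℕ → LP} (hs : TabState E h b m f s) (z : ℤ)
    (hi : i ∉ [3, 4, 5, 6, 7, 8, 30]) : TabState E h b m f (s.set i z) := by
  obtain ⟨h1, h2, h3, h4, h5, h6, h7⟩ := hs
  simp only [List.mem_cons, List.not_mem_nil, or_false, not_or] at hi
  obtain ⟨i3, i4, i5, i6, i7, i8, i30⟩ := hi
  obtain ⟨c1, c2, c3, c4⟩ := h1
  refine ⟨⟨?_, ?_, ?_, ?_⟩, ?_, ?_, ?_, h5, h6, h7⟩ <;>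
    rwa [Store.reg_set, Function.update_of_ne (Ne.symm ‹_›)]

theorem RunState.set {i : ℕ} (h : RunState L G E inp ms ms' s) (z : ℤ)
    (hi : i ∉ [3, 4, 5, 6, 7, 8, 30]) : RunState L G E inp ms ms' (s.set i z) := by
  obtain ⟨h1, ⟨T, T', h2, h3, h4, h5, b, h6⟩, h7⟩ := h
  exact ⟨h1, ⟨T, T', h2, h3, h4, h5, b, h6.set z hi⟩, h7⟩

theorem abs_mem_le {E h m : ℕ} {b : Bool} {f : ℕ → LP} (hs : TabState E h b m f s) (hh : 0 < h)
    (hM : 0 ≤ M) (hlow : ∀ x < E, |s.mem x| ≤ M) (hf : ∀ x e, |(f x).coeff e| ≤ M) (x : ℕ) :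
    |s.mem x| ≤ M := by
  by_cases hx : x < E
  · exact hlow x hx
  · obtain ⟨y, i, hi, rfl⟩ := exists_cell hh (not_lt.1 hx)
    by_cases hy : y % 2 = b.toNat
    · have e : y = 2 * (y / 2) + b.toNat := by omega
      rw [e, hs.tab _ _ hi]; exact hf _ _
    · have e : y = 2 * (y / 2) + (!b).toNat := by cases b <;> simp at hy ⊢ <;> omega
      rw [e, hs.tab' _ _ hi]; simpa using hM

/-- The bounds are not propagated from step to step, where they would grow. The table holds the
state of a tangle that extends to L, so `bdd_runOp` supplies the same bounds again before every
step. -/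
theorem RunState.tri_step (h : RunState L G E inp ms (m :: ms') s) (hP : Params n G E S B M inp)
    {kin kout r : ℕ} {ts : List Term} (hts : ∀ t ∈ ts, t.Small) (hlen : ts.length ≤ 8)
    (hkin : kin ≤ 4) (hkout : kout ≤ 4) {T T₁ T' : Tangle n}
    (h1 : MRun G ms (Tangle.empty n) T) (h2 : MStep m T T₁) (h3 : MRun G ms' T₁ T')
    (h4 : T'.Presents L) (hr : T.boundary.length = kin + r) (hr' : T₁.boundary.length = kout + r)
    (hG : T.boundary.length ≤ G) (hG' : T₁.boundary.length ≤ G) {b : Bool}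
    (hs : TabState E (32 * n) b T.boundary.length
      (vec T.boundary.length (runOp braW ms spinOne)) s)
    (hv : termsVal (2 ^ r) ts (vec (kin + r) (runOp braW ms spinOne)) =
      vec (kout + r) (m.op braW (runOp braW ms spinOne))) :
    Tri S B (opCmd kin kout ts) s (stepTime n G) fun s' =>
      RunState L G E inp (ms ++ [m]) ms' s' ∧ Same opRegs s s' := by
  have hperm : ((ms ++ [m] ++ ms').filterMap Micro.crossing?).Perm (List.finRange n) := by
    simpa using h.perm
  have hrun : MRun G (m :: ms') T T' := .cons h2 hG' h3
  have hB : ∀ x, Bdd (9 * n + G) M (vec T.boundary.length (runOp braW ms spinOne) x) := by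
    intro x
    by_cases hx : x < 2 ^ T.boundary.length
    · rw [vec_of_lt _ hx]
      exact (bdd_runOp h1 hrun h.perm h4 (length_bits _ _).symm).mono (by omega) hP.coeffs
    · rw [vec_of_le _ (by omega)]
      exact Bdd.zero _ (le_trans (by positivity) hP.coeffs)
  have hM0 : 0 ≤ M := (hB 0).1
  have hpG : 2 ^ r ≤ 2 ^ G := Nat.pow_le_pow_right (by omega) (by omega)
  have hpG1 : 32 * (2 ^ r + 1) * (8 * (32 * n)) ≤ 32 * (2 ^ G + 1) * (8 * (32 * n)) :=
    Nat.mul_le_mul_right _ (by omega)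
  have hpos := hP.pos
  have hmem := abs_mem_le hs (by omega) hM0 (fun x hx => by rw [h.inp x hx]; exact hP.input x hx)
    (fun x e => ((hB x).2 e).1)
  have hts' : 2 * (2 ^ ts.length * M) ≤ B := by
    refine le_trans ?_ hP.values
    have : (2 : ℤ) ^ ts.length ≤ 2 ^ 8 := pow_le_pow_right₀ (by norm_num) hlen
    nlinarith
  have hs' := hs
  rw [hr] at hs'
  have hsp := hP.space
  refine Tri.mono (tri_op hts (by omega) hs' hkin hkout (by omega) hP.le hmem hts' ?_ ?_) ?_ ?_
  · intro x e he
    have hg := hP.girth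
    rw [← hr]
    refine ((hB x).2 e).2 ?_
    rw [lt_abs]
    push_cast at he ⊢
    omega
  · intro x hx
    rw [hv, vec_of_le _ hx]
  · unfold stepTime
    refine Nat.add_le_add (Nat.mul_le_mul (by omega) (Nat.add_le_add_right
      (Nat.mul_le_mul_right _ hpG) _)) (by omega)
  · rintro s1 - ⟨k1, k2, k3⟩
    refine ⟨⟨hperm, ⟨T₁, T', mrun_append h1 (.cons h2 hG' (.nil _)), h3, h4, hG', !b, ?_⟩,
      fun x hx => (k3 x hx).trans (h.inp x hx)⟩, k1⟩
    rw [runOp_append, runOp_singleton, hr', ← hv]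
    exact k2

theorem small_rotTerms : ∀ t ∈ rotTerms, t.Small := by
  simp [rotTerms, Term.Small]

theorem small_cupTerms : ∀ t ∈ cupTerms, t.Small := by
  simp [cupTerms, Term.Small]

theorem small_capTerms : ∀ t ∈ capTerms, t.Small := by
  simp [capTerms, Term.Small]

theorem small_xTerms (b : Bool) : ∀ t ∈ xTerms (if b then 1 else -1), t.Small := by
  cases b <;> simp [xTerms, Term.Small]

theorem RunState.tri_micro (h : RunState L G E inp ms (m :: ms') s)
    (hP : Params n G E S B M inp) :
    Tri S B m.cmd s (stepTime n G) fun s' =>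
      RunState L G E inp (ms ++ [m]) ms' s' ∧ Same opRegs s s' := by
  obtain ⟨T, T', h1, h2, h3, h4, b, h5⟩ := h.run
  cases h2 with
  | cons h6 h7 h8 =>
    cases id h6 with
    | rot bd js k hb =>
      obtain ⟨r, hr⟩ := Nat.exists_eq_add_of_le' (List.length_pos_iff.2 hb)
      refine h.tri_step hP small_rotTerms (by decide) (by decide) (by decide) (r := r) h1 h6 h8 h3
        (by simp only [hr, add_comm]) (by simp only [List.length_rotate, hr, add_comm]) h4 h7 h5 ?_
      rw [add_comm, vec_rot]; rfl
    | cup bd js k =>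
      refine h.tri_step hP small_cupTerms (by decide) (by decide) (by decide) (r := bd.length) h1 h6
        h8 h3 (by simp) (by simp only [List.length_cons]; omega) h4 h7 h5 ?_
      rw [zero_add, add_comm, vec_cup]; rfl
    | cap x y bd js k =>
      refine h.tri_step hP small_capTerms (by decide) (by decide) (by decide) (r := bd.length) h1 h6
        h8 h3 (by simp only [List.length_cons]; omega) (by simp) h4 h7 h5 ?_
      rw [zero_add, add_comm, vec_cap]; rfl
    | x c j bd js k =>
      refine h.tri_step hP (small_xTerms _) (by simp [xTerms]) (by decide) (by decide) (r := bd.length)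
        h1 h6 h8 h3 (by simp) (by simp only [List.length_append, List.length_cons, List.length_nil]) h4 h7 h5 ?_
      rw [zero_add, add_comm, vec_x]
      congr 1
      funext l
      cases hj : even4 j <;> simp [Micro.op, braW, hj, -LaurentPolynomial.T_mul, add_comm]

end state

/-! ## The program for one move -/

/-- Do as many rotations as register 25 says. -/
def rotsCmd : Cmd := .repeat 25 (opCmd 1 1 rotTerms)

/-- Carry out as many joins as register 24 says; their positions are read from the input. -/
def capsCmd : Cmd :=
  .repeat 24 ((Cmd.block [.load 25 22, .add 22 22 3]).seq (rotsCmd.seq (opCmd 2 0 capTerms)))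

/-- Add a crossing, whose first half-edge has the number in register 28. -/
def xCmd : Cmd :=
  -- Only the parity of the half-edge number matters, so 2 is subtracted if it is at least 2. After
  -- that exactly one of the two remaining tests succeeds.
  (Cmd.block [.sub 2 28 3]).seq ((Cmd.ifPos 2 (.block [.sub 28 28 3, .sub 28 28 3])).seq
    ((Cmd.block [.sub 2 3 28]).seq ((Cmd.ifPos 2 (opCmd 0 4 (xTerms 1))).seq
      (.ifPos 28 (opCmd 0 4 (xTerms (-1)))))))

def crossingCmd : Cmd :=
  (Cmd.block [.add 22 22 3, .load 28 22, .add 22 22 3, .load 25 22, .add 22 22 3, .load 24 22,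
    .add 22 22 3]).seq (rotsCmd.seq xCmd)

def cupCmd : Cmd :=
  (Cmd.block [.load 25 22, .add 22 22 3, .const 24 0]).seq (rotsCmd.seq (opCmd 0 2 cupTerms))

/-- Carry out the move that is encoded at the address in register 22. -/
def moveCmd : Cmd :=
  -- Register 24 is the number of joins, preset to 1 as in a `cap`. `crossingCmd` and `cupCmd`
  -- overwrite it, so `capsCmd` can conclude moves of every kind.
  (Cmd.block [.load 26 22, .add 22 22 3, .const 24 1, .sub 27 26 3]).seq
    ((Cmd.ifPos 27 crossingCmd).seq ((Cmd.block [.sub 27 3 26]).seq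
      ((Cmd.ifPos 27 cupCmd).seq capsCmd)))

/-- The list is stored at address `a`. -/
def At (inp : ℕ → ℤ) : ℕ → List ℤ → Prop
  | _, [] => True
  | a, z :: l => inp a = z ∧ At inp (a + 1) l

theorem At.append {inp : ℕ → ℤ} {a : ℕ} {l l' : List ℤ} (h : At inp a (l ++ l')) :
    At inp a l ∧ At inp (a + l.length) l' := by
  induction l generalizing a with
  | nil => exact ⟨trivial, h⟩
  | cons z l ih =>
    obtain ⟨h1, h2⟩ := ih h.2
    exact ⟨⟨h.1, h1⟩, by rwa [List.length_cons, ← add_assoc, add_right_comm]⟩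

theorem at_of_eq {inp : ℕ → ℤ} {a : ℕ} {l : List ℤ} (h : ∀ i (hi : i < l.length), inp (a + i) = l[i]) :
    At inp a l := by
  induction l generalizing a with
  | nil => trivial
  | cons z l ih =>
    refine ⟨h 0 (by simp), ih fun i hi => ?_⟩
    have := h (i + 1) (by simpa using hi)
    rwa [← add_assoc, add_right_comm] at this

/-! ### Correctness and running time of the program for one move -/

section program

variable {n G E S : ℕ} {B M : ℤ} {inp : ℕ → ℤ} {L : LinkDiagram n} {ms ms' : List (Micro n)}
  {s : Store} {a : ℕ}

theorem Params.one_le (hP : Params n G E S B M inp) : 1 ≤ B := by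
  have := hP.pos
  have := hP.space
  have := hP.le
  omega

theorem Params.girth_le (hP : Params n G E S B M inp) : (G : ℤ) + 8 ≤ B ∧ (E : ℤ) + 8 ≤ B ∧ E ≤ S := by
  have h1 := hP.pos
  have h2 := hP.space
  have h3 := hP.le
  have h4 : G < 2 ^ G := Nat.lt_two_pow_self
  have h5 : 32 * (2 ^ G + 1) ≤ 32 * (2 ^ G + 1) * (8 * (32 * n)) := Nat.le_mul_of_pos_right _ (by omega)
  refine ⟨by omega, by omega, by omega⟩

theorem RunState.tri_load (h : RunState L G E inp ms ms' s) (hP : Params n G E S B M inp)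
    {r t : ℕ} {l : List Instr} {Q : Store → Prop} {z : ℤ} (hr : r ∉ [3, 4, 5, 6, 7, 8, 30])
    (hr' : r ≠ 22) (ha : s.reg 22 = a) (haE : a < E) (hz : inp a = z)
    (hl : RunState L G E inp ms ms' ((s.set r z).set 22 (a + 1 : ℕ)) →
      Tri S B (.block l) ((s.set r z).set 22 (a + 1 : ℕ)) t Q) :
    Tri S B (.block (.load r 22 :: .add 22 22 3 :: l)) s (t + 2) Q := by
  obtain ⟨h1, h2, h3⟩ := hP.girth_le
  have hc := h.consts.1
  have hr3 : r ≠ 3 := by rintro rfl; simp at hr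
  refine Tri.load ha (by omega) (Tri.add (x := a) (y := 1) ?_ ?_ ?_ ?_)
  · simpa [hr'.symm] using ha
  · simpa [hr3.symm] using hc
  · rw [abs_le]; constructor <;> omega
  · rw [h.inp a haE, hz]
    exact_mod_cast hl ((h.set z hr).set _ (by decide))

theorem RunState.tri_rots {p : ℕ} (h : RunState L G E inp ms (List.replicate p .rot ++ ms') s)
    (hP : Params n G E S B M inp) (hp : s.reg 25 = p) (hpG : p ≤ G) :
    Tri S B rotsCmd s (G * (stepTime n G + 2) + 3) fun s' =>
      RunState L G E inp (ms ++ List.replicate p .rot) ms' s' ∧ Same (25 :: opRegs) s s' := by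
  obtain ⟨h1, h2, h3⟩ := hP.girth_le
  refine Tri.le (Tri.repeat (m := p) (t := stepTime n G) hP.one_le (by omega) (fun j s' =>
    j ≤ p ∧ RunState L G E inp (ms ++ List.replicate (p - j) .rot) (List.replicate j .rot ++ ms') s' ∧
      Same (25 :: opRegs) s s' ∧ s'.reg 25 = j) (fun j s' hI => hI.2.2.2) ?_ ?_ ?_)
      (Nat.add_le_add_right (Nat.mul_le_mul_right _ hpG) _)
  · refine ⟨le_rfl, ?_, (Same.refl _ _).set (by decide) _, by simpa using hp⟩
    simpa using h.set 1 (by decide)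
  · rintro j s1 hj ⟨-, k1, k2, k3⟩
    rw [List.replicate_succ, List.cons_append] at k1
    refine Tri.imp (k1.tri_micro hP) ?_
    rintro s2 - ⟨l1, l2⟩
    refine ⟨(l2 25 (by decide)).trans k3, l1.consts.1, by omega, ?_, ?_, by simp⟩
    · have e : p - j = p - (j + 1) + 1 := by omega
      rw [e, List.replicate_succ', ← List.append_assoc]
      exact l1.set _ (by decide)
    · exact (k2.trans (l2.mono (by simp [opRegs]))).set (by decide) _
  · rintro s1 ⟨-, k1, k2, k3⟩
    exact ⟨by simpa using k1, k2⟩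

/-- A bound for the time that a join takes. -/
def capTime (n G : ℕ) : ℕ := (G + 1) * (stepTime n G + 2) + 7

theorem RunState.tri_caps {qs : List ℕ} (h : RunState L G E inp ms (qs.flatMap capMicros ++ ms') s)
    (hP : Params n G E S B M inp) (hk : s.reg 24 = qs.length) (hq : ∀ q ∈ qs, q ≤ G)
    (hlen : qs.length ≤ 4) (ha : s.reg 22 = a) (hat : At inp a (qs.map fun q : ℕ => (q : ℤ)))
    (haE : a + qs.length ≤ E) :
    Tri S B capsCmd s (4 * (capTime n G + 2) + 3) fun s' =>
      RunState L G E inp (ms ++ qs.flatMap capMicros) ms' s' ∧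
      Same (22 :: 24 :: 25 :: opRegs) s s' ∧ s'.reg 22 = (a + qs.length : ℕ) := by
  obtain ⟨h1, h2, h3⟩ := hP.girth_le
  refine Tri.le (Tri.repeat (m := qs.length) (t := capTime n G) hP.one_le (by omega) (fun j s' =>
    ∃ done todo, qs = done ++ todo ∧ todo.length = j ∧
      RunState L G E inp (ms ++ done.flatMap capMicros) (todo.flatMap capMicros ++ ms') s' ∧
      Same (22 :: 24 :: 25 :: opRegs) s s' ∧ s'.reg 22 = (a + done.length : ℕ) ∧ s'.reg 24 = j)
      ?_ ?_ ?_ ?_) (Nat.add_le_add_right (Nat.mul_le_mul_right _ hlen) _)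
  · rintro j s1 ⟨_, _, _, _, _, _, _, k⟩
    exact k
  · exact ⟨[], qs, rfl, rfl, by simpa using h.set 1 (by decide),
      (Same.refl _ _).set (by decide) _, by simpa using ha, by simpa using hk⟩
  · rintro j s1 hj ⟨done, todo, e, hl, k1, k2, k3, k4⟩
    cases todo with
    | nil => simp at hl
    | cons q todo =>
      rw [e, List.map_append] at hat
      have hz : inp (a + done.length) = q := by simpa using hat.append.2.1
      have hle := congrArg List.length e
      simp only [List.length_append, List.length_cons] at hle
      refine Tri.le (Tri.seq (t := 0 + 2) (t' := (G * (stepTime n G + 2) + 3) + stepTime n G)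
        (k1.tri_load hP (by decide) (by decide) k3 (by omega) hz fun k5 => Tri.nil ?_))
        (by unfold capTime; rw [Nat.succ_mul]; omega)
      rw [List.flatMap_cons, capMicros, List.append_assoc, List.append_assoc] at k5
      refine Tri.seq (Tri.imp (k5.tri_rots hP (by simp) (hq q (by simp [e]))) ?_)
      rintro s2 - ⟨l1, l2⟩
      refine Tri.imp (l1.tri_micro hP) ?_
      rintro s3 - ⟨m1, m2⟩
      have hS : Same (25 :: opRegs) ((s1.set 25 q).set 22 (a + done.length + 1 : ℕ)) s3 :=
        l2.trans (m2.mono (by simp [opRegs]))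
      refine ⟨?_, m1.consts.1, done ++ [q], todo, by simp [e], by simpa using hl, ?_, ?_, ?_, by simp⟩
      · rw [hS 24 (by decide)]; simpa using k4
      · simpa [capMicros] using m1.set j (i := 24) (by decide)
      · refine Same.set ?_ (by decide) _
        refine Same.trans ?_ (hS.mono (by simp [opRegs]))
        exact (k2.set (by decide) _).set (by decide) _
      · rw [Store.reg_set, Function.update_of_ne (by decide), hS 22 (by decide)]
        simp [add_assoc]
  · rintro s1 ⟨done, todo, e, hl, k1, k2, k3, k4⟩
    obtain rfl := List.length_eq_zero_iff.1 hl
    rw [List.append_nil] at e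
    subst e
    exact ⟨by simpa using k1, k2, k3⟩

theorem RunState.tri_x {c : Fin n} {j : Fin 4} (h : RunState L G E inp ms (.x c j :: ms') s)
    (hP : Params n G E S B M inp) (hj : s.reg 28 = (j : ℕ)) :
    Tri S B xCmd s (2 * stepTime n G + 19) fun s' =>
      RunState L G E inp (ms ++ [.x c j]) ms' s' ∧ Same (2 :: 28 :: opRegs) s s' := by
  obtain ⟨b1, b2, b3⟩ := hP.girth_le
  have hB := hP.one_le
  have hj4 : (j : ℕ) < 4 := j.2
  have h3 := h.consts.1
  refine Tri.le (Tri.seq (t := 0 + 1) (t' := (0 + 1 + 1 + 5) + ((0 + 1) + ((stepTime n G + 5) +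
    (stepTime n G + 5)))) (Tri.sub hj h3 (by rw [abs_le]; constructor <;> omega) (Tri.nil ?_))) (by omega)
  have key : ∀ s' : Store, RunState L G E inp ms (.x c j :: ms') s' →
      Same (2 :: 28 :: opRegs) s s' → s'.reg 28 = ((j % 2 : ℕ) : ℤ) →
      Tri S B ((Cmd.block [.sub 2 3 28]).seq ((Cmd.ifPos 2 (opCmd 0 4 (xTerms 1))).seq
      (.ifPos 28 (opCmd 0 4 (xTerms (-1)))))) s' ((0 + 1) + ((stepTime n G + 5) +
    (stepTime n G + 5))) fun s' =>
      RunState L G E inp (ms ++ [.x c j]) ms' s' ∧ Same (2 :: 28 :: opRegs) s s' := by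
    intro s1 k1 k2 k3
    refine Tri.seq (Tri.sub k1.consts.1 k3 (by rw [abs_le]; constructor <;> omega) (Tri.nil ?_))
    have k4 := k1.set (1 - ((j % 2 : ℕ) : ℤ)) (i := 2) (by decide)
    have k5 := k2.set (i := 2) (by decide) (1 - ((j % 2 : ℕ) : ℤ))
    refine Tri.seq (Tri.ifPos hB ?_ ?_ (by decide))
    · intro hpos
      have h0 : (j : ℕ) % 2 = 0 := by simp at hpos; omega
      have := (k4.set (i := 29) 1 (by decide)).tri_micro hP
      have e : (Micro.x c j).cmd = opCmd 0 4 (xTerms 1) := by simp [Micro.cmd, even4, h0]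
      rw [e] at this
      refine Tri.imp this ?_
      rintro s2 - ⟨l1, l2⟩
      have l3 := ((k5.set (i := 29) (by decide) 1).trans (l2.mono (by simp [opRegs]))).set (i := 2) (by decide) 0
      refine Tri.ifPos hB ?_ ?_ (by decide)
      · intro hpos2
        exfalso
        have e : s2.reg 28 = 0 := by
          rw [l2 28 (by decide)]; simp [k3, h0]
        simp [e] at hpos2
      · intro _
        exact ⟨(l1.set 0 (by decide)).set 1 (by decide), l3.set (by decide) _⟩
    · intro hpos
      have h0 : (j : ℕ) % 2 = 1 := by simp at hpos; omega
      refine Tri.ifPos hB ?_ ?_ (by decide)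
      · intro _
        have := ((k4.set (i := 29) 1 (by decide)).set (i := 29) 1 (by decide)).tri_micro hP
        have e : (Micro.x c j).cmd = opCmd 0 4 (xTerms (-1)) := by simp [Micro.cmd, even4, h0]
        rw [e] at this
        refine Tri.imp this ?_
        rintro s2 - ⟨l1, l2⟩
        exact ⟨l1.set 0 (by decide), (((k5.set (i := 29) (by decide) 1).set (i := 29) (by decide) 1).trans
          (l2.mono (by simp [opRegs]))).set (by decide) _⟩
      · intro hn
        simp [k3, h0] at hn
  have k1 := h.set ((j : ℕ) - 1) (i := 2) (by decide)
  have k2 := (Same.refl (2 :: 28 :: opRegs) s).set (i := 2) (by decide) ((j : ℕ) - 1)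
  refine Tri.seq (Tri.ifPos hB ?_ ?_ (by decide))
  · intro hpos
    simp at hpos
    refine Tri.sub (x := (j : ℕ)) (y := 1) (by simpa using hj) (by simpa using h3)
      (by rw [abs_le]; constructor <;> omega) (Tri.sub (x := (j : ℕ) - 1) (y := 1) (by simp)
      (by simpa using h3) (by rw [abs_le]; constructor <;> omega) (Tri.nil ?_))
    refine key _ ?_ ?_ ?_
    · exact (((k1.set _ (by decide)).set _ (by decide)).set _ (by decide)).set _ (by decide)
    · exact (((k2.set (by decide) _).set (by decide) _).set (by decide) _).set (by decide) _
    · simp; omega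
  · intro hpos
    simp at hpos
    refine key _ (k1.set _ (by decide)) (k2.set (by decide) _) ?_
    simp [hj]; omega

/-- A bound for the time that a move takes. -/
def moveTime (n G : ℕ) : ℕ :=
  2 * (G * (stepTime n G + 2) + 3) + 3 * stepTime n G + 4 * (capTime n G + 2) + 60

theorem RunState.tri_crossing {c : Fin n} {j : Fin 4} {p : ℕ} {qs : List ℕ}
    (h : RunState L G E inp ms (List.replicate p .rot ++ .x c j :: ms') s)
    (hP : Params n G E S B M inp) (ha : s.reg 22 = a)
    (hat : At inp a [((c : ℕ) : ℤ), ((j : ℕ) : ℤ), p, qs.length]) (hpG : p ≤ G) (haE : a + 4 ≤ E) :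
    Tri S B crossingCmd s (7 + ((G * (stepTime n G + 2) + 3) + (2 * stepTime n G + 19))) fun s' =>
      RunState L G E inp (ms ++ (List.replicate p .rot ++ [.x c j])) ms' s' ∧
      Same (2 :: 22 :: 24 :: 25 :: 28 :: opRegs) s s' ∧ s'.reg 22 = (a + 4 : ℕ) ∧
      s'.reg 24 = qs.length := by
  obtain ⟨b1, b2, b3⟩ := hP.girth_le
  obtain ⟨-, z1, z2, z3, -⟩ := hat
  refine Tri.seq (t := 0 + 2 + 2 + 2 + 1) (Tri.add (x := a) (y := 1) ha h.consts.1
    (by rw [abs_le]; constructor <;> omega) ?_)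
  have h1 := h.set ((a : ℤ) + 1) (i := 22) (by decide)
  refine h1.tri_load hP (a := a + 1) (by decide) (by decide) (by simp) (by omega) z1 fun h2 =>
    h2.tri_load hP (a := a + 1 + 1) (by decide) (by decide) (by simp) (by omega) z2 fun h3 =>
    h3.tri_load hP (a := a + 1 + 1 + 1) (by decide) (by decide) (by simp) (by omega) z3 fun h4 =>
    Tri.nil ?_
  refine Tri.seq (Tri.imp (h4.tri_rots hP (by simp) hpG) ?_)
  rintro s2 - ⟨l1, l2⟩
  refine Tri.imp (l1.tri_x hP ((l2 28 (by decide)).trans (by simp))) ?_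
  rintro s3 - ⟨m1, m2⟩
  have hS := (l2.mono (by simp [opRegs] : _ ⊆ 2 :: 25 :: 28 :: opRegs)).trans
    (m2.mono (by simp [opRegs]))
  refine ⟨by simpa using m1, ?_, ?_, ?_⟩
  · refine Same.trans ?_ (hS.mono (by simp [opRegs]))
    repeat' first | exact Same.refl _ _ | refine Same.set ?_ (by decide) _
  · rw [hS 22 (by decide)]; simp [add_assoc]
  · rw [hS 24 (by decide)]; simp

theorem RunState.tri_cup {p : ℕ}
    (h : RunState L G E inp ms (List.replicate p .rot ++ .cup :: ms') s)
    (hP : Params n G E S B M inp) (ha : s.reg 22 = a) (hz : inp a = p) (hpG : p ≤ G)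
    (haE : a + 1 ≤ E) :
    Tri S B cupCmd s (3 + ((G * (stepTime n G + 2) + 3) + stepTime n G)) fun s' =>
      RunState L G E inp (ms ++ (List.replicate p .rot ++ [.cup])) ms' s' ∧
      Same (22 :: 24 :: 25 :: opRegs) s s' ∧ s'.reg 22 = (a + 1 : ℕ) ∧ s'.reg 24 = 0 := by
  have hB := hP.one_le
  refine Tri.seq (t := 0 + 1 + 2) (h.tri_load hP (by decide) (by decide) ha (by omega) hz fun h1 =>
    Tri.const (by simp; omega) (Tri.nil ?_))
  refine Tri.seq (Tri.imp ((h1.set 0 (i := 24) (by decide)).tri_rots hP (by simp) hpG) ?_)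
  rintro s2 - ⟨l1, l2⟩
  refine Tri.imp (l1.tri_micro hP) ?_
  rintro s3 - ⟨m1, m2⟩
  have hS := l2.trans (m2.mono (by simp [opRegs]))
  refine ⟨by simpa using m1, ?_, ?_, ?_⟩
  · refine Same.trans ?_ (hS.mono (by simp [opRegs]))
    repeat' first | exact Same.refl _ _ | refine Same.set ?_ (by decide) _
  · rw [hS 22 (by decide)]; simp
  · rw [hS 24 (by decide)]; simp

/-- At most four pairs are joined. -/
def Move.FewJoins : Move n → Prop
  | .crossing _ _ _ qs => qs.length ≤ 4
  | _ => True

/-- The number by which the kind of a move is encoded. -/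
def Move.tag : Move n → ℕ
  | .cup _ => 0
  | .cap _ => 1
  | .crossing _ _ _ _ => 2

theorem RunState.tri_move {mv : Move n} (h : RunState L G E inp ms (mv.micros ++ ms') s)
    (hP : Params n G E S B M inp) (ha : s.reg 22 = a) (hat : At inp a mv.encode)
    (hG : mv.Small G) (hq : mv.FewJoins) (haE : a + mv.encode.length ≤ E) :
    Tri S B moveCmd s (moveTime n G) fun s' =>
      RunState L G E inp (ms ++ mv.micros) ms' s' ∧ s'.reg 22 = (a + mv.encode.length : ℕ) ∧
      s'.reg 23 = s.reg 23 := by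
  obtain ⟨b1, b2, b3⟩ := hP.girth_le
  have hB := hP.one_le
  obtain ⟨tag, htag⟩ : ∃ k, k = mv.tag := ⟨_, rfl⟩
  have ht : inp a = tag := by rw [htag]; cases mv <;> exact hat.1
  have hlen : 0 < mv.encode.length := by cases mv <;> simp [Move.encode]
  have htag2 : tag ≤ 2 := by cases mv <;> simp [htag, Move.tag]
  refine Tri.le (Tri.seq (t := 0 + 1 + 1 + 2) (t' := ((7 + ((G * (stepTime n G + 2) + 3) +
    (2 * stepTime n G + 19))) + 5) + ((0 + 1) + (((3 + ((G * (stepTime n G + 2) + 3) + stepTime n G)) + 5)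
    + (4 * (capTime n G + 2) + 3)))) (h.tri_load hP (by decide) (by decide) ha (by omega) ht fun h1 =>
    Tri.const (by simp; omega) (Tri.sub (x := tag) (y := 1) (by simp) (by simpa using h.consts.1)
    (by rw [abs_le]; constructor <;> omega) (Tri.nil ?_)))) (by unfold moveTime; ring_nf; omega)
  have h2 := (h1.set 1 (i := 24) (by decide)).set ((tag : ℤ) - 1) (i := 27) (by decide)
  set s1 := ((((s.set 26 tag).set 22 (a + 1 : ℕ)).set 24 1).set 27 ((tag : ℤ) - 1)) with hs1
  have r22 : s1.reg 22 = (a + 1 : ℕ) := by simp [hs1]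
  have r23 : s1.reg 23 = s.reg 23 := by simp [hs1]
  have r24 : s1.reg 24 = 1 := by simp [hs1]
  have r26 : s1.reg 26 = tag := by simp [hs1]
  have r27 : s1.reg 27 = (tag : ℤ) - 1 := by simp [hs1]
  have h3 := h2.set 1 (i := 29) (by decide)
  refine Tri.seq (Tri.ifPos hB ?_ ?_ (by decide))
  · intro hpos
    rw [r27] at hpos
    cases mv with
    | cup p => simp [htag, Move.tag] at hpos
    | cap q => simp [htag, Move.tag] at hpos
    | crossing c j p qs =>
      have e1 : tag = 2 := htag
      simp only [Move.micros, List.append_assoc, List.singleton_append] at h3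
      obtain ⟨-, hat1⟩ := hat
      obtain ⟨hat2, hat3⟩ := At.append (l := [((c : ℕ) : ℤ), ((j : ℕ) : ℤ), (p : ℤ), (qs.length : ℤ)]) hat1
      simp only [Move.encode, List.length_append, List.length_cons, List.length_map, List.length_nil] at haE
      simp only [List.length_cons, List.length_nil] at hat3
      refine Tri.imp (h3.tri_crossing hP (qs := qs) (a := a + 1) (by simpa using r22) hat2 hG.1 (by omega)) ?_
      rintro s2 - ⟨k1, k2, k3, k4⟩
      refine Tri.seq (Tri.sub (x := 1) (y := 2) (by simpa using k1.consts.1)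
        (by rw [Store.reg_set, Function.update_of_ne (by decide), k2 26 (by decide)]; simpa [e1] using r26)
        (by simp; omega) (Tri.nil ?_))
      have k5 := ((k1.set 0 (i := 27) (by decide)).set (1 - 2) (i := 27) (by decide)).set 1 (i := 29) (by decide)
      refine Tri.seq (Tri.ifPos hB (fun hpos => by simp at hpos) (fun _ => ?_) (by decide))
      refine Tri.imp (k5.tri_caps hP (by simpa using k4) hG.2 hq (a := a + 1 + 4) (by simpa using k3) hat3 (by omega)) ?_
      rintro s3 - ⟨l1, l2, l3⟩
      refine ⟨by simpa [Move.micros] using l1, ?_, ?_⟩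
      · rw [l3]; simp [Move.encode]; ring
      · rw [l2 23 (by decide)]
        simpa using (k2 23 (by decide)).trans r23
  · intro hneg
    rw [r27] at hneg
    refine Tri.seq (Tri.sub (x := 1) (y := tag) (by simpa using h3.consts.1) (by simpa using r26)
      (by rw [abs_le]; constructor <;> omega) (Tri.nil ?_))
    have h4 := (h3.set (1 - (tag : ℤ)) (i := 27) (by decide)).set 1 (i := 29) (by decide)
    refine Tri.seq (Tri.ifPos hB (fun hpos => ?_) (fun hneg' => ?_) (by decide))
    · simp at hpos
      cases mv with
      | cap q => exact absurd hpos (by simp [htag, Move.tag])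
      | crossing c j p qs => exact absurd hpos (by simp [htag, Move.tag])
      | cup p =>
        simp only [Move.micros, List.append_assoc, List.singleton_append] at h4
        simp only [Move.encode, List.length_cons, List.length_nil] at haE
        refine Tri.imp (h4.tri_cup hP (a := a + 1) (by simpa using r22) hat.2.1 hG (by omega)) ?_
        rintro s2 - ⟨k1, k2, k3, k4⟩
        refine Tri.imp ((k1.set 0 (i := 27) (by decide)).tri_caps (qs := []) hP (by simpa using k4)
          (by simp) (by simp) (a := a + 1 + 1) (by simpa using k3) trivial (by simp; omega)) ?_
        rintro s3 - ⟨l1, l2, l3⟩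
        refine ⟨by simpa [Move.micros] using l1, ?_, ?_⟩
        · rw [l3]; simp [Move.encode]; ring
        · rw [l2 23 (by decide)]
          simpa using (k2 23 (by decide)).trans (by simpa using r23)
    · simp at hneg'
      cases mv with
      | cup p => exact absurd hneg' (by simp [htag, Move.tag])
      | crossing c j p qs => exact absurd hneg (by simp [htag, Move.tag])
      | cap q =>
        simp only [Move.encode, List.length_cons, List.length_nil] at haE
        rw [Move.micros, ← List.flatMap_singleton capMicros q] at h4
        refine Tri.imp (h4.tri_caps (qs := [q]) (ms' := ms') hP (by simpa using r24)
          (by simpa [Move.Small] using hG) (by simp) (a := a + 1) (by simpa using r22) ⟨hat.2.1, trivial⟩ (by simp; omega)) ?_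
        rintro s3 - ⟨l1, l2, l3⟩
        refine ⟨by simpa [Move.micros] using l1, ?_, ?_⟩
        · rw [l3]; simp [Move.encode]; ring
        · rw [l2 23 (by decide)]
          simpa using r23

end program

/-! ## Properties of cuttings -/

section cuttings

variable {n : ℕ} {T T' : Tangle n}

/-- All crossings at the boundary belong to `A`. -/
def Tangle.BoundaryIn (T : Tangle n) (A : List (Fin n)) : Prop :=
  ∀ x ∈ T.boundary, ∀ c, x.isAt c = true → c ∈ A

theorem close_spec {ok : StrandEnd n → StrandEnd n → Bool} {q : ℕ} (h : T.close ok q = some T') :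
    ∃ x y, T.boundary.Perm (x :: y :: T'.boundary) ∧ ok x y = true := by
  unfold Tangle.close at h
  split_ifs at h with hq
  split at h
  · rename_i x y rest e
    split_ifs at h with hok
    simp only [Option.some.injEq] at h
    subst h
    exact ⟨x, y, e ▸ (List.rotate_perm _ _).symm, hok⟩
  · simp at h

/-- Every join of a crossing step uses up at least one boundary point at `c`; their number serves as
a potential. -/
theorem closes_spec {c : Fin n} {qs : List ℕ}
    (h : qs.foldlM (Tangle.close fun x y => x.isAt c || y.isAt c) T = some T') :
    T'.boundary.countP (StrandEnd.isAt c) + qs.length ≤ T.boundary.countP (StrandEnd.isAt c) ∧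
      ∀ x ∈ T'.boundary, x ∈ T.boundary := by
  induction qs generalizing T with
  | nil =>
    simp only [List.foldlM_nil, Option.pure_def, Option.some.injEq] at h
    subst h
    simp
  | cons q qs ih =>
    rw [List.foldlM_cons, Option.bind_eq_bind, Option.bind_eq_some_iff] at h
    obtain ⟨T1, h1, h2⟩ := h
    obtain ⟨x, y, hp, hxy⟩ := close_spec h1
    obtain ⟨k1, k2⟩ := ih h2
    refine ⟨?_, fun z hz => hp.mem_iff.2 (by simp [k2 z hz])⟩
    rw [hp.countP_eq, List.countP_cons, List.countP_cons, List.length_cons]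
    rw [Bool.or_eq_true] at hxy
    rcases hxy with h | h <;> simp only [h, if_true] <;> omega

/-- A crossing that was not added before has no half-edge on the boundary, and adding it brings
four; so at most four joins can follow. This bounds the length of the encoding and the time of a
step. -/
theorem BoundaryIn_apply {A : List (Fin n)} {mv : Move n} (h : mv.apply T = some T')
    (hA : T.BoundaryIn A) (hc : ∀ c ∈ mv.crossing?, c ∉ A) :
    T'.BoundaryIn (A ++ [mv].filterMap Move.crossing?) ∧ mv.FewJoins := by
  cases mv with
  | cup p =>
    simp only [Move.apply] at h
    split_ifs at h with hp
    simp only [Option.some.injEq] at h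
    subst h
    refine ⟨fun x hx c hc => ?_, trivial⟩
    simp only [List.mem_cons, List.mem_rotate] at hx
    rcases hx with rfl | rfl | hx
    · simp [StrandEnd.isAt] at hc
    · simp [StrandEnd.isAt] at hc
    · simp [hA x hx c hc]
  | cap q =>
    obtain ⟨x, y, hp, -⟩ := close_spec (T := T) h
    exact ⟨fun z hz c hc => by simp [hA z (hp.mem_iff.2 (by simp [hz])) c hc], trivial⟩
  | crossing c j p qs =>
    simp only [Move.apply] at h
    split_ifs at h with hp
    obtain ⟨h1, h2⟩ := closes_spec h
    constructor
    · intro x hx c' hc'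
      have := h2 x hx
      simp only [List.mem_append, List.mem_rotate] at this
      rcases this with hx | hx
      · have : c' = c := by
          simp only [List.mem_cons, List.not_mem_nil, or_false] at hx
          rcases hx with rfl | rfl | rfl | rfl <;> simpa [StrandEnd.isAt, eq_comm] using hc'
        simp [this, Move.crossing?]
      · simp [hA x hx c' hc']
    · have h0 : (T.boundary.rotate p).countP (StrandEnd.isAt c) = 0 := by
        rw [List.countP_eq_zero]
        intro x hx hxc
        exact hc c rfl (hA x (List.mem_rotate.1 hx) c hxc)
      have h4 := List.countP_le_length (p := StrandEnd.isAt c)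
        (l := [StrandEnd.dart (c, j), .dart (c, j + 1), .dart (c, j + 2), .dart (c, j + 3)])
      rw [List.countP_append, h0] at h1
      simp only [List.length_cons, List.length_nil] at h4
      simp only [Move.FewJoins]
      omega

theorem fewJoins_of_foldlM {A : List (Fin n)} {l : List (Move n)} (h : l.foldlM Move.apply T = some T')
    (hA : T.BoundaryIn A) (hnd : (A ++ l.filterMap Move.crossing?).Nodup) : ∀ mv ∈ l, mv.FewJoins := by
  induction l generalizing T A with
  | nil => simp
  | cons mv l ih =>
    rw [List.foldlM_cons, Option.bind_eq_bind, Option.bind_eq_some_iff] at h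
    obtain ⟨T1, h1, h2⟩ := h
    have e : A ++ (mv :: l).filterMap Move.crossing? =
        (A ++ [mv].filterMap Move.crossing?) ++ l.filterMap Move.crossing? := by
      rw [List.append_assoc, ← List.filterMap_append]; rfl
    rw [e] at hnd
    obtain ⟨k1, k2⟩ := BoundaryIn_apply h1 hA (by
      intro c hc hcA
      refine (List.nodup_append.1 (List.nodup_append.1 hnd).1).2.2 c hcA c ?_ rfl
      exact List.mem_filterMap.2 ⟨mv, by simp, hc⟩)
    simpa [k2] using ih h2 k1 hnd

/-- All tangles of the sequence of moves have at most `g` boundary points. -/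
def GirthLe (g : ℕ) : List (Move n) → Tangle n → Prop
  | [], T => T.boundary.length ≤ g
  | mv :: l, T => T.boundary.length ≤ g ∧ ∀ T' ∈ mv.apply T, GirthLe g l T'

theorem GirthLe.head {g : ℕ} {l : List (Move n)} (h : GirthLe g l T) : T.boundary.length ≤ g := by
  cases l with
  | nil => exact h
  | cons mv l => exact h.1

theorem girthLe_of_take {g : ℕ} {l : List (Move n)}
    (h : ∀ i ≤ l.length, ∀ T' ∈ (l.take i).foldlM Move.apply T, T'.boundary.length ≤ g) :
    GirthLe g l T := by
  induction l generalizing T with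
  | nil => exact h 0 le_rfl T (by simp)
  | cons mv l ih =>
    refine ⟨h 0 (by simp) T (by simp), fun T1 h1 => ih fun i hi T2 h2 => h (i + 1) (by simpa using hi) T2 ?_⟩
    rw [List.take_succ_cons, List.foldlM_cons, Option.bind_eq_bind, Option.mem_def,
      Option.bind_eq_some_iff]
    exact ⟨T1, h1, h2⟩

theorem GirthLe.mrun {g : ℕ} {l : List (Move n)} (h : GirthLe g l T)
    (hT : l.foldlM Move.apply T = some T') :
    MRun (g + 4) (l.flatMap Move.micros) T T' ∧ ∀ mv ∈ l, mv.Small (g + 4) := by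
  induction l generalizing T with
  | nil =>
    simp only [List.foldlM_nil, Option.pure_def, Option.some.injEq] at hT
    subst hT
    exact ⟨.nil _, by simp⟩
  | cons mv l ih =>
    rw [List.foldlM_cons, Option.bind_eq_bind, Option.bind_eq_some_iff] at hT
    obtain ⟨T1, h1, h2⟩ := hT
    obtain ⟨k1, k2⟩ := mrun_move h1 (Nat.add_le_add_right h.1 4)
    obtain ⟨l1, l2⟩ := ih (h.2 T1 h1) h2
    exact ⟨mrun_append k1 l1, by simpa [k2] using l2⟩

theorem LinkDiagram.Cutting.girthLe {L : LinkDiagram n} (c : L.Cutting) :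
    GirthLe c.girth c.moves (Tangle.empty n) := by
  refine girthLe_of_take fun i hi T hT => ?_
  have := Finset.le_sup (f := fun i => ((build (c.moves.take i)).map fun T => T.boundary.length).getD 0)
    (Finset.mem_range.2 (Nat.lt_succ_of_le hi))
  have e : build (c.moves.take i) = some T := hT
  rw [LinkDiagram.Cutting.girth]
  simpa [e] using this

theorem filterMap_flatMap_micros (l : List (Move n)) :
    (l.flatMap Move.micros).filterMap Micro.crossing? = l.filterMap Move.crossing? := by
  induction l with
  | nil => rfl
  | cons mv l ih =>
    rw [List.flatMap_cons, List.filterMap_append, ih, filterMap_micros, ← List.filterMap_append]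
    rfl

theorem length_encode_le {mv : Move n} (h : mv.FewJoins) : mv.encode.length ≤ 9 := by
  cases mv with
  | crossing c j p qs =>
    have : qs.length ≤ 4 := h
    simp [Move.encode]; omega
  | _ => simp [Move.encode]

theorem length_flatMap_encode_le {l : List (Move n)} (h : ∀ mv ∈ l, mv.FewJoins) :
    (l.flatMap Move.encode).length ≤ 9 * l.length := by
  induction l with
  | nil => simp
  | cons mv l ih =>
    have h1 := length_encode_le (h mv (by simp))
    have h2 := ih fun mv hmv => h mv (by simp [hmv])
    rw [List.flatMap_cons, List.length_append, List.length_cons]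
    omega

theorem length_encode (L : LinkDiagram n) : L.encode.length = 4 * n + 1 := by
  simp [LinkDiagram.encode, List.length_flatMap]; ring

theorem abs_encode_le (L : LinkDiagram n) : ∀ z ∈ L.encode, |z| ≤ 4 * n := by
  intro z hz
  simp only [LinkDiagram.encode, List.mem_cons, List.mem_flatMap, List.mem_map] at hz
  rcases hz with rfl | ⟨c, -, j, -, rfl⟩
  · rw [abs_le]; constructor <;> omega
  · have h1 := (L.link (c, j)).1.2
    have h2 := (L.link (c, j)).2.2
    rw [abs_le]; constructor <;> omega

theorem abs_move_encode_le {mv : Move n} {G : ℕ} (h : mv.Small G) (h' : mv.FewJoins) :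
    ∀ z ∈ mv.encode, |z| ≤ G + n + 4 := by
  intro z hz
  cases mv with
  | cup p =>
    simp only [Move.Small] at h
    simp only [Move.encode, List.mem_cons, List.not_mem_nil, or_false] at hz
    rcases hz with rfl | rfl <;> rw [abs_le] <;> constructor <;> omega
  | cap p =>
    simp only [Move.Small] at h
    simp only [Move.encode, List.mem_cons, List.not_mem_nil, or_false] at hz
    rcases hz with rfl | rfl <;> rw [abs_le] <;> constructor <;> omega
  | crossing c j p qs =>
    obtain ⟨h1, h2⟩ := h
    have h3 : qs.length ≤ 4 := h'
    have hc := c.2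
    have hj := j.2
    simp only [Move.encode, List.mem_append, List.mem_cons, List.not_mem_nil, or_false,
      List.mem_map] at hz
    rcases hz with (rfl | rfl | rfl | rfl | rfl) | ⟨q, hq, rfl⟩ <;> rw [abs_le]
    iterate 5 constructor <;> omega
    have := h2 q hq
    constructor <;> omega

end cuttings

/-! ## The whole program -/

/-- Set up the registers and the table of the empty tangle. -/
def initCmd : Cmd :=
  -- From n and the number N of steps the block computes E = 4 n + 2 + 9 N, the first address behind
  -- the space for the input, and the multiples of h = 32 n by doubling. The final store writes the
  -- coefficient 1 of A⁰ into the only entry of the table of the empty tangle.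
  .block [.const 3 1, .load 24 30, .add 0 24 24, .add 0 0 0, .add 22 0 3, .load 23 22,
    .add 22 22 3, .add 1 23 23, .add 1 1 1, .add 1 1 1, .add 1 1 23, .add 1 1 22, .add 0 0 0,
    .add 0 0 0, .add 0 0 0, .add 4 1 0, .add 7 0 0, .add 6 7 7, .add 5 4 6, .add 6 6 6, .add 1 4 0,
    .store 1 3]

/-- Write the place of the result to the output registers. -/
def outputCmd : Cmd :=
  -- Five doublings turn n into h = 32 n, and the first exponent of the output is -h.
  .block [.load 0 30, .add 0 0 0, .add 0 0 0, .add 0 0 0, .add 0 0 0, .add 0 0 0, .sub 0 30 0,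
    .add 1 7 30, .add 2 4 30]

def bracketCmd : Cmd := initCmd.seq ((Cmd.repeat 23 moveCmd).seq outputCmd)

section main

variable {n G E S : ℕ} {B M : ℤ} {inp : ℕ → ℤ} {L : LinkDiagram n} {ms ms' : List (Micro n)}
  {s : Store} {a : ℕ}

theorem RunState.tri_moves {moves : List (Move n)}
    (h : RunState L G E inp [] (moves.flatMap Move.micros) s) (hP : Params n G E S B M inp)
    (ha : s.reg 22 = a) (hk : s.reg 23 = moves.length) (hat : At inp a (moves.flatMap Move.encode))
    (hG : ∀ mv ∈ moves, mv.Small G) (hq : ∀ mv ∈ moves, mv.FewJoins)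
    (haE : a + (moves.flatMap Move.encode).length ≤ E) (hlen : moves.length ≤ E) :
    Tri S B (.repeat 23 moveCmd) s (moves.length * (moveTime n G + 2) + 3) fun s' =>
      RunState L G E inp (moves.flatMap Move.micros) [] s' := by
  obtain ⟨b1, b2, b3⟩ := hP.girth_le
  refine Tri.repeat (m := moves.length) (t := moveTime n G) hP.one_le (by omega) (fun j s' =>
    ∃ done todo, moves = done ++ todo ∧ todo.length = j ∧
      RunState L G E inp (done.flatMap Move.micros) (todo.flatMap Move.micros) s' ∧
      s'.reg 22 = (a + (done.flatMap Move.encode).length : ℕ) ∧ s'.reg 23 = j) ?_ ?_ ?_ ?_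
  · rintro j s1 ⟨_, _, _, _, _, _, k⟩
    exact k
  · exact ⟨[], moves, rfl, rfl, by simpa using h.set 1 (by decide), by simpa using ha, by simpa using hk⟩
  · rintro j s1 hj ⟨done, todo, e, hl, k1, k3, k4⟩
    cases todo with
    | nil => simp at hl
    | cons mv todo =>
      rw [e, List.flatMap_append, List.flatMap_cons] at hat haE
      have hat' := hat.append.2.append.1
      simp only [List.length_append] at haE
      rw [List.flatMap_cons] at k1
      refine Tri.imp (k1.tri_move hP k3 hat' (hG mv (by simp [e])) (hq mv (by simp [e])) (by omega)) ?_
      rintro s2 - ⟨l1, l2, l3⟩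
      refine ⟨l3.trans k4, l1.consts.1, done ++ [mv], todo, by simp [e], by simpa using hl, ?_, ?_, by simp⟩
      · simpa using l1.set j (i := 23) (by decide)
      · rw [Store.reg_set, Function.update_of_ne (by decide), l2]
        simp [add_assoc]
  · rintro s1 ⟨done, todo, e, hl, k1, k3, k4⟩
    obtain rfl := List.length_eq_zero_iff.1 hl
    rw [List.append_nil] at e
    subst e
    simpa using k1

theorem eq_sum_of_suppIn {h : ℕ} {f : LP} (hf : SuppIn h f) :
    f = ∑ i ∈ Finset.range (2 * h), LaurentPolynomial.C (f.coeff ((i : ℤ) - h)) * T (-h + i) := by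
  have key : ∀ e : ℤ, f.coeff e = ∑ i ∈ Finset.range (2 * h),
      if -(h : ℤ) + i = e then f.coeff ((i : ℤ) - h) else 0 := by
    intro e
    by_cases he : e < -h ∨ (h : ℤ) ≤ e
    · rw [hf e he, Finset.sum_eq_zero]
      intro i hi
      rw [Finset.mem_range] at hi
      rw [if_neg (by omega)]
    · obtain ⟨i, hi⟩ := Int.eq_ofNat_of_zero_le (a := e + h) (by omega)
      rw [Finset.sum_eq_single i]
      · rw [if_pos (by omega)]; congr 1; omega
      · intro j _ hj; rw [if_neg (by omega)]
      · intro hi'; rw [Finset.mem_range] at hi'; omega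
  have hsum : ∀ (P : Finset ℕ) (g : ℕ → LP) (e : ℤ), (∑ i ∈ P, g i).coeff e = ∑ i ∈ P, (g i).coeff e := by
    intro P g e
    classical
    induction P using Finset.induction with
    | empty => rfl
    | insert i P hi ih => rw [Finset.sum_insert hi, Finset.sum_insert hi, coeff_add', ih]
  ext e
  rw [hsum, key]
  refine Finset.sum_congr rfl fun i _ => ?_
  rw [coeff_C_mul, LaurentPolynomial.T_apply]
  split_ifs <;> simp

theorem RunState.tri_output (h : RunState L G E inp ms [] s) (hP : Params n G E S B M inp)
    (hE : 0 < E) (hn : inp 0 = n) {k : ℕ} :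
    Tri S B outputCmd s 9 fun s' => (s'.at k).Holds S L.bracket := by
  obtain ⟨b1, b2, b3⟩ := hP.girth_le
  have hsp := hP.space
  have hle := hP.le
  have hg := hP.girth
  obtain ⟨T₁, T₂, h1, h2, h3, h4, b, h5⟩ := h.run
  cases h2
  have hbr := runOp_bracket h1 (by simpa using h.perm) h3
  have hb := bdd_runOp h1 (.nil _) h.perm h3 (a := []) (by simp [h3.1])
  have hl : T₁.boundary.length = 0 := by simp [h3.1]
  rw [hbr, hl, add_zero] at hb
  rw [hl] at h5
  obtain ⟨⟨c3, c30, c7, c6⟩, r4, -, -, htab, -, -⟩ := h5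
  have hbb : b.toNat * (4 * (32 * n)) ≤ 4 * (32 * n) := by cases b <;> simp
  refine Tri.le (Tri.load (x := 0) (by simpa using c30) (by omega) (Tri.add (x := n) (y := n) ?_ ?_ ?_
    (Tri.add (x := n + n) (y := n + n) (by simp) (by simp) ?_
    (Tri.add (x := n + n + (n + n)) (y := n + n + (n + n)) (by simp) (by simp) ?_
    (Tri.add (x := n + n + (n + n) + (n + n + (n + n))) (y := n + n + (n + n) + (n + n + (n + n))) (by simp) (by simp) ?_
    (Tri.add (x := 16 * n) (y := 16 * n) ?_ ?_ ?_
    (Tri.sub (x := 0) (y := 32 * n) ?_ ?_ ?_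
    (Tri.add (x := (2 * (32 * n) : ℕ)) (y := 0) (by simpa using c7) (by simpa using c30) ?_
    (Tri.add (x := (E + b.toNat * (4 * (32 * n)) + 32 * n : ℕ)) (y := 0) (by simpa using r4) (by simpa using c30) ?_
    (Tri.nil ?_)))))))))) le_rfl
  · simpa [h.inp 0 hE] using hn
  · simpa [h.inp 0 hE] using hn
  · rw [abs_le]; constructor <;> omega
  · rw [abs_le]; constructor <;> omega
  · rw [abs_le]; constructor <;> omega
  · rw [abs_le]; constructor <;> omega
  · simp; ring
  · simp; ring
  · rw [abs_le]; constructor <;> omega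
  · simpa using c30
  · simp; ring
  · rw [abs_le]; constructor <;> omega
  · rw [abs_le]; constructor <;> omega
  · rw [abs_le]; constructor <;> omega
  · have hsupp : SuppIn (32 * n) L.bracket := by
      intro e he
      refine (hb.2 e).2 ?_
      rw [lt_abs]
      push_cast at he ⊢
      omega
    refine ⟨?_, ?_, ?_, ?_⟩
    · simp [Store.at]
    · simp only [Store.at, Store.reg_set]
      rw [Function.update_self]
      omega
    · simp only [Store.at, Store.reg_set]
      rw [Function.update_self, Function.update_of_ne (by decide), Function.update_self]
      omega
    · conv_lhs => rw [eq_sum_of_suppIn hsupp]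
      simp only [Store.at, Store.reg_set, Store.mem_set]
      rw [Function.update_self, Function.update_of_ne (by decide), Function.update_self,
        Function.update_of_ne (by decide), Function.update_of_ne (by decide), Function.update_self,
        add_zero, add_zero, Int.toNat_natCast, Int.toNat_natCast]
      refine Finset.sum_congr rfl fun i hi => ?_
      rw [Finset.mem_range] at hi
      have := htab 0 (32 * n + i) (by omega)
      rw [vec_of_lt _ (by simp), show bits 0 0 = [] from rfl, hbr] at this
      have e : cell E (32 * n) (2 * 0 + b.toNat) (32 * n + i) =
          E + b.toNat * (4 * (32 * n)) + 32 * n + i := by unfold cell; ring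
      rw [e] at this
      rw [this]
      push_cast
      congr 2 <;> ring_nf

end main

/-! ### The initial table -/

section main

variable {n G E S N : ℕ} {B M : ℤ} {inp : ℕ → ℤ} {L : LinkDiagram n}

theorem tri_init {ms : List (Micro n)} {T : Tangle n} (hP : Params n G E S B M inp)
    (hrun : MRun G ms (Tangle.empty n) T) (hT : T.Presents L)
    (hperm : (ms.filterMap Micro.crossing?).Perm (List.finRange n))
    (h0 : inp 0 = n) (hN : inp (4 * n + 1) = N) (hE : E = 4 * n + 2 + 9 * N)
    (hz : ∀ x, E ≤ x → inp x = 0) :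
    Tri S B initCmd ⟨fun _ => 0, inp⟩ 22 fun s =>
      RunState L G E inp [] ms s ∧ s.reg 22 = (4 * n + 2 : ℕ) ∧ s.reg 23 = N := by
  obtain ⟨b1, b2, b3⟩ := hP.girth_le
  have hsp := hP.space
  have hle := hP.le
  have hB := hP.one_le
  have hpos := hP.pos
  have h8 : 8 * (32 * n) ≤ 32 * (2 ^ G + 1) * (8 * (32 * n)) := Nat.le_mul_of_pos_left _ (by positivity)
  have hb : ∀ z : ℤ, 0 ≤ z → z ≤ S → |z| ≤ B := fun z h1 h2 => by rw [abs_le]; constructor <;> omega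
  refine Tri.le (Tri.const (by simpa using hB) (Tri.load (x := 0) (by simp) (by omega)
    (Tri.add (x := n) (y := n) (by simpa using h0) (by simpa using h0) (hb _ (by omega) (by omega))
    (Tri.add (x := n + n) (y := n + n) (by simp) (by simp) (hb _ (by omega) (by omega))
    (Tri.add (x := n + n + (n + n)) (y := 1) (by simp) (by simp) (hb _ (by omega) (by omega))
    (Tri.load (x := 4 * n + 1) (by simp; ring) (by omega)
    (Tri.add (x := n + n + (n + n) + 1) (y := 1) (by simp) (by simp) (hb _ (by omega) (by omega))
    (Tri.add (x := N) (y := N) (by simpa using hN) (by simpa using hN) (hb _ (by omega) (by omega))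
    (Tri.add (x := N + N) (y := N + N) (by simp) (by simp) (hb _ (by omega) (by omega))
    (Tri.add (x := N + N + (N + N)) (y := N + N + (N + N)) (by simp) (by simp) (hb _ (by omega) (by omega))
    (Tri.add (x := N + N + (N + N) + (N + N + (N + N))) (y := N) (by simp) (by simpa using hN) (hb _ (by omega) (by omega))
    (Tri.add (x := N + N + (N + N) + (N + N + (N + N)) + N) (y := n + n + (n + n) + 1 + 1) (by simp) (by simp) (hb _ (by omega) (by omega))
    (Tri.add (x := n + n + (n + n)) (y := n + n + (n + n)) (by simp) (by simp) (hb _ (by omega) (by omega))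
    (Tri.add (x := 8 * n) (y := 8 * n) (by simp; ring) (by simp; ring) (hb _ (by omega) (by omega))
    (Tri.add (x := 16 * n) (y := 16 * n) (by simp; ring) (by simp; ring) (hb _ (by omega) (by omega))
    (Tri.add (x := E) (y := 32 * n) (by simp [hE]; ring) (by simp; ring) (hb _ (by omega) (by omega))
    (Tri.add (x := 32 * n) (y := 32 * n) (by simp; ring) (by simp; ring) (hb _ (by omega) (by omega))
    (Tri.add (x := 64 * n) (y := 64 * n) (by simp; ring) (by simp; ring) (hb _ (by omega) (by omega))
    (Tri.add (x := E + 32 * n) (y := 128 * n) (by simp) (by simp; ring) (hb _ (by omega) (by omega))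
    (Tri.add (x := 128 * n) (y := 128 * n) (by simp; ring) (by simp; ring) (hb _ (by omega) (by omega))
    (Tri.add (x := E + 32 * n) (y := 32 * n) (by simp) (by simp; ring) (hb _ (by omega) (by omega))
    (Tri.cons ⟨?_, ?_⟩ (Tri.nil ?_)))))))))))))))))))))) ) le_rfl
  · simp; omega
  · simp; omega
  set s1 : Store := Store.set _ 1 ((E : ℤ) + 32 * n + 32 * n) with hs1
  have r1 : s1.reg 1 = (E + 64 * n : ℕ) := by simp [hs1]; ring
  have r3 : s1.reg 3 = 1 := by simp [hs1]
  have hmem : ((Instr.store 1 3).act s1).mem = Function.update inp (E + 64 * n) 1 := by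
    simp only [Instr.act]
    rw [r1, r3, Int.toNat_natCast]
    simp [hs1]
  have hreg : ((Instr.store 1 3).act s1).reg = s1.reg := rfl
  refine ⟨⟨by simpa using hperm, ⟨Tangle.empty n, T, .nil _, hrun, hT, by simp [Tangle.empty], false,
    ⟨⟨?_, ?_, ?_, ?_⟩, ?_, ?_, ?_, ?_, ?_, ?_⟩⟩, ?_⟩, ?_, ?_⟩
  · rw [hreg, r3]
  · rw [hreg]; simp [hs1]
  · rw [hreg]; simp [hs1]; ring
  · rw [hreg]; simp [hs1]; ring
  · rw [hreg]; simp [hs1]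
  · rw [hreg]; simp [hs1]; ring
  · rw [hreg]; simp [hs1, Tangle.empty]
  · intro x i hi
    rw [hmem]
    simp only [Tangle.empty, List.length_nil]
    by_cases hx : x = 0
    · subst hx
      rw [vec_of_lt _ (by simp)]
      have e : runOp braW ([] : List (Micro n)) spinOne (bits 0 0) = 1 := by
        simp only [runOp, List.foldl_nil, spinOne]
      rw [e, ← LaurentPolynomial.T_zero, LaurentPolynomial.T_apply, Function.update_apply]
      have ec : cell E (32 * n) (2 * 0 + false.toNat) i = E + i := by simp [cell]
      rw [ec]
      -- The exponent 0 sits at position 2 h = 64 n of a row.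
      by_cases hi2 : i = 64 * n
      · rw [if_pos (by omega), if_pos (by omega)]
      · rw [if_neg (by omega), if_neg (by omega), hz _ (by omega)]
    · rw [vec_of_le _ (by simp; omega), Function.update_of_ne, hz _ (by unfold cell; omega)]
      · rfl
      · intro he
        have : cell E (32 * n) (2 * x + false.toNat) i = cell E (32 * n) 0 (64 * n) := by
          rw [he]; simp [cell]
        have := (cell_inj hi (by omega) this).1
        simp at this
        exact hx this
  · intro x i hi
    rw [hmem, Function.update_of_ne, hz _ (by unfold cell; omega)]
    · rfl
    · intro he
      have : cell E (32 * n) (2 * x + (!false).toNat) i = cell E (32 * n) 0 (64 * n) := by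
        rw [he]; simp [cell]
      have := (cell_inj hi (by omega) this).1
      simp at this
  · intro x hx
    rw [vec_of_le _ hx]
  · intro x hx
    rw [hmem, Function.update_of_ne (by omega)]
  · rw [hreg]; simp [hs1]; ring
  · rw [hreg]; simpa [hs1] using hN

end main

/-! ### Resource bounds for the whole program -/

section main

variable {n g : ℕ} {L : LinkDiagram n}

/-- A polynomial bound for the factor of `2 ^ g` in the time of an elementary step. -/
def stepPoly (n g : ℕ) : ℕ := 25 * (16 * (512 * n + 10) + 80) + 4 * (g + 4)

def capPoly (n g : ℕ) : ℕ := (g + 5) * (stepPoly n g + 2) + 7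

def movePoly (n g : ℕ) : ℕ :=
  2 * ((g + 4) * (stepPoly n g + 2) + 3) + 3 * stepPoly n g + 4 * (capPoly n g + 2) + 60

/-- The four additional boundary points inside a crossing step cost only the constant factor 16. -/
theorem stepTime_le (n g : ℕ) : stepTime n (g + 4) ≤ 2 ^ g * stepPoly n g := by
  have h1 : 1 ≤ 2 ^ g := Nat.one_le_two_pow
  have h2 : 1 * (4 * (g + 4) + 25 * 80) ≤ 2 ^ g * (4 * (g + 4) + 25 * 80) := Nat.mul_le_mul_right _ h1
  have e : (2 : ℕ) ^ (g + 4) = 2 ^ g * 16 := by rw [pow_add]; norm_num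
  unfold stepTime stepPoly
  rw [e]
  nlinarith

theorem mul_two_pow_le {g a b : ℕ} (h : a ≤ 2 ^ g * b) (k : ℕ) : a + k ≤ 2 ^ g * (b + k) := by
  have h1 : 1 * k ≤ 2 ^ g * k := Nat.mul_le_mul_right _ Nat.one_le_two_pow
  rw [Nat.mul_add]; omega

theorem mul_le_two_pow {g a b : ℕ} (h : a ≤ 2 ^ g * b) (k : ℕ) : k * a ≤ 2 ^ g * (k * b) := by
  rw [Nat.mul_left_comm]; exact Nat.mul_le_mul_left _ h

theorem add_le_two_pow {g a b c d : ℕ} (h : a ≤ 2 ^ g * b) (h' : c ≤ 2 ^ g * d) :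
    a + c ≤ 2 ^ g * (b + d) := by
  rw [Nat.mul_add]; omega

theorem capTime_le (n g : ℕ) : capTime n (g + 4) ≤ 2 ^ g * capPoly n g :=
  mul_two_pow_le (mul_le_two_pow (mul_two_pow_le (stepTime_le n g) 2) _) 7

theorem moveTime_le (n g : ℕ) : moveTime n (g + 4) ≤ 2 ^ g * movePoly n g :=
  mul_two_pow_le (add_le_two_pow (add_le_two_pow (mul_le_two_pow (mul_two_pow_le (mul_le_two_pow
    (mul_two_pow_le (stepTime_le n g) 2) _) 3) 2) (mul_le_two_pow (stepTime_le n g) 3))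
    (mul_le_two_pow (mul_two_pow_le (capTime_le n g) 2) 4)) 60

open MvPolynomial in
/-- A polynomial bound for the time of the whole program, divided by `2 ^ g`. -/
def timePoly : MvPolynomial (Fin 2) ℕ :=
  let s : MvPolynomial (Fin 2) ℕ := 25 * (16 * (512 * X 0 + 10) + 80) + 4 * (X 1 + 4)
  let c : MvPolynomial (Fin 2) ℕ := (X 1 + 5) * (s + 2) + 7
  let m : MvPolynomial (Fin 2) ℕ := 2 * ((X 1 + 4) * (s + 2) + 3) + 3 * s + 4 * (c + 2) + 60
  X 0 * (X 1 + 1) * (m + 2) + 34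

theorem eval_timePoly (n g : ℕ) :
    MvPolynomial.eval ![n, g] timePoly = n * (g + 1) * (movePoly n g + 2) + 34 := by
  simp [timePoly, movePoly, capPoly, stepPoly]

/-- The bound `g ≤ 2 * n + 2` makes 9 n + (g + 4) smaller than 32 n, so that the rows are long
enough. Nine cells of input are reserved for each step, by `length_encode_le`. -/
theorem computes_bracket (hn : 1 ≤ n) (c : L.Cutting) (hg : c.girth = g) (hg2 : g ≤ 2 * n + 2)
    (hN : c.moves.length ≤ n * (g + 1)) :
    Computes (bracketCmd.compile 0) (L.encode ++ c.encode) L.bracket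
      (2 ^ g * MvPolynomial.eval ![n, g] timePoly) (150000 * (n * 2 ^ g)) (150000 * (n + g)) := by
  obtain ⟨T, hT, hpres⟩ := c.presents
  have hgl := c.girthLe
  rw [hg] at hgl
  obtain ⟨hrun, hsmall⟩ := hgl.mrun hT
  have hfew : ∀ mv ∈ c.moves, mv.FewJoins := fewJoins_of_foldlM (A := []) hT
    (by intro x hx; simp [Tangle.empty] at hx) (by
      rw [List.nil_append]
      exact c.crossings.nodup_iff.2 (List.nodup_finRange n))
  have hlen := length_flatMap_encode_le hfew
  set N := c.moves.length with hNdef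
  set E := 4 * n + 2 + 9 * N with hE
  set inp : ℕ → ℤ := fun i => (L.encode ++ c.encode).getD i 0 with hinp
  have hleninp : (L.encode ++ c.encode).length ≤ E := by
    rw [List.length_append, length_encode, LinkDiagram.Cutting.encode, List.length_cons]
    omega
  have hat : At inp 0 (L.encode ++ c.encode) := at_of_eq fun i hi => by
    rw [zero_add]
    exact List.getD_eq_getElem _ _ hi
  obtain ⟨hat1, hat2⟩ := hat.append
  rw [length_encode, zero_add] at hat2
  have hgpow : g + 1 ≤ 2 ^ g := Nat.lt_two_pow_self
  have hnpow : n < 2 ^ n := Nat.lt_two_pow_self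
  have hNle : N ≤ n * 2 ^ g := hN.trans (Nat.mul_le_mul_left _ hgpow)
  have h2g : 1 ≤ 2 ^ g := Nat.one_le_two_pow
  have hn2g : n ≤ n * 2 ^ g := Nat.le_mul_of_pos_right _ h2g
  have hn2g' : 1 * 2 ^ g ≤ n * 2 ^ g := Nat.mul_le_mul_right _ hn
  have hpowng : n * 2 ^ g ≤ 2 ^ (n + g) := by
    rw [pow_add]; exact Nat.mul_le_mul_right _ hnpow.le
  have hbound : ∀ z ∈ L.encode ++ c.encode, |z| ≤ (20 * (n * 2 ^ g) : ℕ) := by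
    intro z hz
    rcases List.mem_append.1 hz with hz | hz
    · have := abs_encode_le L z hz
      omega
    · rcases List.mem_cons.1 hz with rfl | hz
      · rw [Nat.abs_cast]; omega
      · obtain ⟨mv, hmv, hz⟩ := List.mem_flatMap.1 hz
        have := abs_move_encode_le (hsmall mv hmv) (hfew mv hmv) z hz
        push_cast at this
        omega
  -- `M` bounds the coefficients of the states as well as the integers of the input.
  set M : ℤ := ((2 ^ (5 * n) + 20 * (n * 2 ^ g) : ℕ) : ℤ) with hM
  have hbits : 2 ^ (30 * (n + g)) ≤ 2 ^ (150000 * (n + g)) := Nat.pow_le_pow_right (by omega) (by omega)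
  have e30 : 2 ^ (30 * (n + g)) = 2 ^ (18 * (n + g)) * 2 ^ (6 * (n + g)) * 2 ^ (6 * (n + g)) := by
    rw [← pow_add, ← pow_add]; congr 1; omega
  have k18 : 2 ^ 18 ≤ 2 ^ (18 * (n + g)) := Nat.pow_le_pow_right (by omega) (by omega)
  have k6 : 2 ^ (n + g) ≤ 2 ^ (6 * (n + g)) := Nat.pow_le_pow_right (by omega) (by omega)
  have k5 : 2 ^ (5 * n) ≤ 2 ^ (6 * (n + g)) := Nat.pow_le_pow_right (by omega) (by omega)
  have k1 : 1 ≤ 2 ^ (6 * (n + g)) := Nat.one_le_two_pow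
  have kk : 2 ^ 18 * 2 ^ (6 * (n + g)) ≤ 2 ^ (150000 * (n + g)) := by
    refine le_trans ?_ hbits
    rw [e30]
    calc 2 ^ 18 * 2 ^ (6 * (n + g)) ≤ 2 ^ (18 * (n + g)) * 2 ^ (6 * (n + g)) := Nat.mul_le_mul_right _ k18
      _ ≤ _ := Nat.le_mul_of_pos_right _ k1
  have hS : 150000 * (n * 2 ^ g) ≤ 2 ^ (150000 * (n + g)) := by
    norm_num at kk
    omega
  have hP : Params n (g + 4) E (150000 * (n * 2 ^ g)) (2 ^ (150000 * (n + g))) M inp := by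
    refine ⟨hn, by omega, ?_, ?_, ?_, ?_, ?_⟩
    -- The main part of the memory is 32 · 16 · 8 · 32 = 131072 times n 2^g; the constant 150000
    -- leaves room for everything else.
    · have e : 32 * (2 ^ (g + 4) + 1) * (8 * (32 * n)) = 131072 * (n * 2 ^ g) + 8192 * n := by
        rw [pow_add]; ring
      omega
    · exact_mod_cast hS
    · have : 2 ^ (5 * n) ≤ 2 ^ (5 * n) + 20 * (n * 2 ^ g) := Nat.le_add_right _ _
      rw [hM]
      exact_mod_cast this
    · rw [hM]
      norm_num at kk
      have : 2 * (2 ^ 8 * (2 ^ (5 * n) + 20 * (n * 2 ^ g))) ≤ 2 ^ (150000 * (n + g)) := by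
        norm_num
        omega
      exact_mod_cast this
    · intro x _
      have h0 : (0 : ℤ) ≤ M := by positivity
      by_cases hx : x < (L.encode ++ c.encode).length
      · have := hbound _ (List.getElem_mem hx)
        simp only [hinp, List.getD, List.getElem?_eq_getElem hx, Option.getD_some]
        rw [hM]; push_cast at this ⊢
        have h5 : (0 : ℤ) ≤ 2 ^ (5 * n) := by positivity
        linarith
      · simp only [hinp, List.getD, List.getElem?_eq_none (not_lt.1 hx), Option.getD_none, abs_zero]
        exact h0
  refine Tri.computes (by omega) (fun z hz => (hbound z hz).trans ?_) ?_
  · have : 20 * (n * 2 ^ g) ≤ 2 ^ (150000 * (n + g)) := by omega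
    exact_mod_cast this
  have hperm : ((c.moves.flatMap Move.micros).filterMap Micro.crossing?).Perm (List.finRange n) := by
    rw [filterMap_flatMap_micros]; exact c.crossings
  refine Tri.le (Tri.seq (t := 22) (t' := (N * (moveTime n (g + 4) + 2) + 3) + 9)
    (Tri.imp (tri_init (N := N) hP hrun hpres hperm hat1.1 hat2.1 hE fun x hx => by
      exact List.getD_eq_default _ _ (by omega)) ?_)) ?_
  · rintro s1 - ⟨h1, h2, h3⟩
    refine Tri.seq (Tri.imp (h1.tri_moves hP h2 h3 hat2.2 hsmall hfew (by omega) (by omega)) ?_)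
    rintro s2 - h4
    exact h4.tri_output hP (by omega) hat1.1
  -- The summand 34 is 22 for the initialization, 3 for the loop over the steps and 9 for the
  -- output.
  · rw [eval_timePoly]
    have h1 := mul_two_pow_le (mul_le_two_pow (mul_two_pow_le (moveTime_le n g) 2) N) 34
    refine le_trans (by omega) (h1.trans (Nat.mul_le_mul_left _ (Nat.add_le_add_right
      (Nat.mul_le_mul_right _ hN) _)))

end main

/-! ## Sequences of moves of bounded girth -/

section runs

variable {n g : ℕ} {T T' T'' : Tangle n} {l l' : List (Move n)}

/-- The moves `l` lead from `T` to `T'`, with at most `g` boundary points at any time. -/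
def Run (g : ℕ) (l : List (Move n)) (T T' : Tangle n) : Prop :=
  l.foldlM Move.apply T = some T' ∧ GirthLe g l T

theorem Run.nil (h : T.boundary.length ≤ g) : Run g [] T T := ⟨rfl, h⟩

theorem Run.single {mv : Move n} (h : mv.apply T = some T') (hT : T.boundary.length ≤ g)
    (hT' : T'.boundary.length ≤ g) : Run g [mv] T T' := by
  refine ⟨by simp [h], hT, fun T1 h1 => ?_⟩
  rw [h, Option.mem_some_iff] at h1
  subst h1; exact hT'

theorem Run.append (h : Run g l T T') (h' : Run g l' T' T'') : Run g (l ++ l') T T'' := by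
  induction l generalizing T with
  | nil =>
    have : T = T' := by simpa using h.1
    subst this; exact h'
  | cons mv l ih =>
    obtain ⟨h1, h2, h3⟩ := h
    rw [List.foldlM_cons, Option.bind_eq_bind, Option.bind_eq_some_iff] at h1
    obtain ⟨T1, h4, h5⟩ := h1
    obtain ⟨k1, k2⟩ := ih ⟨h5, h3 T1 h4⟩
    refine ⟨?_, h2, fun T2 hT2 => ?_⟩
    · rw [List.cons_append, List.foldlM_cons, Option.bind_eq_bind, Option.bind_eq_some_iff]
      exact ⟨T1, h4, k1⟩
    · rw [h4, Option.mem_some_iff] at hT2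
      subst hT2; exact k2

theorem Run.head (h : Run g l T T') : T.boundary.length ≤ g := h.2.head

theorem Run.last (h : Run g l T T') : T'.boundary.length ≤ g := by
  induction l generalizing T with
  | nil =>
    have : T = T' := by simpa using h.1
    subst this; exact h.2
  | cons mv l ih =>
    obtain ⟨h1, h2, h3⟩ := h
    rw [List.foldlM_cons, Option.bind_eq_bind, Option.bind_eq_some_iff] at h1
    obtain ⟨T1, h4, h5⟩ := h1
    exact ih ⟨h5, h3 T1 h4⟩

theorem GirthLe.take (h : GirthLe g l T) (i : ℕ) (hT : (l.take i).foldlM Move.apply T = some T') :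
    T'.boundary.length ≤ g := by
  induction l generalizing T i with
  | nil =>
    have : T = T' := by simpa using hT
    subst this; exact h
  | cons mv l ih =>
    cases i with
    | zero =>
      have : T = T' := by simpa using hT
      subst this; exact h.1
    | succ i =>
      rw [List.take_succ_cons, List.foldlM_cons, Option.bind_eq_bind, Option.bind_eq_some_iff] at hT
      obtain ⟨T1, h4, h5⟩ := hT
      exact ih (h.2 T1 h4) i h5

/-- A cutting from a sequence of moves. -/
theorem exists_cutting {L : LinkDiagram n} (h : Run g l (Tangle.empty n) T) (hT : T.Presents L)
    (hl : (l.filterMap Move.crossing?).Perm (List.finRange n)) :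
    ∃ c : L.Cutting, c.moves = l ∧ c.girth ≤ g := by
  refine ⟨⟨l, hl, T, h.1, hT⟩, rfl, Finset.sup_le fun i _ => ?_⟩
  rcases hb : build (l.take i) with _ | T1
  · simp
  · simpa using h.2.take i hb

theorem close_of_isRotated {ok : StrandEnd n → StrandEnd n → Bool} {x y : StrandEnd n}
    {rest : List (StrandEnd n)} (h : T.boundary.IsRotated (x :: y :: rest)) (hok : ok x y = true) :
    ∃ q, T.close ok q = some ⟨rest, (x, y) :: T.joins, T.cups⟩ := by
  obtain ⟨q, hq⟩ := h
  have hl : 0 < T.boundary.length := by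
    have := congrArg List.length hq
    simp at this; omega
  refine ⟨q % T.boundary.length, ?_⟩
  rw [Tangle.close, if_pos (Nat.mod_lt _ hl), List.rotate_mod, hq]
  simp [hok]

end runs

/-! ## Existence of cuttings -/

section existence

variable {n : ℕ} {L : LinkDiagram n}

/-- Two half-edges belong to the same face. -/
def LinkDiagram.Face (L : LinkDiagram n) : Dart n → Dart n → Prop :=
  Relation.EqvGen fun d e => e = rot (L.link d)

theorem LinkDiagram.face_equivalence (L : LinkDiagram n) : Equivalence L.Face :=
  Relation.EqvGen.is_equivalence _

theorem LinkDiagram.face_link (L : LinkDiagram n) (d : Dart n) : L.Face d (rot (L.link d)) :=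
  .rel _ _ rfl

theorem LinkDiagram.face_rot (L : LinkDiagram n) (d : Dart n) : L.Face (L.link d) (rot d) := by
  have := L.face_link (L.link d)
  rwa [L.link_link] at this

/-- The face of a half-edge. -/
def LinkDiagram.faceOf (L : LinkDiagram n) (d : Dart n) : Quot fun d e : Dart n => e = rot (L.link d) :=
  Quot.mk _ d

theorem LinkDiagram.faceOf_eq {d e : Dart n} : L.faceOf d = L.faceOf e ↔ L.Face d e := Quot.eq

/-- The half-edge `d` has been joined with its partner. -/
def Joined (L : LinkDiagram n) (T : Tangle n) (d : Dart n) : Prop :=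
  (.dart d, .dart (L.link d)) ∈ T.joins ∨ (.dart (L.link d), .dart d) ∈ T.joins

/-- The tangle `T` consists of the crossings in `A` and of some of the edges between them,
and its boundary points are `b`. -/
structure Partial (L : LinkDiagram n) (T : Tangle n) (A : List (Fin n)) (b : List (Dart n)) : Prop where
  bdry : T.boundary.IsRotated (b.map .dart)
  cups : T.cups = 0
  joins : ∀ p ∈ T.joins, ∃ d : Dart n, p = (.dart d, .dart (L.link d)) ∧ d.1 ∈ A ∧ (L.link d).1 ∈ A
  nodup : b.Nodup
  mem : ∀ d, d ∈ b ↔ d.1 ∈ A ∧ ¬ Joined L T d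
  -- A half-edge stands for the corner on its clockwise side. The corner behind `x` and the corner
  -- in front of the next boundary point `y` belong to the same face, since nothing of the tangle
  -- leaves the disk between them.
  chain : Cycle.Chain (fun x y => L.Face (rot x) y) (b : Cycle (Dart n))

theorem Partial.rotate {T : Tangle n} {A : List (Fin n)} {b b' : List (Dart n)} (h : Partial L T A b)
    (hb : b.IsRotated b') : Partial L T A b' := by
  obtain ⟨h1, h2, h3, h4, h5, h6⟩ := h
  refine ⟨h1.trans (hb.map _), h2, h3, hb.nodup_iff.1 h4, fun d => by rw [← hb.mem_iff, h5], ?_⟩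
  rwa [Cycle.coe_eq_coe.2 hb] at h6

theorem Partial.mem_of_joined {T : Tangle n} {A : List (Fin n)} {b : List (Dart n)}
    (h : Partial L T A b) {d : Dart n} (hd : Joined L T d) : d.1 ∈ A := by
  rcases hd with hd | hd
  · obtain ⟨d', he, h1, h2⟩ := h.joins _ hd
    simp only [Prod.mk.injEq, StrandEnd.dart.injEq] at he
    rw [he.1]; exact h1
  · obtain ⟨d', he, h1, h2⟩ := h.joins _ hd
    simp only [Prod.mk.injEq, StrandEnd.dart.injEq] at he
    rw [he.2]; exact h2

theorem joined_link {T : Tangle n} {d : Dart n} : Joined L T (L.link d) ↔ Joined L T d := by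
  simp only [Joined, L.link_link]; exact or_comm

theorem joined_cons {T : Tangle n} {b : List (StrandEnd n)} {k : ℕ} {d x : Dart n} :
    Joined L ⟨b, (.dart d, .dart (L.link d)) :: T.joins, k⟩ x ↔
      Joined L T x ∨ x = d ∨ x = L.link d := by
  have h1 : L.link x = d ↔ x = L.link d :=
    ⟨fun h => by rw [← h, L.link_link], fun h => by rw [h, L.link_link]⟩
  simp only [Joined, List.mem_cons, Prod.mk.injEq, StrandEnd.dart.injEq]
  constructor
  · rintro ((⟨h, -⟩ | h) | (⟨-, h⟩ | h))
    · exact Or.inr (Or.inl h)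
    · exact Or.inl (Or.inl h)
    · exact Or.inr (Or.inr h)
    · exact Or.inl (Or.inr h)
  · rintro ((h | h) | rfl | h)
    · exact Or.inl (Or.inr h)
    · exact Or.inr (Or.inr h)
    · exact Or.inl (Or.inl ⟨rfl, rfl⟩)
    · exact Or.inr (Or.inl ⟨h1.2 h, h⟩)

theorem Partial.presents {T : Tangle n} {A : List (Fin n)} (h : Partial L T A [])
    (hA : ∀ c, c ∈ A) : T.Presents L := by
  obtain ⟨h1, h2, h3, h4, h5, h6⟩ := h
  have hb : T.boundary = [] := by simpa using h1
  refine ⟨hb, fun d e => ⟨fun hde => ?_, ?_⟩, fun k hk => by omega⟩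
  · have key : ∀ x y, T.SameEdge x y → x = y ∨ ∃ d, x = .dart d ∧ y = .dart (L.link d) := by
      intro x y hxy
      induction hxy with
      | rel x y hxy =>
        rcases hxy with hxy | ⟨k, hk, -⟩
        · obtain ⟨d', he, -, -⟩ := h3 _ hxy
          simp only [Prod.mk.injEq] at he
          exact Or.inr ⟨d', he⟩
        · omega
      | refl x => exact Or.inl rfl
      | symm x y _ ih =>
        rcases ih with rfl | ⟨d, rfl, rfl⟩
        · exact Or.inl rfl
        · exact Or.inr ⟨L.link d, rfl, by rw [L.link_link]⟩
      | trans x y z _ _ ih ih' =>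
        rcases ih with rfl | ⟨d, rfl, rfl⟩
        · exact ih'
        · rcases ih' with rfl | ⟨d', hd, rfl⟩
          · exact Or.inr ⟨d, rfl, rfl⟩
          · simp only [StrandEnd.dart.injEq] at hd
            rw [← hd, L.link_link]; exact Or.inl rfl
    rcases key _ _ hde with h | ⟨d', h, h'⟩
    · exact Or.inl (by simpa using h.symm)
    · simp only [StrandEnd.dart.injEq] at h h'
      exact Or.inr (by rw [h', h])
  · rintro (rfl | rfl)
    · exact .refl _
    · have : Joined L T d := by
        by_contra hd
        have := (h5 d).2 ⟨hA _, hd⟩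
        simp at this
      rcases this with hd | hd
      · exact .rel _ _ (Or.inl hd)
      · exact .symm _ _ (.rel _ _ (Or.inl hd))

/-- Joining the neighbours `z` and `L.link z` merges the gaps on their two sides. Both gaps belong
to the face on the outer side of this edge, so the chain of faces persists. -/
theorem Partial.cap {T : Tangle n} {A : List (Fin n)} {b : List (Dart n)} {z : Dart n}
    (h : Partial L T A (z :: L.link z :: b)) : ∃ q T', Move.apply T (.cap q) = some T' ∧
      Partial L T' A b ∧ T'.boundary.length = b.length := by
  obtain ⟨h1, h2, h3, h4, h5, h6⟩ := h
  obtain ⟨q, hq⟩ := close_of_isRotated (ok := fun _ _ => true) h1 rfl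
  refine ⟨q, _, hq, ⟨List.IsRotated.refl _, h2, ?_, ?_, ?_, ?_⟩, by simp⟩
  · intro p hp
    rcases List.mem_cons.1 hp with rfl | hp
    · exact ⟨z, rfl, ((h5 z).1 (by simp)).1, ((h5 (L.link z)).1 (by simp)).1⟩
    · exact h3 p hp
  · simp only [List.nodup_cons] at h4
    exact h4.2.2
  · intro d
    rw [joined_cons]
    simp only [List.nodup_cons, List.mem_cons, not_or] at h4
    have := h5 d
    simp only [List.mem_cons] at this
    constructor
    · intro hd
      refine ⟨(this.1 (Or.inr (Or.inr hd))).1, ?_⟩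
      rintro (hj | rfl | rfl)
      · exact (this.1 (Or.inr (Or.inr hd))).2 hj
      · exact h4.1.2 hd
      · exact h4.2.1 hd
    · rintro ⟨hA, hj⟩
      simp only [not_or] at hj
      rcases this.2 ⟨hA, hj.1⟩ with h | h | h
      · exact absurd h hj.2.1
      · exact absurd h hj.2.2
      · exact h
  · cases b with
    | nil => exact Cycle.Chain.nil _
    | cons w b =>
      rw [Cycle.chain_coe_cons] at h6 ⊢
      simp only [List.cons_append, List.isChain_cons_cons] at h6
      obtain ⟨-, h7, h8⟩ := h6
      rw [← List.cons_append, List.isChain_append] at h8 ⊢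
      refine ⟨h8.1, List.isChain_singleton _, fun x hx y hy => ?_⟩
      obtain rfl : w = y := by simpa using hy
      exact L.face_equivalence.trans (h8.2.2 x hx z (by simp))
        (L.face_equivalence.trans (L.face_link z) h7)

theorem exists_isRotated_cons {α : Type*} {b : List α} {z : α} (h : z ∈ b) :
    ∃ b', b.IsRotated (z :: b') := by
  obtain ⟨l₁, l₂, rfl⟩ := List.append_of_mem h
  exact ⟨l₂ ++ l₁, List.isRotated_append⟩

-- If 2 m boundary points meet at least m + 1 faces, some face contains only one of them, y. The
-- boundary point that follows `L.link y` lies in the face of y, hence is y itself; so `L.link y`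
-- and y are neighbours and can be joined. At most the face of y disappears from the boundary, and
-- the inequality remains true for m - 1.
open scoped Classical in
theorem Partial.exists_caps {A : List (Fin n)} {g : ℕ} (hA : ∀ c, c ∈ A) (m : ℕ) :
    ∀ (T : Tangle n) (b : List (Dart n)), b.length = 2 * m → Partial L T A b → b.length ≤ g →
      (0 < m → m + 1 ≤ (b.toFinset.image L.faceOf).card) →
      ∃ l T', Run g l T T' ∧ T'.Presents L ∧ l.filterMap Move.crossing? = [] := by
  induction m with
  | zero =>
    intro T b hb h hg _
    obtain rfl := List.length_eq_zero_iff.1 hb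
    have := h.bdry.perm.length_eq
    exact ⟨[], T, Run.nil (by simp at this; simp [this]), h.presents hA, rfl⟩
  | succ m ih =>
    intro T b hb h hg hF
    have hF := hF (by omega)
    obtain ⟨y, hy, hy'⟩ : ∃ y ∈ b, ∀ x ∈ b, L.Face y x → x = y := by
      by_contra! hne
      have := Finset.mul_card_image_le_card_of_maps_to (s := b.toFinset)
        (t := b.toFinset.image L.faceOf) (f := L.faceOf) (fun x hx => Finset.mem_image_of_mem _ hx) 2 (by
        intro F hF
        obtain ⟨y, hy, rfl⟩ := Finset.mem_image.1 hF
        obtain ⟨x, hx, hxy, hne⟩ := hne y (List.mem_toFinset.1 hy)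
        rw [← Finset.card_pair hne]
        refine Finset.card_le_card ?_
        intro u hu
        simp only [Finset.mem_insert, Finset.mem_singleton] at hu
        rw [Finset.mem_filter]
        rcases hu with rfl | rfl
        · exact ⟨List.mem_toFinset.2 hx, (L.faceOf_eq.2 hxy).symm⟩
        · exact ⟨hy, rfl⟩)
      have h2 := List.toFinset_card_le b
      omega
    have hz : L.link y ∈ b := (h.mem _).2 ⟨hA _, fun hj => ((h.mem y).1 hy).2 (joined_link.1 hj)⟩
    obtain ⟨b', hb'⟩ := exists_isRotated_cons hz
    have hl := hb'.perm.length_eq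
    have hp := h.rotate hb'
    cases b' with
    | nil => simp at hl; omega
    | cons w b' =>
      have hch := hp.chain
      rw [Cycle.chain_coe_cons, List.cons_append, List.isChain_cons_cons] at hch
      have hw : w = y := hy' w (hb'.mem_iff.2 (by simp))
        (L.face_equivalence.trans (L.face_link y) hch.1)
      have hp' := hp
      have hw2 : w = L.link (L.link y) := by rw [L.link_link, hw]
      rw [hw2] at hp'
      obtain ⟨q, T1, h1, h2, h3⟩ := hp'.cap
      simp only [List.length_cons] at hl
      have hT := h.bdry.perm.length_eq
      rw [List.length_map] at hT
      obtain ⟨l, T', k1, k2, k3⟩ := ih T1 b' (by omega) h2 (by omega) (by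
        intro hm
        have hsub : b.toFinset.image L.faceOf ⊆ insert (L.faceOf y) (b'.toFinset.image L.faceOf) := by
          intro F hF
          obtain ⟨x, hx, rfl⟩ := Finset.mem_image.1 hF
          rw [List.mem_toFinset, hb'.mem_iff] at hx
          rw [Finset.mem_insert, Finset.mem_image]
          simp only [List.mem_cons] at hx
          rcases hx with rfl | rfl | hx
          · cases b' with
            | nil => simp at hl; omega
            | cons v b' =>
              rw [List.cons_append, List.isChain_cons_cons] at hch
              refine Or.inr ⟨v, by simp, L.faceOf_eq.2 (L.face_equivalence.symm
                (L.face_equivalence.trans (L.face_rot y) ?_))⟩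
              rw [← hw]
              exact hch.2.1
          · rw [hw]; exact Or.inl rfl
          · exact Or.inr ⟨x, by simpa using hx, rfl⟩
        have := (Finset.card_le_card hsub).trans (Finset.card_insert_le _ _)
        omega)
      refine ⟨.cap q :: l, T', Run.append (Run.single h1 (by omega) (by omega)) k1, k2, ?_⟩
      simpa [Move.crossing?] using k3

end existence

/-! ### Growing a tangle along a spanning tree -/

section existence

variable {n : ℕ} {L : LinkDiagram n}

theorem rot_rot_rot_rot (d : Dart n) : rot (rot (rot (rot d))) = d := by
  have : ∀ j : Fin 4, j + 1 + 1 + 1 + 1 = j := by decide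
  exact Prod.ext rfl (this d.2)

theorem eq_of_fst_eq {d e : Dart n} (h : d.1 = e.1) :
    d = e ∨ d = rot e ∨ d = rot (rot e) ∨ d = rot (rot (rot e)) := by
  have : ∀ i j : Fin 4, i = j ∨ i = j + 1 ∨ i = j + 1 + 1 ∨ i = j + 1 + 1 + 1 := by decide
  rcases this d.2 e.2 with h' | h' | h' | h'
  · exact Or.inl (Prod.ext h h')
  · exact Or.inr (Or.inl (Prod.ext h h'))
  · exact Or.inr (Or.inr (Or.inl (Prod.ext h h')))
  · exact Or.inr (Or.inr (Or.inr (Prod.ext h h')))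

theorem nodup_rots (e : Dart n) : [e, rot e, rot (rot e), rot (rot (rot e))].Nodup := by
  have : ∀ j : Fin 4, [j, j + 1, j + 1 + 1, j + 1 + 1 + 1].Nodup := by decide
  exact List.Nodup.of_map Prod.snd (this e.2)

theorem crossing_darts (e : Dart n) :
    ([.dart (e.1, e.2), .dart (e.1, e.2 + 1), .dart (e.1, e.2 + 2), .dart (e.1, e.2 + 3)] :
      List (StrandEnd n)) = [e, rot e, rot (rot e), rot (rot (rot e))].map .dart := by
  have h2 : ∀ j : Fin 4, j + 2 = j + 1 + 1 := by decide
  have h3 : ∀ j : Fin 4, j + 3 = j + 1 + 1 + 1 := by decide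
  rw [h2, h3]; rfl

/-- The new crossing is attached along a single edge: one boundary point is replaced by three, and
no face is closed off. This keeps the invariant that every face at a crossing of the tangle still
meets the boundary circle. -/
theorem Partial.add {T : Tangle n} {A : List (Fin n)} {b : List (Dart n)} {d : Dart n}
    (h : Partial L T A b) (hf : ∀ x : Dart n, x.1 ∈ A → ∃ y ∈ b, L.Face x y) (hd : d ∈ b)
    (hc : (L.link d).1 ∉ A) (hb : 2 ≤ b.length) :
    ∃ p q T' b', Move.apply T (.crossing (L.link d).1 (L.link d).2 p [q]) = some T' ∧
      Partial L T' (A ++ [(L.link d).1]) b' ∧ b'.length = b.length + 2 ∧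
      ∀ x : Dart n, x.1 ∈ A ++ [(L.link d).1] → ∃ y ∈ b', L.Face x y := by
  set e := L.link d with he
  obtain ⟨s, hs⟩ := exists_isRotated_cons hd
  have hls := hs.perm.length_eq
  have hE := L.face_equivalence
  obtain ⟨h1, h2, h3, h4, h5, h6⟩ := h.rotate hs
  have hfd : ∀ x : Dart n, x.1 ∈ A → ∃ y ∈ d :: s, L.Face x y := fun x hx => by
    obtain ⟨y, hy, hxy⟩ := hf x hx
    exact ⟨y, hs.mem_iff.1 hy, hxy⟩
  have h1' : T.boundary.IsRotated (s.map .dart ++ [.dart d]) :=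
    h1.trans (by simpa using List.isRotated_append (l := [StrandEnd.dart d]) (l' := s.map .dart))
  obtain ⟨p, hp, hpe⟩ := List.isRotated_iff_mod.1 h1'
  obtain ⟨q, hq⟩ := close_of_isRotated (T := ⟨[.dart (e.1, e.2), .dart (e.1, e.2 + 1), .dart (e.1, e.2 + 2),
    .dart (e.1, e.2 + 3)] ++ T.boundary.rotate p, T.joins, T.cups⟩) (x := .dart d) (y := .dart e)
    (rest := [rot e, rot (rot e), rot (rot (rot e))].map .dart ++ s.map .dart)
    (ok := fun x y => x.isAt e.1 || y.isAt e.1) (by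
      rw [crossing_darts, hpe]
      exact List.isRotated_append (l' := [StrandEnd.dart d])
        (l := [e, rot e, rot (rot e), rot (rot (rot e))].map .dart ++ s.map .dart))
    (by simp [StrandEnd.isAt])
  have hdA : d.1 ∈ A := ((h5 d).1 (by simp)).1
  have hsA : ∀ x ∈ s, x.1 ∈ A := fun x hx => ((h5 x).1 (by simp [hx])).1
  have hje : ∀ x : Dart n, x.1 = e.1 → ¬ Joined L T x := fun x hx hj => hc (by
    rw [← hx]; exact h.mem_of_joined hj)
  have hrot : ∀ x : Dart n, (rot x).1 = x.1 := fun _ => rfl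
  have hnd := List.nodup_cons.1 h4
  have hrots := nodup_rots e
  rw [Cycle.chain_coe_cons] at h6
  cases s with
  | nil => simp at hls; omega
  | cons w s =>
  rw [List.cons_append, List.isChain_cons_cons, ← List.cons_append, List.isChain_append] at h6
  obtain ⟨h7, h8, -, h9⟩ := h6
  have few : L.Face e w := hE.trans (L.face_rot d) h7
  have fde : L.Face d (rot e) := L.face_link d
  refine ⟨p, q, ⟨[rot e, rot (rot e), rot (rot (rot e))].map .dart ++ (w :: s).map .dart,
    (.dart d, .dart e) :: T.joins, T.cups⟩, [rot e, rot (rot e), rot (rot (rot e))] ++ w :: s, ?_, ⟨?_, h2, ?_, ?_, ?_, ?_⟩, ?_, ?_⟩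
  · simp only [Move.apply, if_pos hp, List.foldlM_cons, List.foldlM_nil, hq]
    rfl
  · simp only [List.map_append]; exact List.IsRotated.refl _
  · intro x hx
    rcases List.mem_cons.1 hx with rfl | hx
    · exact ⟨d, by rw [he], by simp [hdA], by simp [he]⟩
    · obtain ⟨d', k1, k2, k3⟩ := h3 x hx
      exact ⟨d', k1, by simp [k2], by simp [k3]⟩
  · rw [List.nodup_append]
    refine ⟨(List.nodup_cons.1 hrots).2, hnd.2, fun x hx y hy hxy => hc ?_⟩
    subst hxy
    have := hsA x hy
    simp only [List.mem_cons, List.not_mem_nil, or_false] at hx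
    rcases hx with rfl | rfl | rfl <;> exact this
  · intro x
    rw [he, joined_cons, ← he]
    by_cases hx : x.1 = e.1
    · have hxd : x ≠ d := by rintro rfl; exact hc (hx ▸ hdA)
      have hxs : x ∉ w :: s := fun hxs => hc (hx ▸ hsA x hxs)
      have hex : x ∈ [rot e, rot (rot e), rot (rot (rot e))] ↔ x ≠ e := by
        constructor
        · rintro h rfl; exact (List.nodup_cons.1 hrots).1 h
        · intro hne
          rcases eq_of_fst_eq hx with h | h | h | h
          · exact absurd h hne
          · simp [h]
          · simp [h]
          · simp [h]
      rw [List.mem_append, hex]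
      simp [hx, hxs, hje x hx, hxd]
    · have hex : x ∉ [rot e, rot (rot e), rot (rot (rot e))] := by
        intro h
        simp only [List.mem_cons, List.not_mem_nil, or_false] at h
        rcases h with rfl | rfl | rfl <;> exact hx rfl
      have hxe : x ≠ e := by rintro rfl; exact hx rfl
      have := h5 x
      rw [List.mem_append, List.mem_append, List.mem_singleton]
      simp only [hex, false_or, hx, or_false, hxe]
      by_cases hxd : x = d
      · subst hxd; simp only [or_true, not_true, and_false, iff_false]; exact hnd.1
      · rw [List.mem_cons] at this
        simpa [hxd] using this
  · simp only [List.cons_append, List.nil_append, Cycle.chain_coe_cons, List.isChain_cons_cons]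
    refine ⟨hE.refl _, hE.refl _, ?_, ?_⟩
    · rw [rot_rot_rot_rot]; exact few
    · rw [← List.cons_append, List.isChain_append]
      refine ⟨h8, List.isChain_singleton _, fun x hx y hy => ?_⟩
      obtain rfl : rot e = y := by simpa using hy
      exact hE.trans (h9 x hx d (by simp)) fde
  · simp at hls ⊢; omega
  · intro x hx
    by_cases hxe : x.1 = e.1
    · rcases eq_of_fst_eq hxe with rfl | h | h | h
      · exact ⟨w, by simp, few⟩
      · exact ⟨x, by simp [h], hE.refl _⟩
      · exact ⟨x, by simp [h], hE.refl _⟩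
      · exact ⟨x, by simp [h], hE.refl _⟩
    · have hxA : x.1 ∈ A := by simpa [hxe] using hx
      obtain ⟨y, hy, hxy⟩ := hfd x hxA
      rcases List.mem_cons.1 hy with rfl | hy
      · exact ⟨rot e, by simp, hE.trans hxy fde⟩
      · exact ⟨y, by simp at hy ⊢; tauto, hxy⟩

theorem exists_link_of_connected (hL : L.Connected) {A : List (Fin n)} {c₀ c₁ : Fin n} (h0 : c₀ ∈ A)
    (h1 : c₁ ∉ A) : ∃ d : Dart n, d.1 ∈ A ∧ (L.link d).1 ∉ A := by
  obtain ⟨w⟩ := hL.preconnected c₀ c₁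
  obtain ⟨a, -, ha, ha'⟩ := w.exists_boundary_dart {c | c ∈ A} h0 h1
  rcases ((SimpleGraph.fromRel_adj _ _ _).1 a.adj).2 with ⟨j, k, h⟩ | ⟨j, k, h⟩
  · exact ⟨(a.fst, j), ha, by rw [h]; exact ha'⟩
  · have : L.link (a.fst, k) = (a.snd, j) := by rw [← h, L.link_link]
    exact ⟨(a.fst, k), ha, by rw [this]; exact ha'⟩

/-- Connectedness provides an edge from the crossings already added to a new one. After k + 1
crossings and k joined edges, 4 (k + 1) - 2 k half-edges are free. -/
theorem exists_partial (hL : L.Connected) (k : ℕ) (hk : k + 1 ≤ n) :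
    ∃ l T A b, Run (2 * n + 2) l (Tangle.empty n) T ∧ l.filterMap Move.crossing? = A ∧ A.Nodup ∧
      A.length = k + 1 ∧ Partial L T A b ∧ b.length = 2 * k + 4 ∧
      ∀ x : Dart n, x.1 ∈ A → ∃ y ∈ b, L.Face x y := by
  induction k with
  | zero =>
    obtain ⟨c⟩ := hL.nonempty
    set e : Dart n := (c, 0) with he
    refine ⟨[.crossing c 0 0 []], ⟨[e, rot e, rot (rot e), rot (rot (rot e))].map .dart, [], 0⟩, [c],
      [e, rot e, rot (rot e), rot (rot (rot e))], Run.single ?_ (by simp [Tangle.empty]) (by simp; omega), rfl,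
      by simp, by simp, ⟨List.IsRotated.refl _, rfl, by simp, nodup_rots e, ?_, ?_⟩, rfl, ?_⟩
    · have := crossing_darts e
      simp only [he] at this
      simp only [Move.apply, List.foldlM_nil, Tangle.empty]
      simp [he, rot]
    · intro d
      simp only [Joined, List.not_mem_nil, or_false, not_false_iff, and_true]
      constructor
      · intro h
        simp only [List.mem_cons, List.not_mem_nil, or_false] at h
        rcases h with rfl | rfl | rfl | rfl <;> simp [rot, he]
      · intro h
        have hd : d.1 = e.1 := by simpa using h
        rcases eq_of_fst_eq hd with h | h | h | h <;> simp [h]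
    · simp only [List.cons_append, List.nil_append, Cycle.chain_coe_cons, List.isChain_cons_cons,
        List.isChain_singleton, rot_rot_rot_rot]
      exact ⟨.refl _, .refl _, .refl _, .refl _, trivial⟩
    · intro d h
      have hd : d.1 = e.1 := by simpa using h
      refine ⟨d, ?_, .refl _⟩
      rcases eq_of_fst_eq hd with h | h | h | h <;> simp [h]
  | succ k ih =>
    obtain ⟨l, T, A, b, h1, h2, h3, h4, h5, h6, h7⟩ := ih (by omega)
    have hc0 : ∃ c₀, c₀ ∈ A := by
      cases A with
      | nil => simp at h4
      | cons c A => exact ⟨c, by simp⟩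
    obtain ⟨c₀, hc0⟩ := hc0
    have hc1 : ∃ c₁, c₁ ∉ A := by
      by_contra! hall
      have := Finset.card_le_card (fun c _ => List.mem_toFinset.2 (hall c) : Finset.univ ⊆ A.toFinset)
      have h8 := List.toFinset_card_le A
      simp at this
      omega
    obtain ⟨c₁, hc1⟩ := hc1
    obtain ⟨d, hd, hd'⟩ := exists_link_of_connected hL hc0 hc1
    have hdb : d ∈ b := (h5.mem d).2 ⟨hd, fun hj => hd' (h5.mem_of_joined (joined_link.2 hj))⟩
    obtain ⟨p, q, T', b', k1, k2, k3, k4⟩ := h5.add h7 hdb hd' (by omega)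
    have hT := h5.bdry.perm.length_eq
    have hT' := k2.bdry.perm.length_eq
    rw [List.length_map] at hT hT'
    refine ⟨l ++ [.crossing (L.link d).1 (L.link d).2 p [q]], T', A ++ [(L.link d).1], b',
      h1.append (Run.single k1 (by omega) (by omega)), ?_, ?_, by simp [h4], k2, by omega, k4⟩
    · simp [h2, Move.crossing?]
    · rw [List.nodup_append]
      exact ⟨h3, by simp, fun x hx y hy hxy => hd' (by simp at hy; rwa [← hy, ← hxy])⟩

/-- After the last crossing there are 2 n + 2 = 2 (n + 1) boundary points, and they meet all faces.
By Euler's formula there are n + 2 of these, which is just enough to start the pigeonhole argument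
of `Partial.exists_caps`. The number of boundary points has its maximum at this moment. -/
theorem exists_cutting_le (hL : L.Connected) : ∃ c : L.Cutting, c.girth ≤ 2 * n + 2 := by
  classical
  obtain ⟨c0⟩ := hL.nonempty
  have hn : 0 < n := c0.pos
  obtain ⟨l, T, A, b, h1, h2, h3, h4, h5, h6, h7⟩ := exists_partial hL (n - 1) (by omega)
  have hA : ∀ c, c ∈ A := by
    have h8 : A.toFinset = Finset.univ := by
      rw [← Finset.card_eq_iff_eq_univ, List.toFinset_card_of_nodup h3]
      simp; omega
    intro c
    rw [← List.mem_toFinset, h8]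
    exact Finset.mem_univ c
  have : Fintype (Quot fun d e : Dart n => e = rot (L.link d)) :=
    Fintype.ofSurjective (Quot.mk _) Quot.exists_rep
  have hF : b.toFinset.image L.faceOf = Finset.univ := by
    ext F
    obtain ⟨x, rfl⟩ := Quot.exists_rep F
    obtain ⟨y, hy, hxy⟩ := h7 x (hA _)
    simp only [Finset.mem_univ, iff_true, Finset.mem_image]
    exact ⟨y, by simpa using hy, (L.faceOf_eq.2 hxy).symm⟩
  have hcc : Nat.card (crossingGraph L.link).ConnectedComponent = 1 := by
    rw [Nat.card_eq_one_iff_unique]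
    exact ⟨hL.preconnected.subsingleton_connectedComponent, ⟨(crossingGraph L.link).connectedComponentMk c0⟩⟩
  have hpl := L.planar
  rw [hcc, faceCount, Nat.card_eq_fintype_card, ← Finset.card_univ, ← hF] at hpl
  obtain ⟨l', T', k1, k2, k3⟩ := Partial.exists_caps (g := 2 * n + 2) hA (n + 1) T b (by omega) h5 (by omega)
    (by intro _; rw [hpl])
  obtain ⟨c, -, hc⟩ := exists_cutting (h1.append k1) k2 (by
    rw [List.filterMap_append, h2, k3, List.append_nil]
    exact (List.perm_ext_iff_of_nodup h3 (List.nodup_finRange n)).2 (by simpa using hA))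
  exact ⟨c, hc⟩

end existence

/-! ## Labelled tangles -/

section labels

variable {n : ℕ} {T : Tangle n} {ℓ : StrandEnd n → ℕ} {β : List ℕ} {δ : Dart n → ℕ}

/-- The end is a half-edge or belongs to one of the first `k` crossingless arcs. -/
def Valid (k : ℕ) : StrandEnd n → Prop
  | .dart _ => True
  | .cup i _ => i < k

structure Tangle.WF (T : Tangle n) : Prop where
  bdry : ∀ x ∈ T.boundary, Valid T.cups x
  joins : ∀ p ∈ T.joins, Valid T.cups p.1 ∧ Valid T.cups p.2

theorem Valid.succ {k : ℕ} {x : StrandEnd n} (h : Valid k x) : Valid (k + 1) x := by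
  cases x with
  | dart d => trivial
  | cup i b => exact Nat.lt_succ_of_lt h

theorem valid_succ {k : ℕ} {x : StrandEnd n} (h : Valid (k + 1) x) :
    Valid k x ∨ ∃ b, x = .cup k b := by
  cases x with
  | dart d => exact Or.inl trivial
  | cup i b =>
    rcases (Nat.lt_succ_iff.1 h).lt_or_eq with h | rfl
    · exact Or.inl h
    · exact Or.inr ⟨b, rfl⟩

theorem Tangle.WF.sameEdge_valid (h : T.WF) {x y : StrandEnd n} (hxy : T.SameEdge x y) :
    (Valid T.cups x ↔ Valid T.cups y) ∧ (¬ Valid T.cups x → x = y) := by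
  induction hxy with
  | rel x y hxy =>
    rcases hxy with hxy | ⟨k, hk, rfl, rfl⟩
    · have := h.joins _ hxy
      exact ⟨iff_of_true this.1 this.2, fun h => absurd this.1 h⟩
    · exact ⟨Iff.rfl, fun h => absurd hk h⟩
  | refl x => exact ⟨Iff.rfl, fun _ => rfl⟩
  | symm x y _ ih => exact ⟨ih.1.symm, fun h => (ih.2 fun h' => h (ih.1.1 h')).symm⟩
  | trans x y z _ _ ih ih' =>
    exact ⟨ih.1.trans ih'.1, fun h => (ih.2 h).trans (ih'.2 fun h' => h (ih.1.2 h'))⟩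

theorem sameEdge_cap {b b' : List (StrandEnd n)} {js : List (StrandEnd n × StrandEnd n)} {k : ℕ}
    {x y u v : StrandEnd n} : Tangle.SameEdge ⟨b, (x, y) :: js, k⟩ u v ↔
      mrg (Tangle.SameEdge ⟨b', js, k⟩) x y u v := by
  refine eqvGen_insert (fun a b => ?_) u v
  simp only [List.mem_cons, Prod.mk.injEq, or_assoc, or_comm]

theorem sameEdge_cup {b b' : List (StrandEnd n)} {js : List (StrandEnd n × StrandEnd n)} {k : ℕ}
    {u v : StrandEnd n} : Tangle.SameEdge ⟨b, js, k + 1⟩ u v ↔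
      mrg (Tangle.SameEdge ⟨b', js, k⟩) (.cup k false) (.cup k true) u v := by
  refine eqvGen_insert (fun a b => ?_) u v
  have : (∃ i < k + 1, a = .cup i false ∧ b = .cup i true) ↔
      (∃ i < k, a = .cup i false ∧ b = .cup i true) ∨ a = .cup k false ∧ b = .cup k true := by
    constructor
    · rintro ⟨i, hi, h⟩
      rcases (Nat.lt_succ_iff.1 hi).lt_or_eq with h' | rfl
      · exact Or.inl ⟨i, h', h⟩
      · exact Or.inr h
    · rintro (⟨i, hi, h⟩ | h)
      · exact ⟨i, by omega, h⟩
      · exact ⟨k, by omega, h⟩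
  simp only [this, or_assoc]

theorem Tangle.WF.cap {b b' : List (StrandEnd n)} {js : List (StrandEnd n × StrandEnd n)} {k : ℕ}
    {x y : StrandEnd n} (h : Tangle.WF ⟨b, js, k⟩) (hx : x ∈ b) (hy : y ∈ b) (hb : ∀ z ∈ b', z ∈ b) :
    Tangle.WF ⟨b', (x, y) :: js, k⟩ := by
  refine ⟨fun z hz => h.bdry z (hb z hz), fun p hp => ?_⟩
  rcases List.mem_cons.1 hp with rfl | hp
  · exact ⟨h.bdry _ hx, h.bdry _ hy⟩
  · exact h.joins p hp

theorem Tangle.WF.cup {b b' : List (StrandEnd n)} {js : List (StrandEnd n × StrandEnd n)} {k : ℕ}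
    (h : Tangle.WF ⟨b, js, k⟩) (hb : ∀ z ∈ b', z ∈ b) :
    Tangle.WF ⟨.cup k false :: .cup k true :: b', js, k + 1⟩ := by
  refine ⟨fun z hz => ?_, fun p hp => ⟨(h.joins p hp).1.succ, (h.joins p hp).2.succ⟩⟩
  simp only [List.mem_cons] at hz
  rcases hz with rfl | rfl | hz
  · exact Nat.lt_succ_self k
  · exact Nat.lt_succ_self k
  · exact (h.bdry z (hb z hz)).succ

/-- Every edge has an end at the boundary or at a crossing. -/
def Tangle.Alive (T : Tangle n) : Prop :=
  ∀ x, Valid T.cups x → ∃ y, T.SameEdge x y ∧ (y ∈ T.boundary ∨ ∃ d, y = .dart d)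

theorem MStep.wf {m : Micro n} {T T' : Tangle n} (h : MStep m T T') (hT : T.WF) : T'.WF := by
  cases h with
  | rot b js k hb => exact ⟨fun x hx => hT.bdry x (List.mem_rotate.1 hx), hT.joins⟩
  | cup b js k => exact hT.cup fun _ => id
  | cap x y b js k => exact hT.cap (by simp) (by simp) fun z hz => by simp [hz]
  | x c j b js k =>
    refine ⟨fun x hx => ?_, hT.joins⟩
    rcases List.mem_append.1 hx with hx | hx
    · simp only [List.mem_cons, List.not_mem_nil, or_false] at hx
      rcases hx with rfl | rfl | rfl | rfl <;> trivial
    · exact hT.bdry x hx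

/-- An edge without a crossing and without a boundary point is a closed curve and remains one for
ever. So its absence at the end implies its absence before. -/
theorem MStep.alive {m : Micro n} {T T' : Tangle n} (h : MStep m T T') (hT : T.WF) (hT' : T'.Alive) :
    T.Alive := by
  intro z hz
  cases h with
  | rot b js k hb =>
    obtain ⟨y, h1, h2⟩ := hT' z hz
    exact ⟨y, h1, by simpa using h2⟩
  | cup b js k =>
    obtain ⟨y, h1, h2⟩ := hT' z hz.succ
    have hno : ∀ b', ¬ Tangle.SameEdge ⟨b, js, k⟩ z (.cup k b') := fun b' h =>
      absurd ((hT.sameEdge_valid h).1.1 hz) (lt_irrefl k)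
    rw [sameEdge_cup (b' := b)] at h1
    rcases h1 with h1 | ⟨h1, -⟩ | ⟨h1, -⟩
    · refine ⟨y, h1, ?_⟩
      rcases h2 with h2 | h2
      · simp only [List.mem_cons] at h2
        rcases h2 with rfl | rfl | h2
        · exact absurd h1 (hno _)
        · exact absurd h1 (hno _)
        · exact Or.inl h2
      · exact Or.inr h2
    · exact absurd h1 (hno _)
    · exact absurd h1 (hno _)
  | cap x y b js k =>
    obtain ⟨w, h1, h2⟩ := hT' z hz
    rw [sameEdge_cap (b' := x :: y :: b)] at h1
    rcases h1 with h1 | ⟨h1, -⟩ | ⟨h1, -⟩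
    · exact ⟨w, h1, h2.imp_left fun h => by simp [h]⟩
    · exact ⟨x, h1, by simp⟩
    · exact ⟨y, h1, by simp⟩
  | x c j b js k =>
    obtain ⟨w, h1, h2⟩ := hT' z hz
    refine ⟨w, h1, ?_⟩
    rcases h2 with h2 | h2
    · rcases List.mem_append.1 h2 with h2 | h2
      · simp only [List.mem_cons, List.not_mem_nil, or_false] at h2
        right
        rcases h2 with rfl | rfl | rfl | rfl <;> exact ⟨_, rfl⟩
      · exact Or.inl h2
    · exact Or.inr h2

theorem MRun.alive {G : ℕ} {ms : List (Micro n)} {T T' : Tangle n} (h : MRun G ms T T') (hT : T.WF)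
    (hT' : T'.Alive) : T.Alive := by
  induction h with
  | nil => exact hT'
  | cons h1 _ _ ih => exact h1.alive hT (ih (h1.wf hT) hT')

theorem MRun.wf {G : ℕ} {ms : List (Micro n)} {T T' : Tangle n} (h : MRun G ms T T') (hT : T.WF) :
    T'.WF := by
  induction h with
  | nil => exact hT
  | cons h1 _ _ ih => exact ih (h1.wf hT)

/-- The labels distinguish the edges. -/
structure Labelled (T : Tangle n) (ℓ : StrandEnd n → ℕ) : Prop where
  wf : T.WF
  iff : ∀ x y, Valid T.cups x → Valid T.cups y → (T.SameEdge x y ↔ ℓ x = ℓ y)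

/-- Replace `b` by `a`. -/
def sub (b a z : ℕ) : ℕ := if z = b then a else z

theorem sub_self (b a : ℕ) : sub b a b = a := if_pos rfl

theorem sub_right (b a : ℕ) : sub b a a = a := by unfold sub; split_ifs <;> rfl

theorem sub_of_ne {b a z : ℕ} (h : z ≠ b) : sub b a z = z := if_neg h

/-- Replacing a label has the same effect on labels as `mrg` on the relation. -/
theorem sub_eq_sub {a b u v : ℕ} : sub b a u = sub b a v ↔
    u = v ∨ u = a ∧ b = v ∨ u = b ∧ a = v := by
  unfold sub; split_ifs <;> omega

theorem Labelled.cap {b b' : List (StrandEnd n)} {js : List (StrandEnd n × StrandEnd n)} {k : ℕ}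
    {x y : StrandEnd n} (h : Labelled ⟨b, js, k⟩ ℓ) (hx : x ∈ b) (hy : y ∈ b) (hb : ∀ z ∈ b', z ∈ b) :
    Labelled ⟨b', (x, y) :: js, k⟩ (sub (ℓ y) (ℓ x) ∘ ℓ) := by
  refine ⟨h.wf.cap hx hy hb, fun u v hu hv => ?_⟩
  have vx := h.wf.bdry x hx
  have vy := h.wf.bdry y hy
  rw [sameEdge_cap (b' := b), Function.comp, Function.comp, sub_eq_sub, mrg, h.iff u v hu hv,
    h.iff u x hu vx, h.iff y v vy hv, h.iff u y hu vy, h.iff x v vx hv]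

open scoped Classical in
theorem Labelled.cup {b b' : List (StrandEnd n)} {js : List (StrandEnd n × StrandEnd n)} {k a : ℕ}
    (h : Labelled ⟨b, js, k⟩ ℓ) (hb : ∀ z ∈ b', z ∈ b) (ha : ∀ x, Valid k x → ℓ x ≠ a) :
    Labelled ⟨.cup k false :: .cup k true :: b', js, k + 1⟩ (fun x => if Valid k x then ℓ x else a) := by
  refine ⟨h.wf.cup hb, fun u v hu hv => ?_⟩
  have hE := Tangle.sameEdge_equivalence ⟨b, js, k⟩
  have hk : ∀ b, ¬ Valid k (.cup k b : StrandEnd n) := fun _ => lt_irrefl k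
  have hno : ∀ b' z, Valid k z → ¬ Tangle.SameEdge ⟨b, js, k⟩ z (.cup k b') := fun b' z hz h' =>
    absurd ((h.wf.sameEdge_valid h').1.1 hz) (lt_irrefl k)
  rw [sameEdge_cup (b' := b), mrg]
  rcases valid_succ hu with hu | ⟨b₁, rfl⟩ <;> rcases valid_succ hv with hv | ⟨b₂, rfl⟩
  · rw [if_pos hu, if_pos hv, ← h.iff u v hu hv]
    simp only [hno _ u hu, false_and, or_false]
  · rw [if_pos hu, if_neg (hk _)]
    simp only [hno _ u hu, false_and, or_false, ha u hu]
  · rw [if_neg (hk _), if_pos hv]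
    have hno' : ∀ b', ¬ Tangle.SameEdge ⟨b, js, k⟩ (.cup k b') v := fun b' h => hno b' v hv (hE.symm h)
    simp only [hno', and_false, or_false, (ha v hv).symm]
  · simp only [if_neg (hk _), iff_true]
    cases b₁ <;> cases b₂
    · exact Or.inl (hE.refl _)
    · exact Or.inr (Or.inl ⟨hE.refl _, hE.refl _⟩)
    · exact Or.inr (Or.inr ⟨hE.refl _, hE.refl _⟩)
    · exact Or.inl (hE.refl _)

theorem Labelled.of_boundary {b b' : List (StrandEnd n)} {js : List (StrandEnd n × StrandEnd n)} {k : ℕ}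
    (h : Labelled ⟨b, js, k⟩ ℓ) (hb : ∀ x ∈ b', Valid k x) : Labelled ⟨b', js, k⟩ ℓ :=
  ⟨⟨hb, h.wf.joins⟩, h.iff⟩

/-- The boundary points of the tangle lie, in cyclic order, on the edges with labels `β`, the
half-edges lie on the edges with labels `δ`, and there are no other edges. -/
def Rep (T : Tangle n) (β : List ℕ) (δ : Dart n → ℕ) : Prop :=
  ∃ ℓ, Labelled T ℓ ∧ (∀ d, ℓ (.dart d) = δ d) ∧ (T.boundary.map ℓ).IsRotated β ∧
    ∀ x, Valid T.cups x → ℓ x ∈ β ∨ ∃ d, δ d = ℓ x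

theorem Rep.of_isRotated {β' : List ℕ} (h : Rep T β δ) (hβ : β.IsRotated β') : Rep T β' δ := by
  obtain ⟨ℓ, h1, h2, h3, h4⟩ := h
  exact ⟨ℓ, h1, h2, h3.trans hβ, fun x hx => by rw [← hβ.mem_iff]; exact h4 x hx⟩

theorem Rep.length_eq (h : Rep T β δ) : T.boundary.length = β.length := by
  obtain ⟨ℓ, -, -, h, -⟩ := h
  simpa using h.perm.length_eq

theorem exists_rotate_map {α γ : Type*} {f : α → γ} {l : List α} {m : List γ}
    (h : (l.map f).IsRotated m) : ∃ p ≤ l.length, (l.rotate p).map f = m := by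
  obtain ⟨p, hp, he⟩ := List.isRotated_iff_mod.1 h
  exact ⟨p, by simpa using hp, by rwa [List.map_rotate]⟩

theorem Labelled.rep_of_alive (h : Labelled T ℓ) (hT : T.Alive) :
    Rep T (T.boundary.map ℓ) (fun d => ℓ (.dart d)) := by
  refine ⟨ℓ, h, fun _ => rfl, List.IsRotated.refl _, fun x hx => ?_⟩
  obtain ⟨y, h1, h2⟩ := hT x hx
  have vy := (h.wf.sameEdge_valid h1).1.1 hx
  have e := (h.iff x y hx vy).1 h1
  rcases h2 with h2 | ⟨d, rfl⟩
  · exact Or.inl (List.mem_map.2 ⟨y, h2, e.symm⟩)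
  · exact Or.inr ⟨d, e.symm⟩

/-- The hypothesis `ha` says that the joined edge still has an end on the boundary or at a crossing,
so no closed curve is split off. -/
theorem Rep.cap {a b : ℕ} {β' : List ℕ} (h : Rep T β δ) (hβ : β.IsRotated (a :: b :: β'))
    (ha : a ∈ β'.map (sub b a) ∨ ∃ d, sub b a (δ d) = a) :
    ∃ q T', T.close (fun _ _ => true) q = some T' ∧
      Rep T' (β'.map (sub b a)) (fun d => sub b a (δ d)) := by
  obtain ⟨ℓ, h1, h2, h3, h4⟩ := h
  obtain ⟨p, -, hp⟩ := exists_rotate_map (h3.trans hβ)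
  rw [List.map_eq_cons_iff] at hp
  obtain ⟨x, t, e1, rfl, hp⟩ := hp
  rw [List.map_eq_cons_iff] at hp
  obtain ⟨y, rest, rfl, rfl, rfl⟩ := hp
  obtain ⟨q, hq⟩ := close_of_isRotated (T := T) (ok := fun _ _ => true) ⟨p, e1⟩ rfl
  have hmem : ∀ z, z ∈ x :: y :: rest → z ∈ T.boundary := fun z hz => by
    rw [← e1] at hz; exact List.mem_rotate.1 hz
  refine ⟨q, _, hq, sub (ℓ y) (ℓ x) ∘ ℓ, h1.cap (hmem x (by simp)) (hmem y (by simp))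
    (fun z hz => hmem z (by simp [hz])), fun d => by rw [Function.comp, h2], by
      rw [List.map_map], fun z hz => ?_⟩
  rcases h4 z hz with h5 | ⟨d, h5⟩
  · rw [hβ.mem_iff] at h5
    simp only [List.mem_cons] at h5
    rcases h5 with h5 | h5 | h5
    · simpa [h5, sub_right, Function.comp] using ha
    · simpa [h5, sub_self, Function.comp] using ha
    · exact Or.inl (List.mem_map.2 ⟨ℓ z, h5, rfl⟩)
  · exact Or.inr ⟨d, by simp only [h5, Function.comp]⟩

/-- Add an arc without crossings that has both its ends on the boundary. -/
def Tangle.addCup (T : Tangle n) (p : ℕ) : Tangle n :=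
  ⟨.cup T.cups false :: .cup T.cups true :: T.boundary.rotate p, T.joins, T.cups + 1⟩

theorem Labelled.rep_addCup {a p : ℕ} {β' : List ℕ} (h1 : Labelled T ℓ) (h2 : ∀ d, ℓ (.dart d) = δ d)
    (he : (T.boundary.rotate p).map ℓ = β') (h4 : ∀ x, Valid T.cups x → ℓ x ∈ β' ∨ ∃ d, δ d = ℓ x)
    (ha : a ∉ β') (ha' : ∀ d, δ d ≠ a) : Rep (T.addCup p) (a :: a :: β') δ := by
  classical
  have hfresh : ∀ x, Valid T.cups x → ℓ x ≠ a := by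
    rintro x hx rfl
    rcases h4 x hx with h | ⟨d, h⟩
    · exact ha h
    · exact ha' d h
  refine ⟨_, h1.cup (b' := T.boundary.rotate p) (fun z hz => List.mem_rotate.1 hz) hfresh, fun d => ?_, ?_,
    fun x hx => ?_⟩
  · rw [if_pos (show Valid T.cups (.dart d) from trivial), h2]
  · have hk : ∀ b, ¬ Valid T.cups (.cup T.cups b : StrandEnd n) := fun _ => lt_irrefl _
    have : (T.boundary.rotate p).map (fun x => if Valid T.cups x then ℓ x else a) = β' := by
      rw [← he]
      refine List.map_congr_left fun x hx => if_pos (h1.wf.bdry x (List.mem_rotate.1 hx))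
    simp only [Tangle.addCup, List.map_cons, if_neg (hk _), this]
    exact List.IsRotated.refl _
  · rcases valid_succ hx with hx | ⟨b, rfl⟩
    · rw [if_pos hx]
      rcases h4 x hx with h | h
      · exact Or.inl (by simp [h])
      · exact Or.inr h
    · rw [if_neg (show ¬ Valid T.cups (.cup T.cups b : StrandEnd n) from lt_irrefl _)]
      simp

theorem Rep.addCup {a : ℕ} {β' : List ℕ} (h : Rep T β δ) (hβ : β.IsRotated β') (ha : a ∉ β')
    (ha' : ∀ d, δ d ≠ a) : ∃ p ≤ T.boundary.length, Rep (T.addCup p) (a :: a :: β') δ := by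
  obtain ⟨ℓ, h1, h2, h3, h4⟩ := h
  obtain ⟨p, hp, he⟩ := exists_rotate_map (h3.trans hβ)
  exact ⟨p, hp, h1.rep_addCup h2 he (fun x hx => by rw [← hβ.mem_iff]; exact h4 x hx) ha ha'⟩

theorem exists_fresh (β : List ℕ) (δ : Dart n → ℕ) : ∃ a, a ∉ β ∧ ∀ d, δ d ≠ a := by
  obtain ⟨a, ha⟩ := Infinite.exists_notMem_finset (β.toFinset ∪ Finset.univ.image δ)
  simp only [Finset.mem_union, List.mem_toFinset, Finset.mem_image, Finset.mem_univ, true_and, not_or,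
    not_exists] at ha
  exact ⟨a, ha.1, ha.2⟩

/-- The possible positions of a neighbouring pair on a circle relative to the marked pair `c₀, c₁`:
the same pair, an overlap at `c₁`, an overlap at `c₀`, disjoint, or the same two points in reverse
order if there are no others. -/
theorem isRotated_cons_cons_cases {α : Type*} {c₀ c₁ x y : α} {b r : List α}
    (h : (c₀ :: c₁ :: b).IsRotated (x :: y :: r)) :
    (x = c₀ ∧ y = c₁ ∧ r = b) ∨ (∃ b', x = c₁ ∧ b = y :: b' ∧ r = b' ++ [c₀]) ∨
      (∃ b', y = c₀ ∧ b = b' ++ [x] ∧ r = c₁ :: b') ∨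
      (∃ l₁ l₂, b = l₁ ++ x :: y :: l₂ ∧ r = l₂ ++ c₀ :: c₁ :: l₁) ∨
      (x = c₁ ∧ y = c₀ ∧ b = [] ∧ r = []) := by
  obtain ⟨l₁, l₂, h1, h2⟩ : ∃ l₁ l₂, c₀ :: c₁ :: b = l₁ ++ l₂ ∧ x :: y :: r = l₂ ++ l₁ := by
    obtain ⟨k, hk, he⟩ := List.isRotated_iff_mod.1 h
    rw [List.rotate_eq_drop_append_take hk] at he
    exact ⟨_, _, (List.take_append_drop k _).symm, he.symm⟩
  match l₁, h1, h2 with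
  | [], h1, h2 =>
    simp only [List.nil_append] at h1
    subst h1
    simp only [List.append_nil, List.cons.injEq] at h2
    exact Or.inl h2
  | [c], h1, h2 =>
    simp only [List.cons_append, List.nil_append, List.cons.injEq] at h1
    obtain ⟨rfl, rfl⟩ := h1
    cases b with
    | nil =>
      simp only [List.cons_append, List.nil_append, List.cons.injEq] at h2
      exact Or.inr (Or.inr (Or.inr (Or.inr ⟨h2.1, h2.2.1, rfl, h2.2.2⟩)))
    | cons y' b =>
      simp only [List.cons_append, List.cons.injEq] at h2
      exact Or.inr (Or.inl ⟨b, h2.1, by rw [h2.2.1], h2.2.2⟩)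
  | c :: c' :: l₁, h1, h2 =>
    simp only [List.cons_append, List.cons.injEq] at h1
    obtain ⟨rfl, rfl, rfl⟩ := h1
    match l₂, h2 with
    | [], h2 =>
      simp only [List.nil_append, List.cons.injEq] at h2
      exact Or.inl ⟨h2.1, h2.2.1, by simpa using h2.2.2⟩
    | [x'], h2 =>
      simp only [List.cons_append, List.nil_append, List.cons.injEq] at h2
      obtain ⟨rfl, rfl, rfl⟩ := h2
      exact Or.inr (Or.inr (Or.inl ⟨l₁, rfl, rfl, rfl⟩))
    | x' :: y' :: l₂, h2 =>
      simp only [List.cons_append, List.cons.injEq] at h2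
      obtain ⟨rfl, rfl, rfl⟩ := h2
      exact Or.inr (Or.inr (Or.inr (Or.inl ⟨l₁, l₂, rfl, rfl⟩)))

end labels

/-! ## Straightening of cuttings -/

section straighten

variable {n g K : ℕ} {T T' : Tangle n} {β : List ℕ} {δ : Dart n → ℕ} {l : List (Move n)}

theorem Tangle.empty_wf : (Tangle.empty n).WF := ⟨fun _ h => by simp [Tangle.empty] at h, fun _ h => by simp [Tangle.empty] at h⟩

theorem Run.wf (h : Run g l (Tangle.empty n) T) : T.WF :=
  (h.2.mrun h.1).1.wf Tangle.empty_wf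

theorem sub_id (a : ℕ) : sub a a = id := by
  funext z; unfold sub; split_ifs with h
  · exact h.symm
  · rfl

theorem Labelled.of_addCup {p : ℕ} {ℓ : StrandEnd n → ℕ} (h : Labelled (T.addCup p) ℓ) (hT : T.WF) :
    Labelled T ℓ ∧ ∀ x, Valid T.cups x → ℓ x ≠ ℓ (.cup T.cups false) := by
  obtain ⟨b, js, k⟩ := T
  have hno : ∀ b' z, Valid k z → ¬ Tangle.SameEdge ⟨b, js, k⟩ z (.cup k b') := fun b' z hz h' =>
    absurd ((hT.sameEdge_valid h').1.1 hz) (lt_irrefl k)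
  have key : ∀ u v, Valid k u →
      (Tangle.SameEdge (Tangle.addCup ⟨b, js, k⟩ p) u v ↔ Tangle.SameEdge ⟨b, js, k⟩ u v) := by
    intro u v hu
    rw [Tangle.addCup, sameEdge_cup (b' := b), mrg]
    simp only [hno _ u hu, false_and, or_false]
  refine ⟨⟨hT, fun u v hu hv => ?_⟩, fun u hu e => ?_⟩
  · rw [← key u v hu, h.iff u v hu.succ hv.succ]
  · rw [← h.iff u (.cup k false) hu.succ (Nat.lt_succ_self k), key u _ hu] at e
    exact hno _ u hu e

theorem Rep.relabel (h : Rep T β δ) (f : ℕ → ℕ) (hf : ∀ u v, (u ∈ β ∨ ∃ d, δ d = u) →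
    (v ∈ β ∨ ∃ d, δ d = v) → f u = f v → u = v) : Rep T (β.map f) (fun d => f (δ d)) := by
  obtain ⟨ℓ, h1, h2, h3, h4⟩ := h
  refine ⟨f ∘ ℓ, ⟨h1.wf, fun u v hu hv => ?_⟩, fun d => by simp [h2], ?_, fun x hx => ?_⟩
  · rw [h1.iff u v hu hv]
    exact ⟨fun h => by simp [h], fun h => hf _ _ (h4 u hu) (h4 v hv) h⟩
  · rw [← List.map_map]; exact h3.map f
  · rcases h4 x hx with h | ⟨d, h⟩
    · exact Or.inl (List.mem_map_of_mem h)
    · exact Or.inr ⟨d, by simp [h]⟩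

/-- A sequence of moves that consists of a short one and of trailing moves `cup`. -/
inductive Norm {n : ℕ} (g K : ℕ) : List (Move n) → Tangle n → Prop
  -- Twice the number of steps plus the number of boundary points does not change under a `cap`,
  -- which costs one step and removes two points. A `cup` would raise it by 4, so these steps are
  -- kept outside the base as long as possible.
  | base {l : List (Move n)} {T : Tangle n} : Run g l (Tangle.empty n) T → 2 * l.length + T.boundary.length ≤ 2 * K * (g + 1) →
      Norm g K l T
  | cup {l : List (Move n)} {T : Tangle n} {p : ℕ} : Norm g K l T → p ≤ T.boundary.length → T.boundary.length + 2 ≤ g →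
      Norm g K (l ++ [.cup p]) (T.addCup p)

theorem length_addCup (T : Tangle n) (p : ℕ) : (T.addCup p).boundary.length = T.boundary.length + 2 := by
  simp [Tangle.addCup]

theorem Norm.run (h : Norm g K l T) : Run g l (Tangle.empty n) T := by
  induction h with
  | base h => exact h
  | @cup l T p _ hp hg ih =>
    exact ih.append (Run.single (by simp [Move.apply, hp, Tangle.addCup]) (by omega)
      (by rw [length_addCup]; exact hg))

/-- A trailing `cup` adds one step and two boundary points, so both sides grow by 2. -/
theorem Norm.length_le (h : Norm g K l T) : 2 * l.length ≤ 2 * K * (g + 1) + T.boundary.length := by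
  induction h with
  | base h hl => omega
  | cup _ _ _ ih =>
    rw [List.length_append, List.length_singleton, length_addCup]
    omega

/-- The join is moved to the left through the trailing arcs. At each of them it either straightens
the arc, which removes a step, or commutes with it; if it reaches the base it is appended there. The
hypothesis on `a` excludes that a circle without crossings arises. -/
theorem Norm.exists_cap (h : Norm g K l T) : ∀ {β : List ℕ} {δ : Dart n → ℕ} {a b : ℕ} {β' : List ℕ},
    Rep T β δ → β.IsRotated (a :: b :: β') →
    (a ∈ β'.map (sub b a) ∨ ∃ d, sub b a (δ d) = a) →
    ∃ l' T', Norm g K l' T' ∧ l'.filterMap Move.crossing? = l.filterMap Move.crossing? ∧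
      Rep T' (β'.map (sub b a)) (fun d => sub b a (δ d)) := by
  induction h with
  | @base l T hr hl =>
    intro β δ a b β' hT hβ ha
    obtain ⟨q, T', h1, h2⟩ := hT.cap hβ ha
    have e1 := hT.length_eq
    have e2 := hβ.perm.length_eq
    have e3 := h2.length_eq
    rw [List.length_map] at e3
    simp only [List.length_cons] at e2
    have h3 := hr.last
    refine ⟨l ++ [.cap q], T', .base (hr.append (Run.single (mv := .cap q) h1 h3 (by omega))) ?_, ?_, h2⟩
    · simp only [List.length_append, List.length_singleton]; omega
    · simp [Move.crossing?]
  | @cup l T p hN hp hg ih =>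
    intro β δ a b β' hT hβ ha
    obtain ⟨ℓ, h1, h2, h3, h4⟩ := hT
    set A := ℓ (.cup T.cups false) with hA
    set b₁ := (T.boundary.rotate p).map ℓ with hb₁
    have hcup : ∀ b, Valid (T.cups + 1) (.cup T.cups b : StrandEnd n) := fun _ => Nat.lt_succ_self _
    have hA' : ℓ (.cup T.cups true) = A := ((h1.iff _ _ (hcup _) (hcup _)).1
      (.rel _ _ (Or.inr ⟨_, Nat.lt_succ_self _, rfl, rfl⟩))).symm
    have hbd : (T.addCup p).boundary.map ℓ = A :: A :: b₁ := by
      simp only [Tangle.addCup, List.map_cons, hA', ← hA, ← hb₁]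
    rw [hbd] at h3
    have hlab := h1.of_addCup hN.run.wf
    have hb₁A : A ∉ b₁ := fun h => by
      obtain ⟨x, hx, e⟩ := List.mem_map.1 h
      exact hlab.2 x (hlab.1.wf.bdry x (List.mem_rotate.1 hx)) e
    have hδA : ∀ d, δ d ≠ A := fun d => by
      rw [← h2]; exact hlab.2 _ trivial
    have halive : ∀ x, Valid T.cups x → ℓ x ∈ b₁ ∨ ∃ d, δ d = ℓ x := by
      intro x hx
      rcases h4 x hx.succ with h | h
      · rw [← h3.mem_iff] at h
        rcases List.mem_cons.1 h with e | h
        · exact absurd e (hlab.2 x hx)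
        rcases List.mem_cons.1 h with e | h
        · exact absurd e (hlab.2 x hx)
        exact Or.inl h
      · exact Or.inr h
    have hrep : Rep T b₁ δ := ⟨ℓ, hlab.1, h2, by
      rw [hb₁, List.map_rotate]; exact (List.IsRotated.forall _ _).symm, halive⟩
    have hinj : ∀ a b u v, u ≠ a → v ≠ a → sub b a u = sub b a v → u = v := fun a b u v hu hv h => by
      rw [sub_eq_sub] at h; omega
    rcases isRotated_cons_cons_cases (h3.trans hβ) with ⟨ea, eb, er⟩ | ⟨b', ea, hb, er⟩ | ⟨b', eb, hb, er⟩ |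
      ⟨l₁, l₂, hb, er⟩ | ⟨ea, eb, -, er⟩
    -- The two ends of the trailing arc would be joined to a circle; its label would occur nowhere
    -- else.
    · rw [ea, eb, er, sub_id, List.map_id] at ha
      rcases ha with ha | ⟨d, ha⟩
      · exact absurd ha hb₁A
      · exact absurd ha (hδA d)
    -- The second end of the arc is joined with its neighbour: arc and join cancel, and up to
    -- renaming the tangle before the arc is obtained.
    · refine ⟨l, T, hN, by simp [Move.crossing?], ?_⟩
      rw [ea, er]
      have := hrep.relabel (sub b A) fun u v hu hv => hinj A b u v
        (by rintro rfl; exact hu.elim hb₁A fun ⟨d, hd⟩ => hδA d hd)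
        (by rintro rfl; exact hv.elim hb₁A fun ⟨d, hd⟩ => hδA d hd)
      rw [hb, List.map_cons, sub_self] at this
      refine this.of_isRotated ?_
      rw [List.map_append, List.map_singleton, sub_right]
      exact List.isRotated_append (l := [A])
    -- The same cancellation at the first end of the arc.
    · refine ⟨l, T, hN, by simp [Move.crossing?], ?_⟩
      rw [eb, er]
      have e1 : b'.map (sub A a) = b' := by
        conv_rhs => rw [← List.map_id b']
        exact List.map_congr_left fun z hz => sub_of_ne (by rintro rfl; exact hb₁A (by simp [hb, hz]))
      have e2 : (fun d => sub A a (δ d)) = δ := funext fun d => sub_of_ne (hδA d)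
      rw [List.map_cons, sub_self, e1, e2]
      rw [hb] at hrep
      exact hrep.of_isRotated List.isRotated_append
    -- Both joined points belong to the earlier tangle. The join is carried out there first, and the
    -- arc is added afterwards; this does not raise the girth.
    · have hAa : A ≠ a := by rintro e; exact hb₁A (by simp [hb, e])
      have hAb : A ≠ b := by rintro e; exact hb₁A (by simp [hb, e])
      have hz : ∀ z, z ≠ A → sub b a z ≠ A := fun z hz => by
        unfold sub; split_ifs
        · exact hAa.symm
        · exact hz
      subst er
      obtain ⟨l', T', k1, k2, k3⟩ := ih (a := a) (b := b) (β' := l₂ ++ l₁) hrep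
        (by rw [hb]; exact List.isRotated_append) (ha.imp_left fun h => by
          simp only [List.map_append, List.map_cons, List.mem_append, List.mem_cons, sub_of_ne hAb,
            hAa.symm, false_or] at h ⊢
          exact h)
      obtain ⟨p', hp', k4⟩ := k3.addCup (a := A) (β' := (l₁ ++ l₂).map (sub b a))
        (by rw [List.map_append, List.map_append]; exact List.isRotated_append)
        (fun h => by
          obtain ⟨z, hz', e⟩ := List.mem_map.1 h
          refine hz z ?_ e
          rintro rfl
          exact hb₁A (by rw [hb]; simp only [List.mem_append, List.mem_cons] at hz' ⊢; tauto))
        fun d => hz _ (hδA d)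
      have e1 := k3.length_eq
      have e2 : b₁.length = T.boundary.length := by simp [hb₁]
      rw [hb] at e2
      simp only [List.length_map, List.length_append, List.length_cons] at e1 e2
      refine ⟨_, _, k1.cup hp' (by omega), by
        rw [List.filterMap_append, List.filterMap_append, k2]; rfl, k4.of_isRotated ?_⟩
      simp only [List.map_append, List.map_cons, sub_of_ne hAb]
      exact List.isRotated_append (l := A :: A :: l₁.map (sub b a))
    -- The arc is the whole boundary and is closed from the other side, which again would give a
    -- circle.
    · rw [ea, eb, er, sub_id] at ha
      rcases ha with ha | ⟨d, ha⟩
      · simp at ha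
      · exact absurd ha (hδA d)

end straighten

/-! ### Transport of crossing steps between tangles with equal labels -/

section transport

variable {n g : ℕ} {T T' T1 : Tangle n} {β : List ℕ} {δ : Dart n → ℕ} {l : List (Move n)} {c : Fin n}

/-- Two tangles with the same labels at the boundary and at the half-edges, and with the half-edges
of `c` at the same places of the boundary. -/
def Sim (c : Fin n) (T T' : Tangle n) : Prop :=
  ∃ ℓ ℓ', Labelled T ℓ ∧ Labelled T' ℓ' ∧ (∀ d, ℓ (.dart d) = ℓ' (.dart d)) ∧
    T.boundary.map (fun x => (x.isAt c, ℓ x)) = T'.boundary.map (fun x => (x.isAt c, ℓ' x)) ∧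
    ∀ x', Valid T'.cups x' → ∃ x, Valid T.cups x ∧ ℓ x = ℓ' x'

theorem close_eq_some {ok : StrandEnd n → StrandEnd n → Bool} {q : ℕ} : T.close ok q = some T1 ↔
    q < T.boundary.length ∧ ∃ x y rest, T.boundary.rotate q = x :: y :: rest ∧ ok x y = true ∧
      T1 = ⟨rest, (x, y) :: T.joins, T.cups⟩ := by
  constructor
  · intro h
    unfold Tangle.close at h
    split_ifs at h with hq
    split at h
    · rename_i x y rest e
      split_ifs at h with hok
      simp only [Option.some.injEq] at h
      exact ⟨hq, x, y, rest, e, hok, h.symm⟩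
    · cases h
  · rintro ⟨hq, x, y, rest, e, hok, rfl⟩
    simp [Tangle.close, hq, e, hok]

theorem mem_of_rotate_eq {α : Type*} {b b' : List α} {q : ℕ} (h : b.rotate q = b') {z : α} (hz : z ∈ b') :
    z ∈ b := by
  rw [← h] at hz; exact List.mem_rotate.1 hz

/-- Whether a join is admissible depends only on which boundary points belong to `c`, and these
positions agree in the two tangles. -/
theorem Sim.close {q : ℕ} (h : Sim c T T')
    (h1 : T.close (fun x y => x.isAt c || y.isAt c) q = some T1) :
    ∃ T1', T'.close (fun x y => x.isAt c || y.isAt c) q = some T1' ∧ Sim c T1 T1' := by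
  obtain ⟨ℓ, ℓ', k1, k2, k3, k4, k5⟩ := h
  obtain ⟨hq, x, y, rest, e, hok, rfl⟩ := close_eq_some.1 h1
  have hlen := congrArg List.length k4
  simp only [List.length_map] at hlen
  have k6 := congrArg (List.rotate · q) k4
  simp only [← List.map_rotate, e] at k6
  have k6 := k6.symm
  simp only [List.map_cons] at k6
  rw [List.map_eq_cons_iff] at k6
  obtain ⟨x', t, e1, ex, k6⟩ := k6
  rw [List.map_eq_cons_iff] at k6
  obtain ⟨y', rest', rfl, ey, k6⟩ := k6
  simp only [Prod.mk.injEq] at ex ey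
  refine ⟨_, close_eq_some.2 ⟨hlen ▸ hq, x', y', rest', e1, by rw [ex.1, ey.1]; exact hok, rfl⟩, ?_⟩
  have hm : ∀ z, z ∈ x :: y :: rest → z ∈ T.boundary := fun z => mem_of_rotate_eq e
  have hm' : ∀ z, z ∈ x' :: y' :: rest' → z ∈ T'.boundary := fun z => mem_of_rotate_eq e1
  refine ⟨_, _, k1.cap (hm x (by simp)) (hm y (by simp)) (fun z hz => hm z (by simp [hz])),
    k2.cap (hm' x' (by simp)) (hm' y' (by simp)) (fun z hz => hm' z (by simp [hz])), fun d => ?_, ?_,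
    fun z hz => ?_⟩
  · simp only [Function.comp, k3, ex.2, ey.2]
  · have := congrArg (List.map (Prod.map id (sub (ℓ y) (ℓ x)))) k6
    simp only [List.map_map] at this
    rw [ex.2, ey.2]
    exact this.symm
  · obtain ⟨w, hw, ew⟩ := k5 z hz
    exact ⟨w, hw, by simp only [Function.comp, ew, ex.2, ey.2]⟩

theorem Sim.closes {qs : List ℕ} (h : Sim c T T')
    (h1 : qs.foldlM (Tangle.close fun x y => x.isAt c || y.isAt c) T = some T1) :
    ∃ T1', qs.foldlM (Tangle.close fun x y => x.isAt c || y.isAt c) T' = some T1' ∧ Sim c T1 T1' := by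
  induction qs generalizing T T' with
  | nil =>
    simp only [List.foldlM_nil, Option.pure_def, Option.some.injEq] at h1
    subst h1
    exact ⟨T', rfl, h⟩
  | cons q qs ih =>
    rw [List.foldlM_cons, Option.bind_eq_bind, Option.bind_eq_some_iff] at h1
    obtain ⟨T2, h2, h3⟩ := h1
    obtain ⟨T2', k1, k2⟩ := h.close h2
    obtain ⟨T1', k3, k4⟩ := ih k2 h3
    exact ⟨T1', by rw [List.foldlM_cons, Option.bind_eq_bind, k1]; exact k3, k4⟩

theorem Sim.rep (h : Sim c T T') (hT : T.Alive) : ∃ β δ, Rep T β δ ∧ Rep T' β δ := by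
  obtain ⟨ℓ, ℓ', k1, k2, k3, k4, k5⟩ := h
  have hr := k1.rep_of_alive hT
  have k6 : T.boundary.map ℓ = T'.boundary.map ℓ' := by
    have := congrArg (List.map Prod.snd) k4
    simp only [List.map_map] at this
    exact this
  refine ⟨_, _, hr, ℓ', k2, fun d => (k3 d).symm, by rw [k6], fun x' hx' => ?_⟩
  obtain ⟨x, hx, e⟩ := k5 x' hx'
  obtain ⟨y, h1, h2⟩ := hT x hx
  have e' := (k1.iff x y hx ((k1.wf.sameEdge_valid h1).1.1 hx)).1 h1
  rw [← e, e']
  rcases h2 with h2 | ⟨d, rfl⟩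
  · exact Or.inl (List.mem_map_of_mem h2)
  · exact Or.inr ⟨d, rfl⟩

/-- Put a crossing next to the tangle. -/
def Tangle.addCrossing (T : Tangle n) (c : Fin n) (j : Fin 4) (p : ℕ) : Tangle n :=
  ⟨[.dart (c, j), .dart (c, j + 1), .dart (c, j + 2), .dart (c, j + 3)] ++ T.boundary.rotate p,
    T.joins, T.cups⟩

theorem Tangle.BoundaryIn.isAt {A : List (Fin n)} (h : T.BoundaryIn A) (hc : c ∉ A) :
    ∀ x ∈ T.boundary, x.isAt c = false := fun x hx => by
  by_contra h'
  exact hc (h x hx c (by simpa using h'))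

theorem Labelled.addCrossing {ℓ : StrandEnd n → ℕ} (h : Labelled T ℓ) (c : Fin n) (j : Fin 4) (p : ℕ) :
    Labelled (T.addCrossing c j p) ℓ := by
  refine Labelled.of_boundary (b := T.boundary) h fun x hx => ?_
  rcases List.mem_append.1 hx with hx | hx
  · simp only [List.mem_cons, List.not_mem_nil, or_false] at hx
    rcases hx with rfl | rfl | rfl | rfl <;> trivial
  · exact h.wf.bdry x (List.mem_rotate.1 hx)

/-- A suitable rotation makes the two label words equal; since `c` is new, none of the old boundary
points belongs to it. -/
theorem Rep.exists_sim {A : List (Fin n)} (h : Rep T β δ) (h' : Rep T' β δ) (hT : T.BoundaryIn A)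
    (hT' : T'.BoundaryIn A) (hc : c ∉ A) (j : Fin 4) (p : ℕ) : ∃ p' ≤ T'.boundary.length,
    Sim c (T.addCrossing c j p) (T'.addCrossing c j p') := by
  obtain ⟨ℓ, k1, k2, k3, k4⟩ := h
  obtain ⟨ℓ', l1, l2, l3, l4⟩ := h'
  have hrot : (T'.boundary.map ℓ').IsRotated ((T.boundary.rotate p).map ℓ) := by
    rw [List.map_rotate]
    exact (l3.trans k3.symm).trans (List.IsRotated.forall _ _).symm
  obtain ⟨p', hp', e⟩ := exists_rotate_map hrot
  refine ⟨p', hp', ℓ, ℓ', k1.addCrossing c j p, l1.addCrossing c j p', fun d => by rw [k2, l2], ?_,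
    fun x' hx' => ?_⟩
  · have key : ∀ {S : Tangle n} {ℓ : StrandEnd n → ℕ} {p : ℕ}, S.BoundaryIn A →
        (S.boundary.rotate p).map (fun x => (x.isAt c, ℓ x)) =
          ((S.boundary.rotate p).map ℓ).map (fun z => (false, z)) := by
      intro S ℓ p hS
      rw [List.map_map]
      exact List.map_congr_left fun x hx => by simp [hS.isAt hc x (List.mem_rotate.1 hx)]
    simp only [Tangle.addCrossing, List.map_append, key hT, key hT', e]
    simp [k2, l2]
  · rcases l4 x' hx' with h | ⟨d, h⟩
    · rw [← k3.mem_iff] at h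
      obtain ⟨x, hx, e⟩ := List.mem_map.1 h
      exact ⟨x, k1.wf.bdry x hx, e⟩
    · exact ⟨.dart d, trivial, by rw [k2, h]⟩

theorem Run.boundaryIn {A : List (Fin n)} (h : Run g l T T') (hA : T.BoundaryIn A)
    (hnd : (A ++ l.filterMap Move.crossing?).Nodup) : T'.BoundaryIn (A ++ l.filterMap Move.crossing?) := by
  induction l generalizing T A with
  | nil =>
    have : T = T' := by simpa using h.1
    subst this; simpa using hA
  | cons mv l ih =>
    obtain ⟨h1, h2, h3⟩ := h
    rw [List.foldlM_cons, Option.bind_eq_bind, Option.bind_eq_some_iff] at h1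
    obtain ⟨T1, h4, h5⟩ := h1
    have e : A ++ (mv :: l).filterMap Move.crossing? =
        (A ++ [mv].filterMap Move.crossing?) ++ l.filterMap Move.crossing? := by
      rw [List.append_assoc, ← List.filterMap_append]; rfl
    rw [e] at hnd ⊢
    refine ih ⟨h5, h3 T1 h4⟩ (BoundaryIn_apply h4 hA fun c hc hcA => ?_).1 hnd
    exact (List.nodup_append.1 (List.nodup_append.1 hnd).1).2.2 c hcA c
      (List.mem_filterMap.2 ⟨mv, by simp, hc⟩) rfl

theorem Run.alive (h : Run g l T T') (hT : T.WF) (hT' : T'.Alive) : T.Alive :=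
  (h.2.mrun h.1).1.alive hT hT'

theorem rep_empty (n : ℕ) : Rep (Tangle.empty n) [] (fun d => Encodable.encode d) := by
  have he : ∀ x y, (Tangle.empty n).SameEdge x y ↔ x = y := by
    intro x y
    constructor
    · intro h
      induction h with
      | rel x y h =>
        rcases h with h | ⟨k, hk, -⟩
        · simp [Tangle.empty] at h
        · simp [Tangle.empty] at hk
      | refl x => rfl
      | symm _ _ _ ih => exact ih.symm
      | trans _ _ _ _ _ ih ih' => exact ih.trans ih'
    · rintro rfl; exact .refl _
  refine ⟨fun x => match x with | .dart d => Encodable.encode d | .cup _ _ => 0,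
    ⟨Tangle.empty_wf, fun x y hx hy => ?_⟩, fun d => rfl, by simp [Tangle.empty], fun x hx => ?_⟩
  · cases x with
    | dart d =>
      cases y with
      | dart e => simp [he]
      | cup k b => exact absurd hy (Nat.not_lt_zero k)
    | cup k b => exact absurd hx (Nat.not_lt_zero k)
  · cases x with
    | dart d => exact Or.inr ⟨d, rfl⟩
    | cup k b => exact absurd hx (Nat.not_lt_zero k)

theorem Tangle.Presents.alive {L : LinkDiagram n} (h : T.Presents L) : T.Alive := by
  intro x hx
  cases x with
  | dart d => exact ⟨.dart d, .refl _, Or.inr ⟨d, rfl⟩⟩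
  | cup k b =>
    obtain ⟨d, hd⟩ := h.2.2 k hx
    refine ⟨.dart d, ?_, Or.inr ⟨d, rfl⟩⟩
    cases b
    · exact hd
    · exact .trans _ _ _ (.symm _ _ (.rel _ _ (Or.inr ⟨k, hx, rfl, rfl⟩))) hd

theorem Tangle.Presents.of_rep {L : LinkDiagram n} (h : T.Presents L) (hT : Rep T β δ) (hT' : Rep T' β δ) :
    T'.Presents L := by
  have hβ : β = [] := by
    have := hT.length_eq
    rw [h.1] at this
    exact List.length_eq_zero_iff.1 this.symm
  subst hβ
  obtain ⟨ℓ, k1, k2, k3, k4⟩ := hT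
  obtain ⟨ℓ', l1, l2, l3, l4⟩ := hT'
  refine ⟨by simpa using l3, fun d e => ?_, fun k hk => ?_⟩
  · rw [← h.2.1 d e, l1.iff (.dart d) (.dart e) trivial trivial, k1.iff (.dart d) (.dart e) trivial trivial,
      k2, k2, l2, l2]
  · rcases l4 (.cup k false) hk with h | ⟨d, h⟩
    · simp at h
    · exact ⟨d, (l1.iff (.cup k false) (.dart d) hk trivial).2 (by rw [l2, h])⟩

end transport

/-! ### Straightening a whole cutting -/

section straightening

variable {n g : ℕ} {T T' Tf : Tangle n} {β : List ℕ} {δ : Dart n → ℕ} {l todo : List (Move n)}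

/-- The steps `todo` from `T` are replayed on an equivalent tangle `T'` that was reached by a
normalized sequence. A `cup` becomes a trailing arc, a `cap` is handled by `Norm.exists_cap`, and a
crossing turns all that precedes it, trailing arcs included, into a new base. -/
theorem exists_norm {A : List (Fin n)} (h : Run g todo T Tf) (hf : Tf.Alive) (hT : Rep T β δ)
    (hT' : Rep T' β δ) (hA : T.BoundaryIn A) (hl : Norm g A.length l T')
    (hlA : l.filterMap Move.crossing? = A) (hnd : (A ++ todo.filterMap Move.crossing?).Nodup) :
    ∃ l' T'', Norm g (A ++ todo.filterMap Move.crossing?).length l' T'' ∧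
      l'.filterMap Move.crossing? = A ++ todo.filterMap Move.crossing? ∧
      ∃ β δ, Rep Tf β δ ∧ Rep T'' β δ := by
  induction todo generalizing T T' β δ l A with
  | nil =>
    have : T = Tf := by simpa using h.1
    subst this
    exact ⟨l, T', by simpa using hl, by simpa using hlA, β, δ, hT, hT'⟩
  | cons mv todo ih =>
    obtain ⟨h1, h2, h3⟩ := h
    rw [List.foldlM_cons, Option.bind_eq_bind, Option.bind_eq_some_iff] at h1
    obtain ⟨T1, h4, h5⟩ := h1
    have hrun : Run g todo T1 Tf := ⟨h5, h3 T1 h4⟩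
    have hrun1 : Run g [mv] T T1 := Run.single h4 h2 hrun.head
    have hwf : T.WF := by obtain ⟨ℓ, h, -⟩ := hT; exact h.wf
    have hwf1 : T1.WF := (hrun1.2.mrun hrun1.1).1.wf hwf
    have halive := hrun.alive hwf1 hf
    have e : A ++ (mv :: todo).filterMap Move.crossing? =
        (A ++ [mv].filterMap Move.crossing?) ++ todo.filterMap Move.crossing? := by
      rw [List.append_assoc, ← List.filterMap_append]; rfl
    rw [e] at hnd ⊢
    have hA1 := hrun1.boundaryIn hA (List.nodup_append.1 hnd).1
    have hA' : T'.BoundaryIn A := by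
      have := hl.run.boundaryIn (A := []) (fun x hx => by simp [Tangle.empty] at hx)
        (by rw [hlA]; exact (List.nodup_append.1 (List.nodup_append.1 hnd).1).1)
      simpa [hlA] using this
    suffices hs : ∃ l' T1' β δ, Rep T1 β δ ∧ Rep T1' β δ ∧
        Norm g (A ++ [mv].filterMap Move.crossing?).length l' T1' ∧
        l'.filterMap Move.crossing? = A ++ [mv].filterMap Move.crossing? by
      obtain ⟨l', T1', β, δ, k1, k2, k3, k4⟩ := hs
      exact ih hrun k1 k2 hA1 k3 k4 hnd
    cases mv with
    | cup p =>
      have e : ([.cup p] : List (Move n)).filterMap Move.crossing? = [] := rfl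
      rw [e, List.append_nil]
      simp only [Move.apply] at h4
      split_ifs at h4 with hp
      simp only [Option.some.injEq] at h4
      subst h4
      obtain ⟨ℓ, k1, k2, k3, k4⟩ := hT
      have hβ : β.IsRotated ((T.boundary.rotate p).map ℓ) := by
        rw [List.map_rotate]; exact k3.symm.trans (List.IsRotated.forall _ _).symm
      obtain ⟨a, ha, ha'⟩ := exists_fresh ((T.boundary.rotate p).map ℓ) δ
      have m1 := k1.rep_addCup k2 rfl (fun x hx => by rw [← hβ.mem_iff]; exact k4 x hx) ha ha'
      obtain ⟨p', hp', m2⟩ := hT'.addCup hβ ha ha'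
      refine ⟨l ++ [.cup p'], _, _, _, m1, m2, hl.cup hp' ?_, by rw [List.filterMap_append, hlA]; simp [Move.crossing?]⟩
      have h6 := m1.length_eq
      have h7 := m2.length_eq
      have h8 := hrun.head
      rw [length_addCup] at h6 h7
      simp only [List.length_cons, List.length_rotate, List.length_map] at h6 h7 h8
      omega
    | cap q =>
      have e : ([.cap q] : List (Move n)).filterMap Move.crossing? = [] := rfl
      rw [e, List.append_nil]
      obtain ⟨hq, x, y, rest, e1, -, rfl⟩ := close_eq_some.1 h4
      obtain ⟨ℓ, k1, k2, k3, k4⟩ := hT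
      have hm : ∀ z, z ∈ x :: y :: rest → z ∈ T.boundary := fun z => mem_of_rotate_eq e1
      have hlab := k1.cap (b' := rest) (hm x (by simp)) (hm y (by simp)) fun z hz => hm z (by simp [hz])
      have m1 := hlab.rep_of_alive halive
      have hβ : β.IsRotated (ℓ x :: ℓ y :: rest.map ℓ) := by
        rw [← List.map_cons, ← List.map_cons, ← e1, List.map_rotate]
        exact k3.symm.trans (List.IsRotated.forall _ _).symm
      have e2 : (fun d : Dart n => (sub (ℓ y) (ℓ x) ∘ ℓ) (.dart d)) = fun d => sub (ℓ y) (ℓ x) (δ d) := by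
        funext d; rw [Function.comp, k2]
      rw [e2, ← List.map_map] at m1
      obtain ⟨l', T1', m2, m3, m4⟩ := hl.exists_cap hT' hβ (by
        obtain ⟨z, h1, h2⟩ := halive x (k1.wf.bdry x (hm x (by simp)))
        have vx := k1.wf.bdry x (hm x (by simp))
        have h3 := (hlab.iff x z vx ((hwf1.sameEdge_valid h1).1.1 vx)).1 h1
        rw [Function.comp, Function.comp, sub_right] at h3
        rcases h2 with h2 | ⟨d, rfl⟩
        · left
          rw [List.map_map]
          exact List.mem_map.2 ⟨z, h2, h3.symm⟩
        · exact Or.inr ⟨d, by rw [← k2, ← h3]⟩)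
      exact ⟨l', T1', _, _, m1, m4, m2, m3.trans hlA⟩
    | crossing c j p qs =>
      have e : ([.crossing c j p qs] : List (Move n)).filterMap Move.crossing? = [c] := rfl
      rw [e] at hnd ⊢
      have hcA : c ∉ A := fun h =>
        (List.nodup_append.1 (List.nodup_append.1 hnd).1).2.2 c h c (by simp) rfl
      simp only [Move.apply] at h4
      split_ifs at h4 with hp
      obtain ⟨p', hp', m1⟩ := hT.exists_sim hT' hA hA' hcA j p
      obtain ⟨T1', m2, m3⟩ := m1.closes h4
      obtain ⟨β', δ', m4, m5⟩ := m3.rep halive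
      have h6 := m4.length_eq
      have h7 := m5.length_eq
      have h8 := hrun.head
      have h9 := hl.run.last
      have h10 := hl.length_le
      refine ⟨l ++ [.crossing c j p' qs], T1', β', δ', m4, m5,
        .base (hl.run.append (Run.single (by simp only [Move.apply, if_pos hp']; exact m2) h9 (by omega))) ?_,
        by rw [List.filterMap_append, hlA]; rfl⟩
      simp only [List.length_append, List.length_singleton]
      -- The old length exceeds the old bound by at most half of the boundary, that is, by g / 2.
      -- Counted twice, with 2 for the new step and at most g for the new boundary, this is the
      -- increment 2 (g + 1).
      have : 2 * (A.length + 1) * (g + 1) = 2 * A.length * (g + 1) + 2 * g + 2 := by ring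
      omega

theorem exists_short_cutting {L : LinkDiagram n} (c : L.Cutting) :
    ∃ c' : L.Cutting, c'.girth ≤ c.girth ∧ c'.moves.length ≤ n * (c.girth + 1) := by
  obtain ⟨Tf, h1, h2⟩ := c.presents
  have hnd : (c.moves.filterMap Move.crossing?).Nodup := c.crossings.nodup_iff.2 (List.nodup_finRange n)
  obtain ⟨l, T, k1, k2, β, δ, k3, k4⟩ := exists_norm (A := []) (l := []) (T' := Tangle.empty n)
    ⟨h1, c.girthLe⟩ h2.alive (rep_empty n) (rep_empty n) (fun x hx => by simp [Tangle.empty] at hx)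
    (.base (Run.nil (by simp [Tangle.empty])) (by simp [Tangle.empty])) rfl (by simpa using hnd)
  rw [List.nil_append] at k1 k2
  have hT := h2.of_rep k3 k4
  obtain ⟨c', e, hc'⟩ := exists_cutting k1.run hT (by rw [k2]; exact c.crossings)
  refine ⟨c', hc', ?_⟩
  -- The last tangle has no boundary points, so nothing is added to the bound.
  have := k1.length_le
  rw [hT.1, c.crossings.length_eq, List.length_finRange, mul_assoc] at this
  rw [e]
  simp only [List.length_nil] at this
  omega

end straightening

/-! ## The main theorem -/

section girth

variable {n : ℕ} {L : LinkDiagram n}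

theorem LinkDiagram.Connected.pos (hL : L.Connected) : 1 ≤ n := by
  obtain ⟨c⟩ := hL.nonempty
  exact c.pos

theorem LinkDiagram.girth_le (c : L.Cutting) : L.girth ≤ c.girth := Nat.sInf_le ⟨c, rfl⟩

/-- Cuttings exist by `exists_cutting_le`, so the infimum that defines the girth is attained;
shortening such a cutting cannot raise its girth, and minimality gives equality. -/
theorem LinkDiagram.Connected.exists_short_cutting (hL : L.Connected) :
    ∃ c : L.Cutting, c.girth = L.girth ∧ c.moves.length ≤ n * (L.girth + 1) := by
  obtain ⟨c₀, -⟩ := exists_cutting_le hL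
  obtain ⟨c, hc⟩ : L.girth ∈ Set.range fun c : L.Cutting => c.girth := Nat.sInf_mem ⟨_, c₀, rfl⟩
  obtain ⟨c', h1, h2⟩ := KauffmanGirth.exists_short_cutting c
  have hc : c.girth = L.girth := hc
  rw [hc] at h1 h2
  exact ⟨c', h1.antisymm (LinkDiagram.girth_le c'), h2⟩

end girth

end KauffmanGirth

end

theorem mainTheorem6 :
    ∃ (code : List KauffmanGirth.Instr) (C : ℕ) (p : MvPolynomial (Fin 2) ℕ),
      ∀ (n : ℕ) (L : KauffmanGirth.LinkDiagram n), L.Connected →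
        (∃ c : L.Cutting, c.girth = L.girth ∧ c.moves.length ≤ n * (L.girth + 1)) ∧
        ∀ c : L.Cutting, c.girth = L.girth → c.moves.length ≤ n * (L.girth + 1) →
          KauffmanGirth.Computes code (L.encode ++ c.encode) L.bracket
            (2 ^ L.girth * MvPolynomial.eval ![n, L.girth] p)
            (C * (n * 2 ^ L.girth))
            (C * (n + L.girth)) := by
  refine ⟨KauffmanGirth.bracketCmd.compile 0, 150000, KauffmanGirth.timePoly, fun n L hL =>
    ⟨hL.exists_short_cutting, fun c hc hlen => ?_⟩⟩
  obtain ⟨c₀, hc₀⟩ := KauffmanGirth.exists_cutting_le hL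
  exact KauffmanGirth.computes_bracket hL.pos c hc
    ((KauffmanGirth.LinkDiagram.girth_le c₀).trans hc₀) hlen
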